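/- Conventions. An extended metric on a set $X$ is a metric that may have one infinitely remote point $\omega$: $d(x,\omega)=\infty$ for all $x\ne\omega$, $d(\omega,\omega)=0$, all other distances are finite, and such a point is unique if it exists. A quadruple $(x,y,z,u)$ is admissible if no entry occurs three or four times in it; its cross-ratio triple is $\big(d(x,y)d(z,u):d(x,z)d(y,u):d(x,u)d(y,z)\big)\in\mathbb{R}P^2$, where infinite factors cancel. A Möbius space is a set $X$ with a Möbius structure, i.e. an equivalence class of extended metrics with equal cross-ratio triples on all admissible quadruples. A Möbius map is an injective map preserving these cross-ratio triples; a Möbius automorphism is a bijective Möbius map $X\to X$. $X$ is compact if it is compact in the topology of a finite metric of the structure, and it is a Ptolemy space if $d(x,z)d(y,u)\le d(x,y)d(z,u)+d(x,u)d(y,z)$ for every metric $d$ of the structure and every admissible quadruple. An admissible quadruple $(x,z,y,u)$ is harmonic if $d(x,z)d(y,u)=d(x,u)d(y,z)$. An $\mathbb{R}$-circle (a $\mathbb{C}$-circle) is a subset of $X$ that is Möbius equivalent to $\mathbb{R}\cup\{\infty\}$ with the metric $|s-t|$ (respectively $|s-t|^{1/2}$). Let $X$ be a compact Ptolemy space such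 that: (E$_{\mathbb C}$) through every two distinct points there is a unique $\mathbb{C}$-circle; (E$_{\mathbb R}$) for every $\mathbb{C}$-circle $F$, $\omega\in F$ and $u\in X\setminus F$ there is a unique $\mathbb{R}$-circle through $\omega,u$ that intersects $F\setminus\{\omega\}$; (O) for every $\mathbb{R}$-circle $\sigma$ and every $\mathbb{C}$-circle $F$ with common distinct points $o,\omega$: if $u,v\in\sigma$ and $(o,u,\omega,v)$ is harmonic, then $(w,u,o,v)$ is harmonic for every $w\in F$; and if $x,y\in F$ and $(o,x,\omega,y)$ is harmonic, then $(w,x,\omega,y)$ is harmonic for every $w\in\sigma$. Fix $\omega\in X$, let $X_\omega=X\setminus\{\omega\}$ be endowed with a metric $|xy|$ of the Möbius structure with infinitely remote point $\omega$, and call $\mathbb{R}$-lines and $\mathbb{C}$-lines the sets $\sigma\setminus\{\omega\}$ for $\mathbb{R}$-circles, respectively $\mathbb{C}$-circles, $\sigma\ni\omega$. For an $\mathbb{R}$-line $\sigma$ the semi-$\mathbb{C}$-plane $R_\sigma\subset X_\omega$ is the union of all $\mathbb{C}$-lines meeting $\sigma$. If $F$ is the $\mathbb{C}$-line and $\sigma$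 an $\mathbb{R}$-line through $o\in X_\omega$, then $x\in R_\sigma$ has the coordinates $x_F$ and $x_\sigma$: $x_F=x$ if $x\in F$, and otherwise $x_F$ is the intersection point of $F$ with the $\mathbb{R}$-line through $x$ that meets $F$; and $x_\sigma$ is the intersection point of $\sigma$ with the $\mathbb{C}$-line through $x$. Proposition. Let $o\in X_\omega$ and $\lambda>0$, and let $F$ be the $\mathbb{C}$-line through $o$. There is exactly one map $h=h_{o,\lambda}:X_\omega\to X_\omega$, $h(o)=o$, such that (1) $h$ preserves $F$ and acts on it as the homothety $c(t)\mapsto c(\lambda^2t)$, for the parametrizations $c:\mathbb{R}\to F$ with $c(0)=o$, $|c(s)c(t)|=|s-t|^{1/2}$; (2) $h$ preserves every $\mathbb{R}$-line $\sigma$ through $o$ and acts on it as the homothety $c(t)\mapsto c(\lambda t)$, for the parametrizations $c:\mathbb{R}\to\sigma$ with $c(0)=o$, $|c(s)c(t)|=|s-t|$; (3) $h$ preserves every semi-$\mathbb{C}$-plane containing $F$, and on the semi-$\mathbb{C}$-plane $R_\sigma$ spanned by $F$ and an $\mathbb{R}$-line $\sigma$ through $o$ it acts coordinatewise: $h(x)_F=h(x_F)$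 and $h(x)_\sigma=h(x_\sigma)$. This map is a homothety of $X_\omega$ with coefficient $\lambda$, i.e. $|h(x)h(y)|=\lambda|xy|$ for all $x,y\in X_\omega$, and, extended by $h(\omega)=\omega$, it is a Möbius automorphism of $X$. -/

import Mathlib

open scoped ENNReal

/-! ### Extended metrics and cross-ratios -/

/-- `ω` is infinitely remote for `δ`: all other points have infinite distance to `ω`. -/
def IsRemotePoint {X : Type*} (δ : X → X → ℝ≥0∞) (ω : X) : Prop :=
  ∀ x, x ≠ ω → δ x ω = ⊤

/-- An extended metric on `X`: a metric for which one infinitely remote point is allowed; infinite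
distances occur only at an infinitely remote point, and such a point is unique if it exists. -/
structure ExtMetric (X : Type*) where
  dist : X → X → ℝ≥0∞
  dist_self : ∀ x, dist x x = 0
  eq_of_dist_eq_zero : ∀ x y, dist x y = 0 → x = y
  symm : ∀ x y, dist x y = dist y x
  triangle : ∀ x y z, dist x z ≤ dist x y + dist y z
  remote_of_top : ∀ x y, dist x y = ⊤ → IsRemotePoint dist x ∨ IsRemotePoint dist y
  remote_unique : ∀ ω ω', IsRemotePoint dist ω → IsRemotePoint dist ω' → ω = ω'

namespace ExtMetric

variable {X : Type*}

/-- `ω` is the infinitely remote point of `d`. -/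
def Remote (d : ExtMetric X) (ω : X) : Prop := IsRemotePoint d.dist ω

/-- `d` is an ordinary metric (no infinite distances). -/
def Finite (d : ExtMetric X) : Prop := ∀ x y, d.dist x y ≠ ⊤

/-- The metric space given by an extended metric without infinite distances. -/
@[reducible] noncomputable def toMetricSpace (d : ExtMetric X) (hd : d.Finite) : MetricSpace X where
  dist x y := (d.dist x y).toReal
  dist_self x := by simp [d.dist_self]
  dist_comm x y := by rw [d.symm]
  dist_triangle x y z := by
    rw [← ENNReal.toReal_add (hd x y) (hd y z)]
    exact ENNReal.toReal_mono (ENNReal.add_ne_top.2 ⟨hd x y, hd y z⟩) (d.triangle x y z)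
  eq_of_dist_eq_zero {x y} h := by
    rcases (ENNReal.toReal_eq_zero_iff _).1 h with h | h
    · exact d.eq_of_dist_eq_zero x y h
    · exact absurd h (hd x y)

open Classical in
/-- The real factor that `d x y` contributes to a homogeneous expression in the distances of a
quadruple. An infinite distance contributes `1`: in each of the three products of opposite
distances of a quadruple that contains the infinitely remote point once, exactly one factor is
infinite, and these factors cancel. -/
noncomputable def factor (d : ExtMetric X) (x y : X) : ℝ :=
  if d.dist x y = ⊤ then 1 else (d.dist x y).toReal

/-- Homogeneous coordinates of the cross-ratio triple
`(d(x,y)d(z,u) : d(x,z)d(y,u) : d(x,u)d(y,z))`. -/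
noncomputable def crt (d : ExtMetric X) (x y z u : X) : Fin 3 → ℝ :=
  ![d.factor x y * d.factor z u, d.factor x z * d.factor y u, d.factor x u * d.factor y z]

end ExtMetric

/-- Equality of points of the real projective plane given by homogeneous coordinates. -/
def SameProjPoint (a b : Fin 3 → ℝ) : Prop := ∃ k : ℝ, k ≠ 0 ∧ a = k • b

/-- A quadruple is admissible if no entry occurs three or four times in it. -/
def Admissible {X : Type*} (x y z u : X) : Prop :=
  ¬(x = y ∧ y = z) ∧ ¬(x = y ∧ y = u) ∧ ¬(x = z ∧ z = u) ∧ ¬(y = z ∧ z = u)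

/-- Two extended metrics are Möbius equivalent if they have the same cross-ratio triples on all
admissible quadruples. -/
def MoebiusEquivalent {X : Type*} (d d' : ExtMetric X) : Prop :=
  ∀ x y z u, Admissible x y z u → SameProjPoint (d.crt x y z u) (d'.crt x y z u)

/-! ### Möbius structures -/

/-- A Möbius structure on `X`: a Möbius equivalence class of extended metrics. -/
structure MoebiusStructure (X : Type*) where
  metrics : Set (ExtMetric X)
  nonempty : metrics.Nonempty
  equivalent : ∀ d ∈ metrics, ∀ d' ∈ metrics, MoebiusEquivalent d d'
  full : ∀ d ∈ metrics, ∀ d', MoebiusEquivalent d d' → d' ∈ metrics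

lemma SameProjPoint.refl (a : Fin 3 → ℝ) : SameProjPoint a a := ⟨1, one_ne_zero, by simp⟩

lemma SameProjPoint.symm {a b : Fin 3 → ℝ} (h : SameProjPoint a b) : SameProjPoint b a := by
  obtain ⟨k, hk, rfl⟩ := h
  exact ⟨k⁻¹, inv_ne_zero hk, by rw [smul_smul, inv_mul_cancel₀ hk, one_smul]⟩

lemma SameProjPoint.trans {a b c : Fin 3 → ℝ} (h : SameProjPoint a b) (h' : SameProjPoint b c) :
    SameProjPoint a c := by
  obtain ⟨k, hk, rfl⟩ := h
  obtain ⟨l, hl, rfl⟩ := h'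
  exact ⟨k * l, mul_ne_zero hk hl, by rw [smul_smul]⟩

/-- The Möbius structure generated by an extended metric. -/
def ExtMetric.moebiusStructure {X : Type*} (d : ExtMetric X) : MoebiusStructure X where
  metrics := {d' | MoebiusEquivalent d d'}
  nonempty := ⟨d, fun _ _ _ _ _ => SameProjPoint.refl _⟩
  equivalent := fun _ h₁ _ h₂ x y z u hQ => ((h₁ x y z u hQ).symm).trans (h₂ x y z u hQ)
  full := fun _ h₁ _ h₂ x y z u hQ => (h₁ x y z u hQ).trans (h₂ x y z u hQ)

/-- A Möbius map: injective, and preserving the cross-ratio triples of admissible quadruples. -/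
def IsMoebiusMap {X Y : Type*} (M : MoebiusStructure X) (N : MoebiusStructure Y) (f : X → Y) :
    Prop :=
  Function.Injective f ∧ ∀ d ∈ M.metrics, ∀ e ∈ N.metrics, ∀ x y z u, Admissible x y z u →
    SameProjPoint (e.crt (f x) (f y) (f z) (f u)) (d.crt x y z u)

/-- A Möbius automorphism: a bijective Möbius self-map. -/
def IsMoebiusAutomorphism {X : Type*} (M : MoebiusStructure X) (f : X → X) : Prop :=
  Function.Bijective f ∧ IsMoebiusMap M M f

/-! ### The extended real line and its square root -/

/-- The distance on `Y ∪ {∞}` that extends a distance on `Y` and has `∞` as remote point. -/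
noncomputable def extendedDist {Y : Type*} (δ : Y → Y → ℝ) : OnePoint Y → OnePoint Y → ℝ≥0∞
  | OnePoint.infty, OnePoint.infty => 0
  | OnePoint.infty, OnePoint.some _ => ⊤
  | OnePoint.some _, OnePoint.infty => ⊤
  | OnePoint.some x, OnePoint.some y => ENNReal.ofReal (δ x y)

/-- The extended metric on `Y ∪ {∞}`, with infinitely remote point `∞`, given by a metric `δ` on a
set `Y` with more than one point. -/
noncomputable def ExtMetric.ofMetric {Y : Type*} [Nontrivial Y] (δ : Y → Y → ℝ)
    (h_self : ∀ x, δ x x = 0) (h_pos : ∀ x y, x ≠ y → 0 < δ x y) (h_symm : ∀ x y, δ x y = δ y x)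
    (h_tri : ∀ x y z, δ x z ≤ δ x y + δ y z) : ExtMetric (OnePoint Y) where
  dist := extendedDist δ
  dist_self x := by
    cases x <;> simp [extendedDist, h_self]
  eq_of_dist_eq_zero x y h := by
    cases x <;> cases y <;> simp [extendedDist] at h ⊢
    by_contra hne
    exact absurd (h_pos _ _ hne) (not_lt.2 h)
  symm x y := by
    cases x <;> cases y <;> simp [extendedDist, h_symm]
  triangle x y z := by
    have hn : ∀ x y, 0 ≤ δ x y := fun x y => by
      by_cases h : x = y
      · rw [h, h_self]
      · exact (h_pos x y h).le
    cases x <;> cases y <;> cases z <;> simp [extendedDist]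
    rw [← ENNReal.ofReal_add (hn _ _) (hn _ _)]
    exact ENNReal.ofReal_le_ofReal (h_tri _ _ _)
  remote_of_top x y h := by
    cases x
    · left
      intro w hw
      cases w
      · exact absurd rfl hw
      · rfl
    · cases y
      · right
        intro w hw
        cases w
        · exact absurd rfl hw
        · rfl
      · simp [extendedDist] at h
  remote_unique := by
    have key : ∀ ω, IsRemotePoint (extendedDist δ) ω → ω = OnePoint.infty := by
      intro ω h
      cases ω with
      | infty => rfl
      | coe y =>
        obtain ⟨z, hz⟩ := exists_ne y
        have := h (OnePoint.some z) (by simpa using hz)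
        simp [extendedDist] at this
    intro ω ω' h h'
    rw [key ω h, key ω' h']

/-- The extended real line `ℝ ∪ {∞}` with the metric `|x - y|`. -/
noncomputable def extRealLine : ExtMetric (OnePoint ℝ) :=
  ExtMetric.ofMetric (fun x y => |x - y|) (by simp) (fun x y h => abs_pos.2 (sub_ne_zero.2 h))
    (fun x y => abs_sub_comm x y) (fun x y z => abs_sub_le x y z)

/-- The square root of the extended real line: `ℝ ∪ {∞}` with the metric `|x - y|^(1/2)`. -/
noncomputable def sqrtExtRealLine : ExtMetric (OnePoint ℝ) :=
  ExtMetric.ofMetric (fun x y => √|x - y|) (by simp)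
    (fun x y h => Real.sqrt_pos.2 (abs_pos.2 (sub_ne_zero.2 h)))
    (fun x y => by rw [abs_sub_comm])
    (fun x y z => (Real.sqrt_le_sqrt (abs_sub_le x y z)).trans
      (by
        rw [Real.sqrt_le_left (by positivity), add_sq, Real.sq_sqrt (abs_nonneg _),
          Real.sq_sqrt (abs_nonneg _)]
        nlinarith [mul_nonneg (Real.sqrt_nonneg |x - y|) (Real.sqrt_nonneg |y - z|)]))

/-! ### Ptolemy spaces, circles and the incidence axioms -/

namespace MoebiusStructure

variable {X : Type*} (M : MoebiusStructure X)

/-- `X` is compact in the topology of a (finite) metric of the Möbius structure. -/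
def Compact : Prop :=
  ∃ d ∈ M.metrics, ∃ hd : d.Finite,
    @CompactSpace X (d.toMetricSpace hd).toPseudoMetricSpace.toUniformSpace.toTopologicalSpace

/-- The Ptolemy inequality holds for every metric of the structure. -/
def Ptolemy : Prop :=
  ∀ d ∈ M.metrics, ∀ x y z u, Admissible x y z u →
    d.factor x z * d.factor y u ≤ d.factor x y * d.factor z u + d.factor x u * d.factor y z

/-- An `ℝ`-circle: a subset that is Möbius equivalent to the extended real line. -/
def IsRCircle (σ : Set X) : Prop :=
  ∃ f : OnePoint ℝ → X, IsMoebiusMap extRealLine.moebiusStructure M f ∧ Set.range f = σ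

/-- A `ℂ`-circle: a subset that is Möbius equivalent to the square root of the extended real
line. -/
def IsCCircle (F : Set X) : Prop :=
  ∃ f : OnePoint ℝ → X, IsMoebiusMap sqrtExtRealLine.moebiusStructure M f ∧ Set.range f = F

/-- The quadruple `(x, z, y, u)` is harmonic: it is admissible and its cross-ratio triple is
`(1 : * : 1)`, that is, `d(x,z) d(y,u) = d(x,u) d(y,z)`. -/
def Harmonic (x z y u : X) : Prop :=
  Admissible x z y u ∧
    ∀ d ∈ M.metrics, d.factor x z * d.factor y u = d.factor x u * d.factor y z

/-- Through every two distinct points there is a unique `ℂ`-circle. -/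
def AxiomEC : Prop :=
  ∀ x y : X, x ≠ y → ∃! F : Set X, M.IsCCircle F ∧ x ∈ F ∧ y ∈ F

/-- For every `ℂ`-circle `F`, `ω ∈ F` and `u ∉ F` there is a unique `ℝ`-circle through `ω`, `u`
that intersects `F \ {ω}`. -/
def AxiomER : Prop :=
  ∀ F : Set X, M.IsCCircle F → ∀ ω ∈ F, ∀ u ∉ F,
    ∃! σ : Set X, M.IsRCircle σ ∧ ω ∈ σ ∧ u ∈ σ ∧ (σ ∩ (F \ {ω})).Nonempty

/-- Given an `ℝ`-circle `σ` and a `ℂ`-circle `F` with common distinct points `o`, `ω`: if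
`u, v ∈ σ` and `(o, u, ω, v)` is harmonic, then `(w, u, o, v)` is harmonic for all `w ∈ F`. -/
def AxiomOC : Prop :=
  ∀ σ F : Set X, M.IsRCircle σ → M.IsCCircle F → ∀ o ω : X, o ≠ ω → o ∈ σ → o ∈ F → ω ∈ σ → ω ∈ F →
    ∀ u ∈ σ, ∀ v ∈ σ, M.Harmonic o u ω v → ∀ w ∈ F, M.Harmonic w u o v

/-- Given an `ℝ`-circle `σ` and a `ℂ`-circle `F` with common distinct points `o`, `ω`: if
`x, y ∈ F` and `(o, x, ω, y)` is harmonic, then `(w, x, ω, y)` is harmonic for all `w ∈ σ`. -/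
def AxiomOR : Prop :=
  ∀ σ F : Set X, M.IsRCircle σ → M.IsCCircle F → ∀ o ω : X, o ≠ ω → o ∈ σ → o ∈ F → ω ∈ σ → ω ∈ F →
    ∀ x ∈ F, ∀ y ∈ F, M.Harmonic o x ω y → ∀ w ∈ σ, M.Harmonic w x ω y

/-! ### Lines, projections and semi-`ℂ`-planes in `X_ω = X \ {ω}`

An `ℝ`-line (`ℂ`-line) in `X_ω` is represented by the `ℝ`-circle (`ℂ`-circle) through `ω` that
contains it. -/

/-- The circle `σ` gives an `ℝ`-line of `X_ω` through `o`. -/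
def IsRLine (ω o : X) (σ : Set X) : Prop := M.IsRCircle σ ∧ ω ∈ σ ∧ o ∈ σ ∧ o ≠ ω

/-- The circle `F` gives a `ℂ`-line of `X_ω` through `o`. -/
def IsCLine (ω o : X) (F : Set X) : Prop := M.IsCCircle F ∧ ω ∈ F ∧ o ∈ F ∧ o ≠ ω

/-- `p` is the projection `μ_{F,ω}(u)` of `u ∈ X_ω` to the `ℂ`-line `F \ {ω}`: `p = u` if `u ∈ F`;
otherwise `p` is the point where `F \ {ω}` is hit by the `ℝ`-circle through `ω` and `u` that
meets `F \ {ω}`. -/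
def IsVerticalProj (ω : X) (F : Set X) (u p : X) : Prop :=
  (u ∈ F ∧ p = u) ∨
    (u ∉ F ∧ p ∈ F ∧ p ≠ ω ∧ ∃ σ : Set X, M.IsRCircle σ ∧ ω ∈ σ ∧ u ∈ σ ∧ p ∈ σ)

/-- `p` is a point where the `ℝ`-line `σ \ {ω}` meets the `ℂ`-line through `u`. -/
def IsHorizontalProj (ω : X) (σ : Set X) (u p : X) : Prop :=
  p ∈ σ ∧ p ≠ ω ∧ ∃ G : Set X, M.IsCLine ω u G ∧ p ∈ G

/-- The semi-`ℂ`-plane `π_ω⁻¹(π_ω(σ)) ⊆ X_ω` over an `ℝ`-line `σ`, where `π_ω` maps a point of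
`X_ω` to the `ℂ`-circle through this point and `ω`: the union of all `ℂ`-lines that meet the
`ℝ`-line. -/
def semiCPlane (ω : X) (σ : Set X) : Set X :=
  {x | ∃ p ∈ σ, p ≠ ω ∧ ∃ G : Set X, M.IsCLine ω x G ∧ p ∈ G}

/-- `h` acts on the `ℝ`-line `σ \ {ω}` as the homothety with center `o` and coefficient `lam`:
`c t ↦ c (lam * t)` in unit speed parametrizations `c` with `c 0 = o`. -/
def ScalesRLine (d : ExtMetric X) (ω o : X) (lam : ℝ) (σ : Set X) (h : X → X) : Prop :=
  ∀ c : ℝ → X, Set.range c = σ \ {ω} → c 0 = o →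
    (∀ s t, d.dist (c s) (c t) = ENNReal.ofReal |s - t|) → ∀ t, h (c t) = c (lam * t)

/-- `h` acts on the `ℂ`-line `F \ {ω}` as the homothety with center `o` and coefficient `lam`.
In a parametrization `c` with `c 0 = o` and `d (c s) (c t) = |s - t|^(1/2)` this is
`c t ↦ c (lam ^ 2 * t)`. -/
def ScalesCLine (d : ExtMetric X) (ω o : X) (lam : ℝ) (F : Set X) (h : X → X) : Prop :=
  ∀ c : ℝ → X, Set.range c = F \ {ω} → c 0 = o →
    (∀ s t, d.dist (c s) (c t) = ENNReal.ofReal (√|s - t|)) → ∀ t, h (c t) = c (lam ^ 2 * t)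

/-- `h` is the map `h_{o,lam} : X_ω → X_ω`, extended to `X` by `h ω = ω`. It preserves the
`ℂ`-line `F` through `o` and all `ℝ`-lines `σ` through `o` and scales them by `lam`; it preserves
every semi-`ℂ`-plane that contains `F`, and acts coordinatewise, `(x_F, x_σ) ↦ (h x_F, h x_σ)`, on
the semi-`ℂ`-plane spanned by `F` and `σ`. The extended metric `d` has `ω` as infinitely remote
point. -/
structure IsPureHomothetyMap (d : ExtMetric X) (ω o : X) (lam : ℝ) (h : X → X) : Prop where
  map_omega : h ω = ω
  mapsTo : ∀ x, x ≠ ω → h x ≠ ω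
  map_center : h o = o
  image_cline : ∀ F, M.IsCLine ω o F → h '' F = F
  scales_cline : ∀ F, M.IsCLine ω o F → ScalesCLine d ω o lam F h
  image_rline : ∀ σ, M.IsRLine ω o σ → h '' σ = σ
  scales_rline : ∀ σ, M.IsRLine ω o σ → ScalesRLine d ω o lam σ h
  image_semiCPlane : ∀ F σ, M.IsCLine ω o F → M.IsRCircle σ → ω ∈ σ →
    F \ {ω} ⊆ M.semiCPlane ω σ → h '' M.semiCPlane ω σ = M.semiCPlane ω σ
  coordinatewise : ∀ F σ, M.IsCLine ω o F → M.IsRLine ω o σ →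
    ∀ x ∈ M.semiCPlane ω σ, ∀ xF xσ,
      M.IsVerticalProj ω F x xF → M.IsHorizontalProj ω σ x xσ →
        M.IsVerticalProj ω F (h x) (h xF) ∧ M.IsHorizontalProj ω σ (h x) (h xσ)

end MoebiusStructure

/-! ### Gauges and circles in terms of gauges -/

/-! Each metric of the structure is replaced by its real factor function, a gauge `q`. Möbius maps
become the maps that multiply `q` by a conformal factor `φ x * φ y`, and normalizing `q` at a point
makes that point infinitely remote.

Everything rests on the quartic law `IsCGeom.quartic`: if an ℝ-line and a ℂ-line meet in `o`, then
`|xy|⁴ = |xo|⁴ + |oy|⁴`. For fixed `x` the function `G t = |x e(t)|²` is even by (O). The ℝ-circle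
through `x` and `e w` meets the ℂ-line again in some `e η`, and (O) makes `G` equivariant under the
projective involution of the line that fixes `w` and `η`. Among the forms `α t² + β` below `G²`, the
one with the largest product `α β` is unique, hence respected by these involutions. So `w η` does
not depend on `w`, and `G²` is a quadratic polynomial.

By the quartic law the distance between two ℂ-lines depends on a difference of parameters only, so
coherently oriented ℂ-lines carry a one-parameter group of isometric shifts
(`IsCGeom.exists_shift`). Shifts `n a` fixing `ω` and `m b` fixing `o` act on `F` as `t ↦ t + a` and
`t ↦ t / (1 + b t)`, the two unipotent subgroups of `SL₂(ℝ)`. The word `dilation` acts on `F` as `t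
↦ l² t` and fixes `ω`, so it is a homothety of coefficient `l`; what is missing is its effect on the
ℝ-lines through `o`.

For points `x`, `x'` of such an ℝ-line, `|x', n_c m_b n_a x|⁴` is, up to a known factor, quadratic
in each of `a`, `b`, `c`. This determines it up to one defect `δ ≥ 0` (`IsFrame.exists_defect`). For
`x' = x` the defect vanishes because the ℂ-circle through `o` and a point is tangent to the ℂ-line
through that point (`IsFrame.exists_tangent`); the triangle inequality then removes it for `x' = c
(l * s)`. Hence the dilations converge on ℝ-lines to the required homothety as `b → 0`, and
compactness provides an ultrafilter limit on the whole space (`IsFrame.exists_homothety`).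

The limit is a Möbius bijection preserving the lines through `o`, so it respects the coordinates. It
is the only such map because a point off `F` is determined by its two coordinates
(`IsCGeom.eq_shift_of_coordinates`). -/

namespace MoebiusGauge

/-- The multiplicative distance profiles of the model circles: `x ↦ x` and `x ↦ √x`. -/
structure IsProfile (p : ℝ → ℝ) : Prop where
  map_zero : p 0 = 0
  map_pos : ∀ x, 0 < x → 0 < p x
  map_mul : ∀ x y, 0 ≤ x → 0 ≤ y → p (x * y) = p x * p y
  surj : ∀ y, 0 < y → ∃ x, 0 < x ∧ p x = y

lemma isProfile_id : IsProfile (fun x => x) :=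
  ⟨rfl, fun _ h => h, fun _ _ _ _ => rfl, fun y h => ⟨y, h, rfl⟩⟩

lemma isProfile_sqrt : IsProfile Real.sqrt :=
  ⟨Real.sqrt_zero, fun _ h => Real.sqrt_pos.2 h, fun x y hx _ => Real.sqrt_mul hx y,
    fun y h => ⟨y ^ 2, by positivity, Real.sqrt_sq h.le⟩⟩

lemma IsProfile.map_one {p : ℝ → ℝ} (hp : IsProfile p) : p 1 = 1 := by
  have h := hp.map_mul 1 1 zero_le_one zero_le_one
  have h1 := hp.map_pos 1 one_pos
  rw [mul_one] at h
  exact mul_left_cancel₀ h1.ne' (by linarith)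

lemma IsProfile.map_inv {p : ℝ → ℝ} (hp : IsProfile p) {x : ℝ} (hx : 0 < x) :
    p x⁻¹ = (p x)⁻¹ := by
  have h := hp.map_mul x x⁻¹ hx.le (inv_nonneg.2 hx.le)
  rw [mul_inv_cancel₀ hx.ne', hp.map_one] at h
  exact (inv_eq_of_mul_eq_one_right h.symm).symm

/-- The factor function of `ℝ ∪ {∞}` with the distance `p |s - t|`. -/
noncomputable def model (p : ℝ → ℝ) : OnePoint ℝ → OnePoint ℝ → ℝ
  | OnePoint.infty, OnePoint.infty => 0
  | OnePoint.infty, OnePoint.some _ => 1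
  | OnePoint.some _, OnePoint.infty => 1
  | OnePoint.some x, OnePoint.some y => p |x - y|

/-- A gauge: a real function of two points with the Ptolemy inequality, a representative of a
Möbius structure. -/
structure IsGauge {X : Type*} (q : X → X → ℝ) : Prop where
  symm : ∀ x y, q x y = q y x
  self : ∀ x, q x x = 0
  pos : ∀ x y, x ≠ y → 0 < q x y
  ptolemy : ∀ x y z u, q x z * q y u ≤ q x y * q z u + q x u * q y z

/-- A subset that is Möbius equivalent to the model circle with profile `p`. -/
def IsCircle {X : Type*} (p : ℝ → ℝ) (q : X → X → ℝ) (σ : Set X) : Prop :=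
  ∃ f : OnePoint ℝ → X, ∃ φ : OnePoint ℝ → ℝ, (∀ x, 0 < φ x) ∧
    (∀ x y, q (f x) (f y) = φ x * φ y * model p x y) ∧ Set.range f = σ

/-- A parametrized line with profile `p` that avoids `ω`. -/
def IsPar {X : Type*} (p : ℝ → ℝ) (q : X → X → ℝ) (ω : X) (c : ℝ → X) : Prop :=
  (∀ s, c s ≠ ω) ∧ ∀ s t, q (c s) (c t) = p |s - t|

/-- The gauge `q` is normalized at `ω`. -/
def NormalizedAt {X : Type*} (q : X → X → ℝ) (ω : X) : Prop := ∀ x, x ≠ ω → q x ω = 1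

/-! ### Circles through `ω` as parametrized lines -/

section Lines

variable {X : Type*} {p : ℝ → ℝ} {q : X → X → ℝ} {ω : X}

lemma IsGauge.eq_of_eq_zero (hq : IsGauge q) {x y : X} (h : q x y = 0) : x = y := by
  by_contra hne
  exact (hq.pos x y hne).ne' h

lemma IsGauge.nonneg (hq : IsGauge q) (x y : X) : 0 ≤ q x y := by
  by_cases h : x = y
  · rw [h, hq.self]
  · exact (hq.pos x y h).le

lemma IsGauge.triangle (hq : IsGauge q) (hω : NormalizedAt q ω) {x y z : X} (hx : x ≠ ω)
    (hy : y ≠ ω) (hz : z ≠ ω) : q x z ≤ q x y + q y z := by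
  have h := hq.ptolemy x y z ω
  rw [hω x hx, hω y hy, hω z hz] at h
  linarith

/-- The involution `s ↦ r + 1 / s` of the extended line, with `∞ ↦ r` and `0 ↦ ∞`. -/
noncomputable def invAt (r : ℝ) : OnePoint ℝ → OnePoint ℝ
  | OnePoint.infty => OnePoint.some r
  | OnePoint.some s => if s = 0 then OnePoint.infty else OnePoint.some (r + s⁻¹)

open Classical in
/-- The conformal factor of `invAt`. -/
noncomputable def invFactor (p : ℝ → ℝ) : OnePoint ℝ → ℝ
  | OnePoint.infty => 1
  | OnePoint.some s => if s = 0 then 1 else (p |s|)⁻¹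

lemma invFactor_pos (hp : IsProfile p) (x : OnePoint ℝ) : 0 < invFactor p x := by
  cases x with
  | infty => exact one_pos
  | coe s =>
    change 0 < (if s = 0 then 1 else (p |s|)⁻¹)
    split_ifs with h
    · exact one_pos
    · exact inv_pos.2 (hp.map_pos _ (abs_pos.2 h))

lemma model_invAt (hp : IsProfile p) (r : ℝ) (x y : OnePoint ℝ) :
    model p (invAt r x) (invAt r y) = invFactor p x * invFactor p y * model p x y := by
  have h0 := hp.map_zero
  cases x with
  | infty =>
    cases y with
    | infty => simp [invAt, model, h0]
    | coe t =>
      by_cases ht : t = 0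
      · simp [invAt, invFactor, model, ht]
      · simp [invAt, invFactor, model, ht, abs_inv, hp.map_inv (abs_pos.2 ht)]
  | coe s =>
    cases y with
    | infty =>
      by_cases hs : s = 0
      · simp [invAt, invFactor, model, hs]
      · simp [invAt, invFactor, model, hs, abs_inv, hp.map_inv (abs_pos.2 hs)]
    | coe t =>
      by_cases hs : s = 0 <;> by_cases ht : t = 0
      · simp [invAt, invFactor, model, hs, ht, h0]
      · have := hp.map_pos _ (abs_pos.2 ht)
        simp [invAt, invFactor, model, hs, ht, this.ne']
      · have := hp.map_pos _ (abs_pos.2 hs)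
        simp [invAt, invFactor, model, hs, ht, this.ne']
      · have e : r + s⁻¹ - (r + t⁻¹) = (t - s) * (s⁻¹ * t⁻¹) := by field_simp; ring
        simp only [invAt, invFactor, model, hs, ht, if_false]
        rw [e, abs_mul, abs_mul, hp.map_mul _ _ (abs_nonneg _) (by positivity),
          hp.map_mul _ _ (abs_nonneg _) (by positivity), abs_inv, abs_inv,
          hp.map_inv (abs_pos.2 hs), hp.map_inv (abs_pos.2 ht), abs_sub_comm]
        ring

lemma invAt_surjective (r : ℝ) : Function.Surjective (invAt r) := by
  intro y
  cases y with
  | infty => exact ⟨OnePoint.some 0, by simp [invAt]⟩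
  | coe t =>
    by_cases h : t = r
    · exact ⟨OnePoint.infty, by simp [invAt, h]⟩
    · refine ⟨OnePoint.some (t - r)⁻¹, ?_⟩
      have : t - r ≠ 0 := sub_ne_zero.2 h
      simp [invAt, this]

/-- The model circle is homogeneous: `invAt` moves any finite parameter to `∞` and changes the model
only conformally. -/
lemma IsCircle.exists_map_infty (hp : IsProfile p) {σ : Set X} (hσ : IsCircle p q σ)
    (hω : ω ∈ σ) : ∃ f : OnePoint ℝ → X, ∃ φ : OnePoint ℝ → ℝ, (∀ x, 0 < φ x) ∧
    (∀ x y, q (f x) (f y) = φ x * φ y * model p x y) ∧ Set.range f = σ ∧ f OnePoint.infty = ω := by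
  obtain ⟨f, φ, hφ, hf, rfl⟩ := hσ
  obtain ⟨x0, hx0⟩ := hω
  cases x0 with
  | infty => exact ⟨f, φ, hφ, hf, rfl, hx0⟩
  | coe r =>
    refine ⟨f ∘ invAt r, fun x => φ (invAt r x) * invFactor p x,
      fun x => mul_pos (hφ _) (invFactor_pos hp x), fun x y => ?_, ?_, hx0⟩
    · simp only [Function.comp]
      rw [hf, model_invAt hp]
      ring
    · exact (invAt_surjective r).range_comp f

/-- With `ω` at the parameter `∞`, normalization forces the conformal factor to be constant on
finite parameters. The map is then a similarity, and surjectivity of the profile allows rescaling it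
to unit speed. -/
lemma IsCircle.exists_par (hp : IsProfile p) (hq : IsGauge q) (hn : NormalizedAt q ω) {σ : Set X}
    (hσ : IsCircle p q σ) (hω : ω ∈ σ) {o : X} (ho : o ∈ σ) (hne : o ≠ ω) :
    ∃ c, IsPar p q ω c ∧ c 0 = o ∧ Set.range c = σ \ {ω} := by
  obtain ⟨f, φ, hφ, hf, rfl, hfω⟩ := hσ.exists_map_infty hp hω
  have hfs : ∀ s : ℝ, f (OnePoint.some s) ≠ ω := by
    intro s hs
    have h := hf (OnePoint.some s) OnePoint.infty
    rw [hs, hfω, hq.self] at h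
    have := mul_pos (hφ (OnePoint.some s)) (hφ OnePoint.infty)
    simp only [model, mul_one] at h
    linarith
  have hφs : ∀ s : ℝ, φ (OnePoint.some s) = (φ OnePoint.infty)⁻¹ := by
    intro s
    have h := hf (OnePoint.some s) OnePoint.infty
    rw [hfω, hn _ (hfs s)] at h
    simp only [model, mul_one] at h
    exact eq_inv_of_mul_eq_one_left h.symm
  obtain ⟨y0, hy0⟩ := ho
  cases y0 with
  | infty => exact absurd (hy0.symm.trans hfω) hne
  | coe r =>
    obtain ⟨k, hk, hpk⟩ := hp.surj (φ OnePoint.infty * φ OnePoint.infty)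
      (mul_pos (hφ _) (hφ _))
    refine ⟨fun s => f (OnePoint.some (r + k * s)), ⟨fun s => hfs _, fun s t => ?_⟩, ?_, ?_⟩
    · change q (f (OnePoint.some (r + k * s))) (f (OnePoint.some (r + k * t))) = _
      rw [hf, hφs, hφs]
      simp only [model]
      have e : r + k * s - (r + k * t) = k * (s - t) := by ring
      rw [e, abs_mul, abs_of_pos hk, hp.map_mul _ _ hk.le (abs_nonneg _), hpk]
      have := (hφ OnePoint.infty).ne'
      field_simp
    · simpa using hy0
    · ext x
      constructor
      · rintro ⟨s, rfl⟩
        exact ⟨⟨_, rfl⟩, hfs _⟩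
      · rintro ⟨⟨y, rfl⟩, hy⟩
        cases y with
        | infty => exact absurd hfω hy
        | coe y =>
          refine ⟨(y - r) / k, ?_⟩
          have : r + k * ((y - r) / k) = y := by field_simp; simp
          simp only [this]

lemma IsPar.isCircle (hq : IsGauge q) (hn : NormalizedAt q ω) {c : ℝ → X} (hc : IsPar p q ω c) :
    IsCircle p q (insert ω (Set.range c)) := by
  refine ⟨fun x => match x with
    | OnePoint.infty => ω
    | OnePoint.some s => c s, fun _ => 1, fun _ => one_pos, fun x y => ?_, ?_⟩
  · cases x with
    | infty =>
      cases y with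
      | infty => simp [model, hq.self]
      | coe t =>
        change q ω (c t) = 1 * 1 * 1
        rw [hq.symm, hn _ (hc.1 t)]; ring
    | coe s =>
      cases y with
      | infty =>
        change q (c s) ω = 1 * 1 * 1
        rw [hn _ (hc.1 s)]; ring
      | coe t =>
        change q (c s) (c t) = 1 * 1 * p |s - t|
        rw [hc.2]; ring
  · ext x
    constructor
    · rintro ⟨y, rfl⟩
      cases y with
      | infty => exact Or.inl rfl
      | coe s => exact Or.inr ⟨s, rfl⟩
    · rintro (rfl | ⟨s, rfl⟩)
      · exact ⟨OnePoint.infty, rfl⟩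
      · exact ⟨OnePoint.some s, rfl⟩

lemma IsPar.injective (hp : IsProfile p) (hq : IsGauge q) {c : ℝ → X} (hc : IsPar p q ω c) :
    Function.Injective c := by
  intro s t h
  by_contra hne
  have h1 := hc.2 s t
  rw [h, hq.self] at h1
  exact absurd h1 (hp.map_pos _ (abs_pos.2 (sub_ne_zero.2 hne))).ne

lemma IsPar.shift {c : ℝ → X} (hc : IsPar p q ω c) (a : ℝ) : IsPar p q ω (fun s => c (a + s)) :=
  ⟨fun s => hc.1 _, fun s t => by rw [hc.2]; congr 2; ring⟩

lemma IsPar.neg {c : ℝ → X} (hc : IsPar p q ω c) : IsPar p q ω (fun s => c (-s)) :=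
  ⟨fun s => hc.1 _, fun s t => by rw [hc.2, abs_sub_comm]; congr 2; ring⟩

lemma range_shift (c : ℝ → X) (a : ℝ) : Set.range (fun s => c (a + s)) = Set.range c :=
  (add_left_surjective a).range_comp c

/-- Two functions on the line with the same distances from a common range differ by a
reflection at most. -/
lemma IsPar.eq_or_eq_neg (hp : IsProfile p) (hinj : Set.InjOn p (Set.Ici 0)) (hq : IsGauge q)
    {c c' : ℝ → X} (hc : IsPar p q ω c) (hc' : IsPar p q ω c') (h0 : c' 0 = c 0)
    (hr : Set.range c' ⊆ Set.range c) : (∀ t, c' t = c t) ∨ ∀ t, c' t = c (-t) := by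
  have hch : ∀ t, ∃ s, c s = c' t := fun t => hr ⟨t, rfl⟩
  choose g hg using hch
  have hg0 : g 0 = 0 := hc.injective hp hq (by rw [hg, h0])
  have hd : ∀ s t, |g s - g t| = |s - t| := by
    intro s t
    have h1 := hc.2 (g s) (g t)
    rw [hg, hg, hc'.2] at h1
    exact (hinj (Set.mem_Ici.2 (abs_nonneg _)) (Set.mem_Ici.2 (abs_nonneg _)) h1).symm
  have habs : ∀ t, g t = t ∨ g t = -t := by
    intro t
    have := hd t 0
    rw [hg0, sub_zero, sub_zero] at this
    exact abs_eq_abs.1 this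
  have h1 := habs 1
  rcases h1 with h1 | h1
  · left
    intro t
    rw [← hg]
    congr 1
    rcases habs t with h | h
    · exact h
    · have := hd t 1
      rw [h1, h] at this
      rcases abs_eq_abs.1 this with h2 | h2
      · linarith
      · have : t = 0 := by linarith
        rw [h, this, neg_zero]
  · right
    intro t
    rw [← hg]
    congr 1
    rcases habs t with h | h
    · have := hd t 1
      rw [h1, h] at this
      rcases abs_eq_abs.1 this with h2 | h2
      · linarith
      · have : t = 0 := by linarith
        rw [h, this, neg_zero]
    · exact h

end Lines

/-! ### The incidence conditions in terms of a gauge -/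

/-- `R`-circles of a gauge. -/
abbrev IsR {X : Type*} (q : X → X → ℝ) (σ : Set X) : Prop := IsCircle (fun x => x) q σ

/-- `C`-circles of a gauge. -/
abbrev IsC {X : Type*} (q : X → X → ℝ) (F : Set X) : Prop := IsCircle Real.sqrt q F

/-- Parametrized `R`-lines. -/
abbrev RPar {X : Type*} (q : X → X → ℝ) (ω : X) (c : ℝ → X) : Prop := IsPar (fun x => x) q ω c

/-- Parametrized `C`-lines. -/
abbrev CPar {X : Type*} (q : X → X → ℝ) (ω : X) (c : ℝ → X) : Prop := IsPar Real.sqrt q ω c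

/-- A gauge that satisfies the incidence conditions. -/
structure IsCGeom {X : Type*} (q : X → X → ℝ) : Prop extends IsGauge q where
  existsUnique_C : ∀ x y : X, x ≠ y → ∃! F : Set X, IsC q F ∧ x ∈ F ∧ y ∈ F
  existsUnique_R : ∀ F : Set X, IsC q F → ∀ ω ∈ F, ∀ u ∉ F,
    ∃! σ : Set X, IsR q σ ∧ ω ∈ σ ∧ u ∈ σ ∧ (σ ∩ (F \ {ω})).Nonempty
  harmonic_C : ∀ σ F : Set X, IsR q σ → IsC q F → ∀ o ω : X, o ≠ ω → o ∈ σ → o ∈ F → ω ∈ σ → ω ∈ F →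
    ∀ u ∈ σ, ∀ v ∈ σ, u ≠ o → u ≠ ω → v ≠ o → v ≠ ω → q o u * q ω v = q o v * q u ω →
    ∀ w ∈ F, q w u * q o v = q w v * q u o
  harmonic_R : ∀ σ F : Set X, IsR q σ → IsC q F → ∀ o ω : X, o ≠ ω → o ∈ σ → o ∈ F → ω ∈ σ → ω ∈ F →
    ∀ x ∈ F, ∀ y ∈ F, x ≠ o → x ≠ ω → y ≠ o → y ≠ ω → q o x * q ω y = q o y * q x ω →
    ∀ w ∈ σ, q w x * q ω y = q w y * q x ω

/-! ### Invariance under conformal change and normalization at a point -/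

section GaugeChange

variable {X : Type*} {p : ℝ → ℝ} {q : X → X → ℝ} {ψ : X → ℝ}

/-- Multiplication of a gauge by a conformal factor. -/
def rescale (ψ : X → ℝ) (q : X → X → ℝ) : X → X → ℝ := fun x y => ψ x * ψ y * q x y

lemma IsCircle.rescale (hψ : ∀ x, 0 < ψ x) {σ : Set X} (h : IsCircle p q σ) :
    IsCircle p (rescale ψ q) σ := by
  obtain ⟨f, φ, hφ, hf, hr⟩ := h
  refine ⟨f, fun x => ψ (f x) * φ x, fun x => mul_pos (hψ _) (hφ _), fun x y => ?_, hr⟩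
  simp only [MoebiusGauge.rescale, hf]
  ring

lemma rescale_inv (hψ : ∀ x, 0 < ψ x) : rescale (fun x => (ψ x)⁻¹) (rescale ψ q) = q := by
  funext x y
  have h1 := (hψ x).ne'
  have h2 := (hψ y).ne'
  simp only [rescale]
  field_simp

lemma isCircle_rescale_iff (hψ : ∀ x, 0 < ψ x) {σ : Set X} :
    IsCircle p (rescale ψ q) σ ↔ IsCircle p q σ := by
  refine ⟨fun h => ?_, fun h => h.rescale hψ⟩
  have := h.rescale (ψ := fun x => (ψ x)⁻¹) (fun x => inv_pos.2 (hψ x))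
  rwa [rescale_inv hψ] at this

lemma rescale_eq_iff (hψ : ∀ x, 0 < ψ x) (a b c d : X) :
    rescale ψ q a b * rescale ψ q c d = rescale ψ q a d * rescale ψ q b c ↔
      q a b * q c d = q a d * q b c := by
  have h : ψ a * ψ b * (ψ c * ψ d) ≠ 0 :=
    (mul_pos (mul_pos (hψ a) (hψ b)) (mul_pos (hψ c) (hψ d))).ne'
  simp only [rescale]
  constructor
  · intro h1
    apply mul_left_cancel₀ h
    linarith
  · intro h1
    linear_combination ψ a * ψ b * (ψ c * ψ d) * h1

lemma IsGauge.rescale (hq : IsGauge q) (hψ : ∀ x, 0 < ψ x) : IsGauge (rescale ψ q) where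
  symm x y := by simp only [MoebiusGauge.rescale, hq.symm x y]; ring
  self x := by simp [MoebiusGauge.rescale, hq.self]
  pos x y h := mul_pos (mul_pos (hψ _) (hψ _)) (hq.pos x y h)
  ptolemy x y z u := by
    simp only [MoebiusGauge.rescale]
    have h : 0 ≤ ψ x * ψ y * (ψ z * ψ u) :=
      (mul_pos (mul_pos (hψ x) (hψ y)) (mul_pos (hψ z) (hψ u))).le
    have := mul_le_mul_of_nonneg_left (hq.ptolemy x y z u) h
    linarith

lemma IsCGeom.rescale (hq : IsCGeom q) (hψ : ∀ x, 0 < ψ x) : IsCGeom (rescale ψ q) where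
  toIsGauge := hq.toIsGauge.rescale hψ
  existsUnique_C := by simpa only [IsC, isCircle_rescale_iff hψ] using hq.existsUnique_C
  existsUnique_R := by simpa only [IsC, IsR, isCircle_rescale_iff hψ] using hq.existsUnique_R
  harmonic_C σ F hσ hF o ω hoω h1 h2 h3 h4 u hu v hv huo huω hvo hvω h w hw := by
    have hσ := (isCircle_rescale_iff hψ).1 hσ
    have hF := (isCircle_rescale_iff hψ).1 hF
    rw [rescale_eq_iff hψ] at h ⊢
    exact hq.harmonic_C σ F hσ hF o ω hoω h1 h2 h3 h4 u hu v hv huo huω hvo hvω h w hw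
  harmonic_R σ F hσ hF o ω hoω h1 h2 h3 h4 u hu v hv huo huω hvo hvω h w hw := by
    have hσ := (isCircle_rescale_iff hψ).1 hσ
    have hF := (isCircle_rescale_iff hψ).1 hF
    rw [rescale_eq_iff hψ] at h ⊢
    exact hq.harmonic_R σ F hσ hF o ω hoω h1 h2 h3 h4 u hu v hv huo huω hvo hvω h w hw

open Classical in
/-- The conformal factor that normalizes a gauge at `a`. -/
noncomputable def normFactor (q : X → X → ℝ) (a x : X) : ℝ := if x = a then 1 else (q x a)⁻¹

/-- The gauge `q` normalized at `a`. -/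
noncomputable def normAt (q : X → X → ℝ) (a : X) : X → X → ℝ := rescale (normFactor q a) q

lemma normFactor_pos (hq : IsGauge q) (a x : X) : 0 < normFactor q a x := by
  unfold normFactor
  split_ifs with h
  · exact one_pos
  · exact inv_pos.2 (hq.pos x a h)

lemma normalizedAt_normAt (hq : IsGauge q) (a : X) : NormalizedAt (normAt q a) a := by
  intro x hx
  have := (hq.pos x a hx).ne'
  simp [normAt, rescale, normFactor, hx, this]

lemma normAt_apply (q : X → X → ℝ) {a x y : X} (hx : x ≠ a) (hy : y ≠ a) :
    normAt q a x y = q x y / (q x a * q y a) := by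
  simp only [normAt, rescale, normFactor, hx, hy, if_false]
  field_simp

lemma IsCGeom.normAt (hq : IsCGeom q) (a : X) : IsCGeom (normAt q a) :=
  hq.rescale (normFactor_pos hq.toIsGauge a)

end GaugeChange

/-! ### The quartic law for an `R`-line and a `C`-line with a common point -/

/-- If the midpoint of two points of a superlevel set of `αβ` is no better than the first point,
the points agree. -/
lemma eq_of_mul_mid_le {α β α' β' : ℝ} (hα : 0 < α) (hβ : 0 < β) (hα' : 0 ≤ α') (hβ' : 0 ≤ β')
    (h : α * β ≤ α' * β') (hm : (α + α') / 2 * ((β + β') / 2) ≤ α * β) : α' = α := by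
  have hP : 0 < α * β := mul_pos hα hβ
  set x := α * β' with hx
  set y := α' * β with hy
  have hx0 : 0 ≤ x := mul_nonneg hα.le hβ'
  have hy0 : 0 ≤ y := mul_nonneg hα' hβ.le
  have e1 : (α + α') / 2 * ((β + β') / 2) = (α * β + x + y + α' * β') / 4 := by
    rw [hx, hy]; ring
  have h1 : x + y ≤ 2 * (α * β) := by rw [e1] at hm; linarith
  -- Equality case of the arithmetic-geometric mean inequality: `x + y ≤ 2αβ`, while `x y ≥ (αβ)²`.
  have e2 : x * y = (α * β) * (α' * β') := by rw [hx, hy]; ring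
  have h2 : (α * β) * (α * β) ≤ x * y := by rw [e2]; exact mul_le_mul_of_nonneg_left h hP.le
  have h3 : (x + y) * (x + y) ≤ 2 * (α * β) * (2 * (α * β)) :=
    mul_self_le_mul_self (by linarith) h1
  have h4 : (x - y) * (x - y) ≤ 0 := by
    have h5 : (x - y) * (x - y) = (x + y) * (x + y) - 4 * (x * y) := by ring
    linarith
  have h5 : x - y = 0 := mul_self_eq_zero.1 (le_antisymm h4 (mul_self_nonneg _))
  have h6 : x = y := by linarith
  rw [h6] at h1 h2
  have h7 : α * β ≤ y := le_of_not_gt fun hlt => by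
    have := mul_self_lt_mul_self hy0 hlt
    linarith
  exact mul_right_cancel₀ hβ.ne' (le_antisymm (by linarith) h7)

/-- The reflection of the line with fixed points `w` and `η` transports lower bounds by quadratic
forms. -/
lemma reflected_form_le {G : ℝ → ℝ} {α β w η : ℝ} (hα1 : α ≤ 1)
    (hle : ∀ t, α * t ^ 2 + β ≤ G t ^ 2) (hne : η ≠ w) (hm : G ((w + η) / 2) = |w - η| / 2)
    (hrel : ∀ t t', t ≠ w → t ≠ η → t' ≠ w → t' ≠ η → |η - t| * |w - t'| = |η - t'| * |w - t| →
        G t * |w - t'| = G t' * |w - t|) (t : ℝ) :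
    α * ((w + η) / 2 * t - w * η) ^ 2 + β * (t - (w + η) / 2) ^ 2 ≤
      G t ^ 2 * ((w - η) / 2) ^ 2 := by
  set m := (w + η) / 2 with hmdef
  set E := ((w - η) / 2) ^ 2 with hE
  have hwη : w - η ≠ 0 := sub_ne_zero.2 (Ne.symm hne)
  have hEpos : 0 < E := by positivity
  have hE' : E = m ^ 2 - w * η := by rw [hE, hmdef]; ring
  have hmE : G m ^ 2 = E := by rw [hm, hE, div_pow, sq_abs, div_pow]
  by_cases htw : t = w
  · have e1 : (m * t - w * η) ^ 2 = t ^ 2 * E := by rw [htw, hE, hmdef]; ring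
    have e2 : (t - m) ^ 2 = E := by rw [htw, hE, hmdef]; ring
    rw [e1, e2]
    linarith [mul_le_mul_of_nonneg_right (hle t) hEpos.le]
  by_cases htη : t = η
  · have e1 : (m * t - w * η) ^ 2 = t ^ 2 * E := by rw [htη, hE, hmdef]; ring
    have e2 : (t - m) ^ 2 = E := by rw [htη, hE, hmdef]; ring
    rw [e1, e2]
    linarith [mul_le_mul_of_nonneg_right (hle t) hEpos.le]
  -- The involution sends the midpoint `m` to infinity, where the form is controlled by `α ≤ 1`
  -- instead of a value of `G`.
  by_cases htm : t = m
  · rw [htm, sub_self, hmE]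
    have e1 : (m * m - w * η) = E := by rw [hE']; ring
    rw [e1]
    linarith [mul_le_mul_of_nonneg_right hα1 (mul_pos hEpos hEpos).le]
  have htm' : t - m ≠ 0 := sub_ne_zero.2 htm
  have hP : (m * t - w * η) / (t - m) * (t - m) = m * t - w * η := div_mul_cancel₀ _ htm'
  -- The image of `t` under the projective involution with fixed points `w` and `η`; `t` and `t'`
  -- separate these harmonically.
  set t' := (m * t - w * η) / (t - m) with ht'
  have h20 : 2 * (t - m) ≠ 0 := mul_ne_zero two_ne_zero htm'
  have ew : w - t' = (w - η) * (t - w) / (2 * (t - m)) := by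
    rw [eq_div_iff h20]; linear_combination (-2) * hP + (-2 * w - 2 * t) * hmdef
  have eη : η - t' = (w - η) * (η - t) / (2 * (t - m)) := by
    rw [eq_div_iff h20]; linear_combination (-2) * hP + (-2 * η - 2 * t) * hmdef
  have htw0 : t - w ≠ 0 := sub_ne_zero.2 htw
  have htη0 : η - t ≠ 0 := sub_ne_zero.2 (Ne.symm htη)
  have h1 : t' ≠ w := by
    intro hh
    have : w - t' ≠ 0 := by rw [ew]; exact div_ne_zero (mul_ne_zero hwη htw0) h20
    exact this (by rw [hh, sub_self])
  have h2 : t' ≠ η := by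
    intro hh
    have : η - t' ≠ 0 := by rw [eη]; exact div_ne_zero (mul_ne_zero hwη htη0) h20
    exact this (by rw [hh, sub_self])
  have h3 := hrel t t' htw htη h1 h2 (by
    rw [ew, eη, abs_sub_comm w t]; simp only [abs_div, abs_mul]; ring)
  have h5 : (G t * |w - t'|) ^ 2 = (G t' * |w - t|) ^ 2 := by rw [h3]
  have ew2 : (w - t') ^ 2 * (t - m) ^ 2 = E * (t - w) ^ 2 := by
    rw [ew, hE]; field_simp
  rw [mul_pow, mul_pow, sq_abs, sq_abs] at h5
  have h4 : G t ^ 2 * E = G t' ^ 2 * (t - m) ^ 2 := by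
    apply mul_left_cancel₀ (pow_ne_zero 2 htw0)
    linear_combination (t - m) ^ 2 * h5 - G t ^ 2 * ew2
  rw [h4, ← hP]
  linarith [mul_le_mul_of_nonneg_right (hle t') (sq_nonneg (t - m))]

/-- An even function on the line that is invariant under a reflection for every point is the
square root of a quadratic polynomial. -/
lemma sq_eq_of_reflections (G : ℝ → ℝ) (k : ℝ) (hk : 0 < k) (hG0 : G 0 = k)
    (heven : ∀ t, G (-t) = G t) (hGt : ∀ t, |t| ≤ G t) (hGk : ∀ t, k ≤ G t)
    (h : ∀ w, w ≠ 0 → ∃ η, η ≠ w ∧ G ((w + η) / 2) = |w - η| / 2 ∧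
      ∀ t t', t ≠ w → t ≠ η → t' ≠ w → t' ≠ η → |η - t| * |w - t'| = |η - t'| * |w - t| →
        G t * |w - t'| = G t' * |w - t|) (t : ℝ) : G t ^ 2 = t ^ 2 + k ^ 2 := by
  have hGpos : ∀ t, 0 < G t := fun t => hk.trans_le (hGk t)
  -- Even quadratic forms below `G²`. The bounds on the coefficients make `S` compact, and a
  -- maximizer of `α β` plays the role of an extremal ellipse.
  set S : Set (ℝ × ℝ) :=
    {z | (z.1 ∈ Set.Icc (0 : ℝ) 1 ∧ z.2 ∈ Set.Icc 0 (k ^ 2)) ∧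
      ∀ t, z.1 * t ^ 2 + z.2 ≤ G t ^ 2} with hS
  have hScomp : IsCompact S := by
    refine (isCompact_Icc.prod isCompact_Icc :
      IsCompact (Set.Icc (0 : ℝ) 1 ×ˢ Set.Icc 0 (k ^ 2))).of_isClosed_subset ?_
      (fun z hz => ⟨hz.1.1, hz.1.2⟩)
    have h1 : IsClosed {z : ℝ × ℝ | ∀ t, z.1 * t ^ 2 + z.2 ≤ G t ^ 2} := by
      simp only [Set.ofPred_forall]
      exact isClosed_iInter fun t => isClosed_le (by fun_prop) continuous_const
    have h2 : IsClosed {z : ℝ × ℝ | z.1 ∈ Set.Icc (0 : ℝ) 1 ∧ z.2 ∈ Set.Icc 0 (k ^ 2)} :=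
      (isClosed_Icc.preimage continuous_fst).inter (isClosed_Icc.preimage continuous_snd)
    exact h2.inter h1
  have hmem0 : ((1 / 2 : ℝ), k ^ 2 / 2) ∈ S := by
    refine ⟨⟨⟨by norm_num, by norm_num⟩, ⟨by positivity, by nlinarith [sq_nonneg k]⟩⟩, fun t => ?_⟩
    have h1 : t ^ 2 ≤ G t ^ 2 := by
      rw [← sq_abs t]; exact pow_le_pow_left₀ (abs_nonneg t) (hGt t) 2
    have h2 : k ^ 2 ≤ G t ^ 2 := pow_le_pow_left₀ hk.le (hGk t) 2
    simp only
    linarith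
  obtain ⟨⟨α, β⟩, hαβ, hmax⟩ := hScomp.exists_isMaxOn ⟨_, hmem0⟩
    (f := fun z : ℝ × ℝ => z.1 * z.2) (by fun_prop)
  obtain ⟨⟨⟨hα0, hα1⟩, hβ0, hβk⟩, hle⟩ := hαβ
  simp only at hα0 hα1 hβ0 hβk hle
  have hpos : 0 < α * β := by
    have := hmax hmem0
    simp only [Set.mem_ofPred_eq] at this
    nlinarith [sq_pos_of_pos hk]
  have hα : 0 < α := by
    rcases hα0.lt_or_eq with h | h
    · exact h
    · rw [← h] at hpos; simp at hpos
  have hβ : 0 < β := pos_of_mul_pos_right hpos hα0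
  have key : ∀ w, w ≠ 0 → ∃ η, α * (w * η) + β = 0 ∧
      G ((w + η) / 2) ^ 2 = ((w + η) / 2) ^ 2 - w * η := by
    intro w hw
    obtain ⟨η, hne, hm, hrel⟩ := h w hw
    refine ⟨η, ?_, ?_⟩
    swap
    · rw [hm, div_pow, sq_abs]; ring
    set m := (w + η) / 2 with hmdef
    set E := ((w - η) / 2) ^ 2 with hE
    have hwη : w - η ≠ 0 := sub_ne_zero.2 (Ne.symm hne)
    have hEpos : 0 < E := by positivity
    have hE' : E = m ^ 2 - w * η := by rw [hE, hmdef]; ring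
    have hmE : G m ^ 2 = E := by rw [hm, hE, div_pow, sq_abs, div_pow]
    have hQ := reflected_form_le hα1 hle hne hm hrel
    rw [← hmdef, ← hE] at hQ
    -- The transported form lies below `G²`, and so does its average over `t` and `-t` because `G`
    -- is even. Averaging drops the cross term and leaves `α' t² + β'`.
    set α' := (α * m ^ 2 + β) / E with hα'
    set β' := (α * (w * η) ^ 2 + β * m ^ 2) / E with hβ'
    have eα' : α' * E = α * m ^ 2 + β := by rw [hα']; field_simp
    have eβ' : β' * E = α * (w * η) ^ 2 + β * m ^ 2 := by rw [hβ']; field_simp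
    have hα'0 : 0 ≤ α' := by positivity
    have hβ'0 : 0 ≤ β' := by positivity
    have hle' : ∀ t, α' * t ^ 2 + β' ≤ G t ^ 2 := by
      intro t
      have h1 := hQ t
      have h2 := hQ (-t)
      rw [heven] at h2
      refine le_of_mul_le_mul_right ?_ hEpos
      have : (α' * t ^ 2 + β') * E = (α' * E) * t ^ 2 + β' * E := by ring
      rw [this, eα', eβ']
      linarith
    have hα'1 : α' ≤ 1 := by
      have := hle m
      rw [hmE] at this
      rw [hα', div_le_one hEpos]
      exact this
    -- The involution preserves the determinant of the form, and dropping the cross term increases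
    -- it by a square. So `α' β' ≥ α β`, and maximality at the midpoint of the two forms gives `α' =
    -- α`, that is `α w η + β = 0`.
    have hdet : (α' * β') * E ^ 2 = (α * β) * E ^ 2 + (m * (α * (w * η) + β)) ^ 2 := by
      have : (α' * β') * E ^ 2 = (α' * E) * (β' * E) := by ring
      rw [this, eα', eβ', hE']
      ring
    have hmem : ((α + α') / 2, (β + β') / 2) ∈ S := by
      refine ⟨⟨⟨by positivity, ?_⟩, by positivity, ?_⟩, fun t => ?_⟩
      · simp only; linarith
      · have := hle' 0
        rw [hG0] at this
        simp only; nlinarith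
      · have h1 := hle t
        have h2 := hle' t
        simp only; linarith
    have hprod : α * β ≤ α' * β' := by
      refine le_of_mul_le_mul_right ?_ (pow_pos hEpos 2)
      rw [hdet]
      linarith [sq_nonneg (m * (α * (w * η) + β))]
    have hmx : (α + α') / 2 * ((β + β') / 2) ≤ α * β := hmax hmem
    have hαα : α' = α := eq_of_mul_mid_le hα hβ hα'0 hβ'0 hprod hmx
    have : α' * E = α * m ^ 2 + β := eα'
    rw [hαα, hE'] at this
    linarith
  set K := β / α with hK
  have hKpos : 0 < K := div_pos hβ hα
  have hall : ∀ t, G t ^ 2 = t ^ 2 + K := by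
    intro t
    -- Chosen so that the partner `η = -K / w` is `t - √(t ^ 2 + K)` and the midpoint of `w` and `η`
    -- is the prescribed `t`.
    set w := t + √(t ^ 2 + K) with hw
    have hs : 0 ≤ t ^ 2 + K := by positivity
    have hsq := Real.sq_sqrt hs
    have hwne : w ≠ 0 := by
      intro h0
      have : √(t ^ 2 + K) = -t := by linarith
      rw [this] at hsq
      linarith [neg_sq t]
    obtain ⟨η, h1, h2⟩ := key w hwne
    have h3 : w * η = -K := by
      rw [hK]; field_simp; linarith
    have h4 : η = t - √(t ^ 2 + K) := by
      apply mul_left_cancel₀ hwne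
      rw [h3, hw]; linear_combination hsq
    have h5 : (w + η) / 2 = t := by rw [h4, hw]; ring
    rw [h5, h3] at h2
    linarith
  have := hall 0
  rw [hG0] at this
  rw [hall t]
  linarith

/-! ### The quartic law from the orthogonality axioms -/

section Quartic

variable {X : Type*} {q : X → X → ℝ} {ω : X}

/-- The points `r s` and `r (-s)` are harmonic with respect to `r 0` and `ω`, so (O) makes them
equidistant from every point of the ℂ-line. -/
lemma IsCGeom.even_R (hq : IsCGeom q) (hn : NormalizedAt q ω) {r e : ℝ → X} (hr : RPar q ω r)
    (he : CPar q ω e) (h0 : r 0 = e 0) (s t : ℝ) : q (e t) (r (-s)) = q (e t) (r s) := by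
  by_cases hs : s = 0
  · simp [hs]
  have hi := hr.injective isProfile_id hq.toIsGauge
  have h := hq.harmonic_C _ _ (hr.isCircle hq.toIsGauge hn) (he.isCircle hq.toIsGauge hn) (r 0) ω
    (hr.1 0) (Or.inr ⟨0, rfl⟩) (Or.inr ⟨0, h0.symm⟩) (Or.inl rfl) (Or.inl rfl) (r s)
    (Or.inr ⟨s, rfl⟩) (r (-s)) (Or.inr ⟨-s, rfl⟩) (fun h => hs (hi h)) (hr.1 _)
    (fun h => hs (neg_eq_zero.1 (hi h))) (hr.1 _) (by
      rw [hr.2, hr.2, hq.symm ω, hn _ (hr.1 _), hn _ (hr.1 _)]; simp) (e t) (Or.inr ⟨t, rfl⟩)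
  rw [hr.2, hr.2] at h
  simp only [sub_neg_eq_add, zero_add, sub_zero] at h
  exact (mul_right_cancel₀ (abs_pos.2 hs).ne' h).symm

lemma IsCGeom.even_C (hq : IsCGeom q) (hn : NormalizedAt q ω) {r e : ℝ → X} (hr : RPar q ω r)
    (he : CPar q ω e) (h0 : r 0 = e 0) (s t : ℝ) : q (r s) (e (-t)) = q (r s) (e t) := by
  by_cases ht : t = 0
  · simp [ht]
  have hi := he.injective isProfile_sqrt hq.toIsGauge
  have h := hq.harmonic_R _ _ (hr.isCircle hq.toIsGauge hn) (he.isCircle hq.toIsGauge hn) (r 0) ω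
    (hr.1 0) (Or.inr ⟨0, rfl⟩) (Or.inr ⟨0, h0.symm⟩) (Or.inl rfl) (Or.inl rfl) (e t)
    (Or.inr ⟨t, rfl⟩) (e (-t)) (Or.inr ⟨-t, rfl⟩) (fun h => ht (hi (h.trans h0))) (he.1 _)
    (fun h => ht (neg_eq_zero.1 (hi (h.trans h0)))) (he.1 _) (by
      rw [h0, he.2, he.2, hq.symm ω, hn _ (he.1 _), hn _ (he.1 _)]; simp) (r s) (Or.inr ⟨s, rfl⟩)
  rw [hq.symm ω, hn _ (he.1 _), hn _ (he.1 _), mul_one, mul_one] at h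
  exact h.symm

/-- A common point would by evenness have distance zero from its mirror image on the ℝ-line. -/
lemma IsCGeom.eq_zero_of_meet (hq : IsCGeom q) (hn : NormalizedAt q ω) {r e : ℝ → X}
    (hr : RPar q ω r) (he : CPar q ω e) (h0 : r 0 = e 0) {a b : ℝ} (h : r a = e b) :
    a = 0 ∧ b = 0 := by
  have h1 := hq.even_R hn hr he h0 a b
  rw [h, hq.self] at h1
  have h2 := hr.injective isProfile_id hq.toIsGauge (h.trans (hq.toIsGauge.eq_of_eq_zero h1))
  have ha : a = 0 := by linarith
  refine ⟨ha, ?_⟩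
  rw [ha, h0] at h
  exact (he.injective isProfile_sqrt hq.toIsGauge h).symm

/-- The ℝ-circle through `e w` and `r s` meets the ℂ-circle again at `e η`. Axiom (O) for this pair
of circles compares the distances from `r s` to any two points harmonic with respect to `e w` and `e
η`. -/
lemma IsCGeom.exists_reflection (hq : IsCGeom q) (hn : NormalizedAt q ω) {r e : ℝ → X}
    (hr : RPar q ω r) (he : CPar q ω e) (h0 : r 0 = e 0) {s : ℝ} (hs : s ≠ 0) {w : ℝ}
    (hw : w ≠ 0) : ∃ η, η ≠ w ∧ q (r s) (e ((w + η) / 2)) ^ 2 = |w - η| / 2 ∧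
      ∀ t t', t ≠ w → t ≠ η → t' ≠ w → t' ≠ η → |η - t| * |w - t'| = |η - t'| * |w - t| →
        q (r s) (e t) ^ 2 * |w - t'| = q (r s) (e t') ^ 2 * |w - t| := by
  have hF := he.isCircle hq.toIsGauge hn
  have hR := hr.isCircle hq.toIsGauge hn
  have hi := he.injective isProfile_sqrt hq.toIsGauge
  have huF : r s ∉ insert ω (Set.range e) := by
    rintro (h | ⟨t, h⟩)
    · exact hr.1 _ h
    · exact hs (hq.eq_zero_of_meet hn hr he h0 h.symm).1
  obtain ⟨σ, ⟨hσ, hwσ, huσ, z, hzσ, hzF, hzw⟩, -⟩ :=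
    hq.existsUnique_R _ hF (e w) (Or.inr ⟨w, rfl⟩) (r s) huF
  rcases hzF with hz | ⟨η, hz⟩
  -- If the second intersection were `ω`, the ℝ-circle would be the given ℝ-line, which meets the
  -- ℂ-line only at parameter `0`.
  · exfalso
    have huniq := (hq.existsUnique_R _ hF ω (Or.inl rfl) (r s) huF).unique
      ⟨hσ, hz ▸ hzσ, huσ, e w, hwσ, Or.inr ⟨w, rfl⟩, he.1 w⟩
      ⟨hR, Or.inl rfl, Or.inr ⟨s, rfl⟩, r 0, Or.inr ⟨0, rfl⟩, Or.inr ⟨0, h0.symm⟩, hr.1 0⟩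
    rw [huniq] at hwσ
    rcases hwσ with h | ⟨a, h⟩
    · exact he.1 w h
    · exact hw (hq.eq_zero_of_meet hn hr he h0 h).2
  subst hz
  have hηw : η ≠ w := fun h => hzw (by rw [h]; rfl)
  have hne : e η ≠ e w := fun h => hηw (hi h)
  have hOR := hq.harmonic_R σ _ hσ hF (e η) (e w) hne hzσ (Or.inr ⟨η, rfl⟩) hwσ (Or.inr ⟨w, rfl⟩)
  refine ⟨η, hηw, ?_, ?_⟩
  · have hwη : w - η ≠ 0 := sub_ne_zero.2 hηw.symm
    have e1 : w - (w + η) / 2 = (w - η) / 2 := by ring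
    have e2 : η - (w + η) / 2 = -((w - η) / 2) := by ring
    -- The harmonic partner of `ω` is the midpoint of `w` and `η`; this fixes the value of the
    -- distance there.
    have h := hOR ω (Or.inl rfl) (e ((w + η) / 2)) (Or.inr ⟨_, rfl⟩) (he.1 _).symm (he.1 _).symm
      (fun h => by have := hi h; apply hwη; linarith)
      (fun h => by have := hi h; apply hwη; linarith)
      (by rw [hn _ (he.1 _), he.2, he.2, hq.symm ω, hn _ (he.1 _), e1, e2, abs_neg]; ring)
      (r s) huσ
    rw [hn _ (hr.1 _), hq.symm ω, hn _ (he.1 _), he.2, e1, one_mul, mul_one] at h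
    rw [← h, Real.sq_sqrt (abs_nonneg _), abs_div]
    norm_num
  · intro t t' h1 h2 h3 h4 hrel
    have h := hOR (e t) (Or.inr ⟨t, rfl⟩) (e t') (Or.inr ⟨t', rfl⟩) (fun h => h2 (hi h))
      (fun h => h1 (hi h)) (fun h => h4 (hi h)) (fun h => h3 (hi h)) (by
        rw [he.2, he.2, he.2, he.2, ← Real.sqrt_mul (abs_nonneg _), ← Real.sqrt_mul (abs_nonneg _),
          hrel, abs_sub_comm t w]) (r s) huσ
    rw [he.2, he.2] at h
    have hsq : (q (r s) (e t) * √|w - t'|) ^ 2 = (q (r s) (e t') * √|t - w|) ^ 2 := by rw [h]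
    rwa [mul_pow, mul_pow, Real.sq_sqrt (abs_nonneg _), Real.sq_sqrt (abs_nonneg _),
      abs_sub_comm t w] at hsq

/-- The quartic law: for an `R`-line and a `C`-line through a common point `o`, the distances of
their points satisfy `|xy|⁴ = |xo|⁴ + |oy|⁴`. -/
lemma IsCGeom.quartic (hq : IsCGeom q) (hn : NormalizedAt q ω) {r e : ℝ → X}
    (hr : RPar q ω r) (he : CPar q ω e) (h0 : r 0 = e 0) (s t : ℝ) :
    q (r s) (e t) ^ 4 = s ^ 4 + t ^ 2 := by
  by_cases hs : s = 0
  · rw [hs, h0, he.2, zero_sub, abs_neg]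
    have : √|t| ^ 4 = (√|t| ^ 2) ^ 2 := by ring
    rw [this, Real.sq_sqrt (abs_nonneg _), sq_abs]
    ring
  have hG : ∀ t, 0 ≤ q (r s) (e t) := fun t => hq.toIsGauge.nonneg _ _
  have hsym : ∀ t, q (e t) (r (-s)) = q (r s) (e t) := fun t => by
    rw [hq.even_R hn hr he h0, hq.symm]
  have hss : |s - -s| = 2 * |s| := by
    rw [sub_neg_eq_add, ← two_mul, abs_mul, abs_two]
  have hs0 : 0 < |s| := abs_pos.2 hs
  -- Both lower bounds compare with the mirror image `r (-s)`: first by the triangle inequality,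
  -- then by the Ptolemy inequality for `e t`, `r s`, `e 0`, `r (-s)`.
  have hlow : ∀ t, |s| ≤ q (r s) (e t) := by
    intro t
    have h1 := hq.toIsGauge.triangle hn (hr.1 s) (he.1 t) (hr.1 (-s))
    rw [hr.2, hsym, hss] at h1
    linarith
  have hlow2 : ∀ t, √|t| ≤ q (r s) (e t) := by
    intro t
    have h1 := hq.ptolemy (e t) (r s) (e 0) (r (-s))
    rw [← h0, hr.2, hr.2, hr.2, hsym, h0, he.2, hss, hq.symm (e t)] at h1
    simp only [sub_zero, zero_sub, neg_neg] at h1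
    nlinarith
  have key := sq_eq_of_reflections (fun t => q (r s) (e t) ^ 2) (s ^ 2) (by positivity)
    (by simp only [← h0, hr.2, sub_zero, sq_abs])
    (fun t => by simp only [hq.even_C hn hr he h0])
    (fun t => by
      have := pow_le_pow_left₀ (Real.sqrt_nonneg _) (hlow2 t) 2
      rwa [Real.sq_sqrt (abs_nonneg _)] at this)
    (fun t => by
      have := pow_le_pow_left₀ (abs_nonneg _) (hlow t) 2
      rwa [sq_abs] at this)
    (fun w hw => hq.exists_reflection hn hr he h0 hs hw) t
  linear_combination key

end Quartic

/-! ### Fibers and vertical shifts -/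

lemma sqrt_abs_pow_four (x : ℝ) : √|x| ^ 4 = x ^ 2 := by
  have : √|x| ^ 4 = (√|x| ^ 2) ^ 2 := by ring
  rw [this, Real.sq_sqrt (abs_nonneg _), sq_abs]

lemma pow_four_inj {a b : ℝ} (ha : 0 ≤ a) (hb : 0 ≤ b) (h : a ^ 4 = b ^ 4) : a = b :=
  (pow_left_inj₀ ha hb (by norm_num)).1 h

lemma real_isometry {g : ℝ → ℝ} (h : ∀ s t, (g s - g t) ^ 2 = (s - t) ^ 2) :
    (∀ t, g t = t + g 0) ∨ ∀ t, g t = -t + g 0 := by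
  have h0 : ∀ t, g t = t + g 0 ∨ g t = -t + g 0 := by
    intro t
    have := sq_eq_sq_iff_eq_or_eq_neg.1 (h t 0)
    rcases this with h | h
    · left; linarith
    · right; linarith
  rcases h0 1 with h1 | h1
  · left
    intro t
    rcases h0 t with h2 | h2
    · exact h2
    · have := h t 1
      rw [h1, h2] at this
      have : t = 0 := by linarith
      rw [this]; ring
  · right
    intro t
    rcases h0 t with h2 | h2
    · have := h t 1
      rw [h1, h2] at this
      have : t = 0 := by linarith
      rw [this]; ring
    · exact h2

section Fibers

variable {X : Type*} {q : X → X → ℝ} {ω : X}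

lemma IsCGeom.exists_cpar (hq : IsCGeom q) (hn : NormalizedAt q ω) {x : X} (hx : x ≠ ω) :
    ∃ e, CPar q ω e ∧ e 0 = x := by
  obtain ⟨F, ⟨hF, hxF, hωF⟩, -⟩ := hq.existsUnique_C x ω hx
  obtain ⟨e, he, h0, -⟩ := hF.exists_par isProfile_sqrt hq.toIsGauge hn hωF hxF hx
  exact ⟨e, he, h0⟩

lemma IsCGeom.range_cpar_eq (hq : IsCGeom q) (hn : NormalizedAt q ω) {e e' : ℝ → X}
    (he : CPar q ω e) (he' : CPar q ω e') {s t : ℝ} (h : e s = e' t) :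
    Set.range e = Set.range e' := by
  have h1 := (hq.existsUnique_C (e s) ω (he.1 s)).unique
    ⟨he.isCircle hq.toIsGauge hn, Or.inr ⟨s, rfl⟩, Or.inl rfl⟩
    ⟨he'.isCircle hq.toIsGauge hn, Or.inr ⟨t, h.symm⟩, Or.inl rfl⟩
  have hne : ω ∉ Set.range e := by rintro ⟨s, hs⟩; exact he.1 s hs
  have hne' : ω ∉ Set.range e' := by rintro ⟨s, hs⟩; exact he'.1 s hs
  ext x
  constructor
  · intro hx
    have : x ∈ insert ω (Set.range e') := h1 ▸ Or.inr hx
    rcases this with h2 | h2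
    · exact absurd (h2 ▸ hx) hne
    · exact h2
  · intro hx
    have : x ∈ insert ω (Set.range e) := h1 ▸ Or.inr hx
    rcases this with h2 | h2
    · exact absurd (h2 ▸ hx) hne'
    · exact h2

lemma IsCGeom.exists_rpar_foot (hq : IsCGeom q) (hn : NormalizedAt q ω) {e : ℝ → X}
    (he : CPar q ω e) {u : X} (hu : u ≠ ω) (hue : u ∉ Set.range e) :
    ∃ r t₀ s, RPar q ω r ∧ r 0 = e t₀ ∧ r s = u := by
  obtain ⟨σ, ⟨hσ, hωσ, huσ, z, hzσ, hzF, hzω⟩, -⟩ :=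
    hq.existsUnique_R _ (he.isCircle hq.toIsGauge hn) ω (Or.inl rfl) u
      (by rintro (h | h); exacts [hu h, hue h])
  rcases hzF with hz | ⟨t₀, hz⟩
  · exact absurd hz hzω
  obtain ⟨r, hr, h0, hrσ⟩ := hσ.exists_par isProfile_id hq.toIsGauge hn hωσ hzσ hzω
  have : u ∈ Set.range r := by rw [hrσ]; exact ⟨huσ, hu⟩
  obtain ⟨s, hs⟩ := this
  exact ⟨r, t₀, s, hr, h0.trans hz.symm, hs⟩

/-- The ℝ-line through `u` and its foot `e t₀` meets both the ℂ-line `e` and the ℂ-line through `u`,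
so the quartic law applies at either end with the same `ρ`. -/
lemma IsCGeom.exists_foot (hq : IsCGeom q) (hn : NormalizedAt q ω) {e : ℝ → X}
    (he : CPar q ω e) {u : X} (hu : u ≠ ω) : ∃ ρ t₀, 0 ≤ ρ ∧ (ρ = 0 → u ∈ Set.range e) ∧
      (∀ t, q u (e t) ^ 4 = ρ ^ 4 + (t - t₀) ^ 2) ∧
      ∀ e', CPar q ω e' → e' 0 = u → ∀ s, q (e' s) (e t₀) ^ 4 = ρ ^ 4 + s ^ 2 := by
  by_cases hue : u ∈ Set.range e
  · obtain ⟨t₀, rfl⟩ := hue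
    refine ⟨0, t₀, le_rfl, fun _ => ⟨t₀, rfl⟩, fun t => ?_, fun e' he' h0 s => ?_⟩
    · rw [he.2, sqrt_abs_pow_four]; ring
    · rw [← h0, he'.2, sqrt_abs_pow_four]; ring
  · obtain ⟨r, t₀, s, hr, h0, hs⟩ := hq.exists_rpar_foot hn he hu hue
    refine ⟨|s|, t₀, abs_nonneg _, fun h => ?_, fun t => ?_, fun e' he' h0' a => ?_⟩
    · rw [abs_eq_zero.1 h] at hs
      exact absurd ⟨t₀, h0.symm.trans hs⟩ hue
    · have := hq.quartic hn hr (he.shift t₀) (by simpa using h0) s (t - t₀)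
      rw [hs] at this
      simp only [add_sub_cancel] at this
      rw [this, ← abs_pow, abs_of_nonneg (by positivity : (0 : ℝ) ≤ s ^ 4)]
    · have := hq.quartic hn (hr.shift s) he' (by simpa using hs.trans h0'.symm) (-s) a
      simp only [add_neg_cancel, h0] at this
      rw [hq.symm, this, ← abs_pow, abs_of_nonneg (by positivity : (0 : ℝ) ≤ s ^ 4)]
      ring

/-- Each point of `e'` has a foot on `e`. Computing a distance from `e' b` to the foot of `e' a` in
two ways shows that the distance `ρ` to the foot is constant and that the parameter `τ` of the foot
is an isometry of `ℝ`, a translation or a reflection. -/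
lemma IsCGeom.fiber_dist (hq : IsCGeom q) (hn : NormalizedAt q ω) {e e' : ℝ → X}
    (he : CPar q ω e) (he' : CPar q ω e') : ∃ D n, 0 ≤ D ∧
      ((∀ s t, q (e' s) (e t) ^ 4 = D ^ 4 + (t - s - n) ^ 2) ∨
        ∀ s t, q (e' s) (e t) ^ 4 = D ^ 4 + (t + s - n) ^ 2) := by
  have hf : ∀ s, ∃ ρ τ, 0 ≤ ρ ∧ (∀ t, q (e' s) (e t) ^ 4 = ρ ^ 4 + (t - τ) ^ 2) ∧
      ∀ s', q (e' s') (e τ) ^ 4 = ρ ^ 4 + (s' - s) ^ 2 := by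
    intro s
    obtain ⟨ρ, τ, h0, -, h1, h2⟩ := hq.exists_foot hn he (he'.1 s)
    refine ⟨ρ, τ, h0, h1, fun s' => ?_⟩
    have := h2 _ (he'.shift s) (by simp) (s' - s)
    simpa using this
  choose ρ τ hρ h1 h2 using hf
  have hA : ∀ a b, ρ a ^ 4 + (τ b - τ a) ^ 2 = ρ b ^ 4 + (a - b) ^ 2 := by
    intro a b
    rw [← h1, h2]
  have hρc : ∀ a b, ρ a ^ 4 = ρ b ^ 4 := by
    intro a b
    have := hA a b
    have := hA b a
    linarith [sq_nonneg (a - b), show (a - b) ^ 2 = (b - a) ^ 2 by ring,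
      show (τ a - τ b) ^ 2 = (τ b - τ a) ^ 2 by ring]
  have hiso : ∀ a b, (τ a - τ b) ^ 2 = (a - b) ^ 2 := by
    intro a b
    have := hA a b
    linarith [hρc a b, show (τ a - τ b) ^ 2 = (τ b - τ a) ^ 2 by ring]
  refine ⟨ρ 0, τ 0, hρ 0, ?_⟩
  rcases real_isometry hiso with h | h
  · left
    intro s t
    rw [h1, hρc s 0, h s]; ring
  · right
    intro s t
    rw [h1, hρc s 0, h s]; ring

/-- `e` and `e'` are oriented in the same way. -/
def CoOriented (q : X → X → ℝ) (e e' : ℝ → X) : Prop :=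
  ∃ D n, 0 ≤ D ∧ ∀ s t, q (e' s) (e t) ^ 4 = D ^ 4 + (t - s - n) ^ 2

lemma IsCGeom.exists_coOriented (hq : IsCGeom q) (hn : NormalizedAt q ω) {e : ℝ → X}
    (he : CPar q ω e) {x : X} (hx : x ≠ ω) :
    ∃ e', CPar q ω e' ∧ e' 0 = x ∧ CoOriented q e e' := by
  obtain ⟨e', he', h0⟩ := hq.exists_cpar hn hx
  obtain ⟨D, n, hD, h | h⟩ := hq.fiber_dist hn he he'
  · exact ⟨e', he', h0, D, n, hD, h⟩
  · exact ⟨_, he'.neg, by simpa using h0, D, n, hD, fun s t => by rw [h]; ring⟩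

lemma unbounded_sq {M c : ℝ} (hM : 0 ≤ M) (h : ∀ s : ℝ, (2 * s + c) ^ 2 ≤ M) : False := by
  have := h ((M + 1 - c) / 2)
  nlinarith

lemma CoOriented.trans (hq : IsCGeom q) (hn : NormalizedAt q ω) {e₀ e₁ e₂ : ℝ → X}
    (he₀ : CPar q ω e₀) (he₁ : CPar q ω e₁) (he₂ : CPar q ω e₂) (h1 : CoOriented q e₀ e₁)
    (h2 : CoOriented q e₀ e₂) : CoOriented q e₁ e₂ := by
  obtain ⟨D, n, hD, h | h⟩ := hq.fiber_dist hn he₁ he₂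
  · exact ⟨D, n, hD, h⟩
  exfalso
  obtain ⟨D₁, n₁, hD₁, h1⟩ := h1
  obtain ⟨D₂, n₂, hD₂, h2⟩ := h2
  -- Run up the feet on `e₀`: the corresponding points of `e₁` and `e₂` stay within `D₁ + D₂`, but
  -- with opposite orientations their distance would be unbounded.
  refine unbounded_sq (M := (D₁ + D₂) ^ 4) (c := n₂ - n₁ - n) (by positivity) fun s => ?_
  have e1 : q (e₁ (s + n₂ - n₁)) (e₀ (s + n₂)) = D₁ :=
    pow_four_inj (hq.toIsGauge.nonneg _ _) hD₁ (by rw [h1]; ring)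
  have e2 : q (e₂ s) (e₀ (s + n₂)) = D₂ :=
    pow_four_inj (hq.toIsGauge.nonneg _ _) hD₂ (by rw [h2]; ring)
  have h3 := hq.toIsGauge.triangle hn (he₂.1 s) (he₀.1 (s + n₂)) (he₁.1 (s + n₂ - n₁))
  rw [e2, hq.symm, hq.symm (e₀ _), e1] at h3
  have h4 := pow_le_pow_left₀ (hq.toIsGauge.nonneg _ _) h3 4
  rw [hq.symm, h] at h4
  have : (2 * s + (n₂ - n₁ - n)) ^ 2 = (s + n₂ - n₁ + s - n) ^ 2 := by ring
  rw [this]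
  have : 0 ≤ D ^ 4 := by positivity
  rw [add_comm D₁ D₂]
  linarith

lemma CoOriented.eq_shift (hq : IsCGeom q) (hn : NormalizedAt q ω) {e₀ c c' : ℝ → X}
    (hc : CPar q ω c) (hc' : CPar q ω c') (h : CoOriented q e₀ c) (h' : CoOriented q e₀ c')
    {s : ℝ} (h0 : c' 0 = c s) (t : ℝ) : c' t = c (s + t) := by
  have hr : Set.range c' ⊆ Set.range fun t => c (s + t) := by
    rw [range_shift]
    exact (hq.range_cpar_eq hn hc' hc h0).subset
  have hinj : Set.InjOn Real.sqrt (Set.Ici 0) := fun a ha b hb hab =>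
    (Real.sqrt_inj (Set.mem_Ici.1 ha) (Set.mem_Ici.1 hb)).1 hab
  rcases (hc.shift s).eq_or_eq_neg isProfile_sqrt hinj hq.toIsGauge hc' (by simpa using h0) hr
    with h1 | h1
  · exact h1 t
  · exfalso
    obtain ⟨D, n, hD, h⟩ := h
    obtain ⟨D', n', hD', h'⟩ := h'
    refine unbounded_sq (M := D' ^ 4) (c := n' - s - n) (by positivity) fun t => ?_
    have e1 := h' t (t + n')
    rw [h1, h] at e1
    have : 0 ≤ D ^ 4 := by positivity
    have e2 : (2 * t + (n' - s - n)) ^ 2 = (t + n' - (s + -t) - n) ^ 2 := by ring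
    rw [e2]
    have e3 : (t + n' - t - n') ^ 2 = 0 := by ring
    linarith

/-- A one-parameter group of vertical shifts of `X_ω`. -/
structure IsShift (q : X → X → ℝ) (ω : X) (T : ℝ → X → X) : Prop where
  map_omega : ∀ a, T a ω = ω
  zero : ∀ x, T 0 x = x
  add : ∀ a b x, T (a + b) x = T a (T b x)
  cpar : ∀ x, x ≠ ω → CPar q ω fun a => T a x
  dist : ∀ x y, x ≠ ω → y ≠ ω → ∃ D h, 0 ≤ D ∧ ∀ a b, q (T a x) (T b y) ^ 4 = D ^ 4 + (h + b - a) ^ 2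

open Classical in
-- Every ℂ-line is parametrized so as to be co-oriented with `e₀`; such a parametrization is unique
-- up to translation, which gives the group law. Transitivity of co-orientation gives distances that
-- depend only on `b - a`.
theorem IsCGeom.exists_shift (hq : IsCGeom q) (hn : NormalizedAt q ω) {e₀ : ℝ → X}
    (he₀ : CPar q ω e₀) : ∃ T, IsShift q ω T ∧ ∀ a t, T a (e₀ t) = e₀ (t + a) := by
  have hex : ∀ x, ∃ e, x ≠ ω → CPar q ω e ∧ e 0 = x ∧ CoOriented q e₀ e := by
    intro x
    by_cases hx : x = ω
    · exact ⟨fun _ => ω, fun h => absurd hx h⟩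
    · obtain ⟨e, he⟩ := hq.exists_coOriented hn he₀ hx
      exact ⟨e, fun _ => he⟩
  choose E hE using hex
  have hT : ∀ x, x ≠ ω → ∀ a, (if x = ω then ω else E x a) = E x a := fun x hx a => by simp [hx]
  have hself : CoOriented q e₀ e₀ :=
    ⟨0, 0, le_rfl, fun s t => by rw [he₀.2, sqrt_abs_pow_four]; ring⟩
  refine ⟨fun a x => if x = ω then ω else E x a, ⟨fun a => by simp, fun x => ?_, fun a b x => ?_,
    fun x hx => ?_, fun x y hx hy => ?_⟩, fun a t => ?_⟩
  · by_cases hx : x = ω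
    · simp [hx]
    · simp [hx, (hE x hx).2.1]
  · by_cases hx : x = ω
    · simp [hx]
    · have h1 := (hE x hx).1.1 b
      simp only [hT x hx, hT _ h1]
      rw [CoOriented.eq_shift hq hn (hE x hx).1 (hE _ h1).1 (hE x hx).2.2 (hE _ h1).2.2
        (hE _ h1).2.1, add_comm]
  · simp only [hT x hx]
    exact (hE x hx).1
  · obtain ⟨D, n, hD, h⟩ := CoOriented.trans hq hn he₀ (hE y hy).1 (hE x hx).1 (hE y hy).2.2
      (hE x hx).2.2
    refine ⟨D, -n, hD, fun a b => ?_⟩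
    simp only [hT x hx, hT y hy, h]
    ring
  · have h1 := he₀.1 t
    simp only [hT _ h1]
    exact CoOriented.eq_shift hq hn he₀ (hE _ h1).1 hself (hE _ h1).2.2 (hE _ h1).2.1 a

variable {T : ℝ → X → X}

lemma IsShift.ne (hT : IsShift q ω T) {x : X} (hx : x ≠ ω) (a : ℝ) : T a x ≠ ω := (hT.cpar x hx).1 a

lemma IsShift.neg_apply (hT : IsShift q ω T) (a : ℝ) (x : X) : T (-a) (T a x) = x := by
  rw [← hT.add, neg_add_cancel, hT.zero]

lemma IsShift.apply_neg (hT : IsShift q ω T) (a : ℝ) (x : X) : T a (T (-a) x) = x := by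
  rw [← hT.add, add_neg_cancel, hT.zero]

lemma IsShift.isometry (hT : IsShift q ω T) (hq : IsGauge q) (hn : NormalizedAt q ω) (a : ℝ)
    (x y : X) : q (T a x) (T a y) = q x y := by
  by_cases hx : x = ω
  · by_cases hy : y = ω
    · rw [hx, hy, hT.map_omega]
    · rw [hx, hT.map_omega, hq.symm, hn _ (hT.ne hy a), hq.symm, hn _ hy]
  by_cases hy : y = ω
  · rw [hy, hT.map_omega, hn _ (hT.ne hx a), hn _ hx]
  obtain ⟨D, h, -, hd⟩ := hT.dist x y hx hy
  apply pow_four_inj (hq.nonneg _ _) (hq.nonneg _ _)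
  have := hd 0 0
  rw [hT.zero, hT.zero] at this
  rw [hd, this]
  ring

lemma IsShift.dist_left (hT : IsShift q ω T) {x y : X} (hx : x ≠ ω) (hy : y ≠ ω) :
    ∃ D h, ∀ b, q x (T b y) ^ 4 = D ^ 4 + (h + b) ^ 2 := by
  obtain ⟨D, h, -, hd⟩ := hT.dist x y hx hy
  refine ⟨D, h, fun b => ?_⟩
  have := hd 0 b
  rwa [hT.zero, sub_zero] at this

lemma IsShift.dist_rline (hT : IsShift q ω T) (hq : IsCGeom q) (hn : NormalizedAt q ω)
    {r : ℝ → X} (hr : RPar q ω r) (s s' a : ℝ) :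
    q (r s) (T a (r s')) ^ 4 = (s - s') ^ 4 + a ^ 2 := by
  have := hq.quartic hn (hr.shift s') (hT.cpar (r s') (hr.1 s')) (by simp [hT.zero]) (s - s') a
  simpa using this

end Fibers

/-! ### Möbius maps of a gauge -/

section Mob

variable {X : Type*} {q : X → X → ℝ} {ω : X}

/-- Maps that change the gauge by a conformal factor. -/
def IsMob (q : X → X → ℝ) (g : X → X) : Prop :=
  ∃ φ : X → ℝ, (∀ x, 0 < φ x) ∧ ∀ x y, q (g x) (g y) = φ x * φ y * q x y

lemma IsMob.comp {g g' : X → X} (hg : IsMob q g) (hg' : IsMob q g') : IsMob q (g ∘ g') := by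
  obtain ⟨φ, hφ, h⟩ := hg
  obtain ⟨φ', hφ', h'⟩ := hg'
  refine ⟨fun x => φ (g' x) * φ' x, fun x => mul_pos (hφ _) (hφ' _), fun x y => ?_⟩
  simp only [Function.comp, h, h']
  ring

lemma IsMob.injective (hq : IsGauge q) {g : X → X} (hg : IsMob q g) : Function.Injective g := by
  intro x y hxy
  obtain ⟨φ, hφ, h⟩ := hg
  have h1 := h x y
  rw [hxy, hq.self] at h1
  exact hq.eq_of_eq_zero ((mul_eq_zero.1 h1.symm).resolve_left (mul_pos (hφ x) (hφ y)).ne')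

lemma IsCircle.image {p : ℝ → ℝ} {σ : Set X} (h : IsCircle p q σ) {g : X → X} (hg : IsMob q g) :
    IsCircle p q (g '' σ) := by
  obtain ⟨f, φ, hφ, hf, rfl⟩ := h
  obtain ⟨ψ, hψ, hg⟩ := hg
  refine ⟨g ∘ f, fun x => ψ (f x) * φ x, fun x => mul_pos (hψ _) (hφ _), fun x y => ?_,
    Set.range_comp g f⟩
  simp only [Function.comp, hg, hf]
  ring

lemma IsMob.exists_homothety (hn : NormalizedAt q ω) (hq : IsGauge q) {g : X → X}
    (hg : IsMob q g) (hgω : g ω = ω) :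
    ∃ k, 0 < k ∧ ∀ x y, x ≠ ω → y ≠ ω → q (g x) (g y) = k * q x y := by
  have hi := hg.injective hq
  obtain ⟨φ, hφ, h⟩ := hg
  have h1 : ∀ x, x ≠ ω → φ x = (φ ω)⁻¹ := by
    intro x hx
    have := h x ω
    rw [hgω, hn x hx, hn _ (fun h => hx (hi (h.trans hgω.symm))), mul_one] at this
    exact eq_inv_of_mul_eq_one_left this.symm
  refine ⟨(φ ω)⁻¹ * (φ ω)⁻¹, mul_pos (inv_pos.2 (hφ ω)) (inv_pos.2 (hφ ω)), fun x y hx hy => ?_⟩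
  rw [h, h1 x hx, h1 y hy]

lemma isMob_of_rescale {ψ : X → ℝ} (hψ : ∀ x, 0 < ψ x) {g : X → X}
    (h : ∀ x y, rescale ψ q (g x) (g y) = rescale ψ q x y) : IsMob q g := by
  refine ⟨fun x => ψ x / ψ (g x), fun x => div_pos (hψ _) (hψ _), fun x y => ?_⟩
  have h1 := h x y
  simp only [rescale] at h1
  have hx := (hψ (g x)).ne'
  have hy := (hψ (g y)).ne'
  field_simp
  linarith

end Mob

/-! ### Shifts with respect to two points of a `C`-circle -/

section Frame

variable {X : Type*} {q : X → X → ℝ} {ω : X}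

/-- A parametrized `C`-line `e` with the shifts `n` along it that fix `ω`, and the shifts `m`
that fix `e 0`. -/
structure IsFrame (q : X → X → ℝ) (ω : X) (e : ℝ → X) (n m : ℝ → X → X) : Prop where
  cpar : CPar q ω e
  shift_n : IsShift q ω n
  shift_m : IsShift (normAt q (e 0)) (e 0) m
  n_apply : ∀ a t, n a (e t) = e (t + a)
  m_apply : ∀ b t, 1 + b * t ≠ 0 → m b (e t) = e (t / (1 + b * t))
  m_pole : ∀ b t, 1 + b * t = 0 → m b (e t) = ω
  m_omega : ∀ b, b ≠ 0 → m b ω = e b⁻¹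

open Classical in
lemma IsCGeom.exists_frame (hq : IsCGeom q) (hn : NormalizedAt q ω) {e : ℝ → X}
    (he : CPar q ω e) : ∃ n m, IsFrame q ω e n m := by
  obtain ⟨n, hsn, hna⟩ := hq.exists_shift hn he
  have hi := he.injective isProfile_sqrt hq.toIsGauge
  -- The same ℂ-circle in the inverted parameter `τ = 1 / t`, with `ω` at `0` and `e 0` removed: a
  -- unit speed ℂ-line for the gauge normalized at `e 0`.
  set e' : ℝ → X := fun τ => if τ = 0 then ω else e τ⁻¹ with he'
  have e'0 : e' 0 = ω := by simp [he']
  have e's : ∀ τ, τ ≠ 0 → e' τ = e τ⁻¹ := fun τ h => by simp [he', h]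
  have hne : ∀ τ, e' τ ≠ e 0 := by
    intro τ
    by_cases h : τ = 0
    · rw [h, e'0]; exact (he.1 0).symm
    · rw [e's τ h]
      intro h1
      exact inv_ne_zero h (hi h1)
  have hpar : CPar (MoebiusGauge.normAt q (e 0)) (e 0) e' := by
    refine ⟨hne, fun s t => ?_⟩
    rw [normAt_apply q (hne s) (hne t)]
    by_cases hs : s = 0 <;> by_cases ht : t = 0
    · rw [hs, ht, hq.self]; simp
    · rw [hs, e'0, e's t ht, hq.symm ω, hn _ (he.1 _), hq.symm ω, hn _ (he.1 _), he.2, sub_zero,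
        zero_sub, abs_neg, abs_inv, Real.sqrt_inv]
      simp
    · rw [ht, e'0, e's s hs, hn _ (he.1 _), hq.symm ω, hn _ (he.1 _), he.2, sub_zero,
        sub_zero, abs_inv, Real.sqrt_inv]
      simp
    · rw [e's s hs, e's t ht, he.2, he.2, he.2, sub_zero, sub_zero]
      have h1 : 0 < √|s⁻¹| := Real.sqrt_pos.2 (abs_pos.2 (inv_ne_zero hs))
      have h2 : 0 < √|t⁻¹| := Real.sqrt_pos.2 (abs_pos.2 (inv_ne_zero ht))
      rw [div_eq_iff (mul_pos h1 h2).ne', ← Real.sqrt_mul (abs_nonneg _),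
        ← Real.sqrt_mul (abs_nonneg _), ← abs_mul, ← abs_mul, abs_sub_comm]
      congr 2
      field_simp
  obtain ⟨m, hsm, hma⟩ := (hq.normAt (e 0)).exists_shift (normalizedAt_normAt hq.toIsGauge _) hpar
  refine ⟨n, m, he, hsn, hsm, hna, fun b t h => ?_, fun b t h => ?_, fun b hb => ?_⟩
  · by_cases ht : t = 0
    · rw [ht, zero_div]
      exact hsm.map_omega b
    · have h1 : t⁻¹ + b ≠ 0 := by
        intro h2
        apply h
        have : 1 + b * t = t * (t⁻¹ + b) := by field_simp
        rw [this, h2, mul_zero]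
      have h2 := hma b t⁻¹
      rw [e's _ (inv_ne_zero ht), e's _ h1, inv_inv] at h2
      rw [h2]
      congr 1
      field_simp
  · have ht : t ≠ 0 := by rintro rfl; simp at h
    have h2 := hma b t⁻¹
    have h1 : t⁻¹ + b = 0 := by field_simp; linarith
    rwa [e's _ (inv_ne_zero ht), h1, e'0, inv_inv] at h2
  · have h2 := hma b 0
    rwa [e'0, zero_add, e's b hb] at h2

variable {e : ℝ → X} {n m : ℝ → X → X}

lemma IsFrame.mob_n (hf : IsFrame q ω e n m) (hq : IsCGeom q) (hn : NormalizedAt q ω) (a : ℝ) :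
    IsMob q (n a) :=
  ⟨fun _ => 1, fun _ => one_pos, fun x y => by
    rw [hf.shift_n.isometry hq.toIsGauge hn]; ring⟩

lemma IsFrame.m_isometry (hf : IsFrame q ω e n m) (hq : IsCGeom q) (b : ℝ) (x y : X) :
    normAt q (e 0) (m b x) (m b y) = normAt q (e 0) x y :=
  hf.shift_m.isometry (hq.normAt _).toIsGauge (normalizedAt_normAt hq.toIsGauge _) b x y

lemma IsFrame.mob_m (hf : IsFrame q ω e n m) (hq : IsCGeom q) (b : ℝ) :
    IsMob q (m b) :=
  isMob_of_rescale (normFactor_pos hq.toIsGauge _) (hf.m_isometry hq b)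

/-- The `C`-circle of a frame. -/
def frameCircle (ω : X) (e : ℝ → X) : Set X := insert ω (Set.range e)

lemma IsFrame.n_mem (hf : IsFrame q ω e n m) {x : X} (a : ℝ) (hx : x ∈ frameCircle ω e) :
    n a x ∈ frameCircle ω e := by
  rcases hx with rfl | ⟨t, rfl⟩
  · exact Or.inl (hf.shift_n.map_omega a)
  · exact Or.inr ⟨t + a, (hf.n_apply a t).symm⟩

lemma IsFrame.m_mem (hf : IsFrame q ω e n m) {x : X} (b : ℝ) (hx : x ∈ frameCircle ω e) :
    m b x ∈ frameCircle ω e := by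
  rcases hx with rfl | ⟨t, rfl⟩
  · by_cases hb : b = 0
    · exact Or.inl (by rw [hb, hf.shift_m.zero])
    · exact Or.inr ⟨b⁻¹, (hf.m_omega b hb).symm⟩
  · by_cases h : 1 + b * t = 0
    · exact Or.inl (hf.m_pole b t h)
    · exact Or.inr ⟨_, (hf.m_apply b t h).symm⟩

lemma IsFrame.n_not_mem (hf : IsFrame q ω e n m) {x : X} (a : ℝ) (hx : x ∉ frameCircle ω e) :
    n a x ∉ frameCircle ω e := fun h => hx (by
  have := hf.n_mem (-a) h
  rwa [hf.shift_n.neg_apply] at this)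

lemma IsFrame.m_not_mem (hf : IsFrame q ω e n m) {x : X} (b : ℝ) (hx : x ∉ frameCircle ω e) :
    m b x ∉ frameCircle ω e := fun h => hx (by
  have := hf.m_mem (-b) h
  rwa [hf.shift_m.neg_apply] at this)

lemma ne_omega_of_not_mem {x : X} (hx : x ∉ frameCircle ω e) : x ≠ ω :=
  fun h => hx (Or.inl h)

lemma ne_center_of_not_mem {x : X} (hx : x ∉ frameCircle ω e) : x ≠ e 0 :=
  fun h => hx (Or.inr ⟨0, h.symm⟩)

variable {c : ℝ → X}

lemma IsFrame.rline_not_mem (hf : IsFrame q ω e n m) (hq : IsCGeom q) (hn : NormalizedAt q ω)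
    (hc : RPar q ω c) (h0 : c 0 = e 0) {s : ℝ} (hs : s ≠ 0) : c s ∉ frameCircle ω e := by
  rintro (h | ⟨t, h⟩)
  · exact hc.1 s h
  · exact hs (hq.eq_zero_of_meet hn hc hf.cpar h0 h.symm).1

/-- The squared modulus of `1 + b (a + i s²)`. -/
def modSq (b a s : ℝ) : ℝ := (1 + a * b) ^ 2 + b ^ 2 * s ^ 4

lemma modSq_pos (b a : ℝ) {s : ℝ} (hs : s ≠ 0) : 0 < modSq b a s := by
  unfold modSq
  by_cases hb : b = 0
  · rw [hb]; norm_num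
  · positivity

lemma IsFrame.dist_n_center (hf : IsFrame q ω e n m) (hq : IsCGeom q) (hn : NormalizedAt q ω)
    (hc : RPar q ω c) (h0 : c 0 = e 0) (a s : ℝ) : q (n a (c s)) (e 0) ^ 4 = s ^ 4 + a ^ 2 := by
  have h := hf.n_apply a (-a)
  rw [neg_add_cancel] at h
  rw [← h, hf.shift_n.isometry hq.toIsGauge hn, hq.quartic hn hc hf.cpar h0]
  ring

lemma IsFrame.dist_mn_center (hf : IsFrame q ω e n m) (hq : IsCGeom q) (hn : NormalizedAt q ω)
    (hc : RPar q ω c) (h0 : c 0 = e 0) (b a : ℝ) {s : ℝ} (hs : s ≠ 0) :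
    q (m b (n a (c s))) (e 0) ^ 4 * modSq b a s = s ^ 4 + a ^ 2 := by
  have hx := hf.rline_not_mem hq hn hc h0 hs
  have hy := hf.n_not_mem a hx
  have hz := hf.m_not_mem b hy
  have hωo : ω ≠ e 0 := (hf.cpar.1 0).symm
  have hyo := hf.dist_n_center hq hn hc h0 a s
  by_cases hb : b = 0
  · rw [hb, hf.shift_m.zero, hyo, modSq]; ring
  -- Undoing `m b` carries `ω` to `e (-1/b)`, whose distance from `n a (c s)` follows from the
  -- quartic law.
  have h1 := hf.m_isometry hq (-b) (m b (n a (c s))) ω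
  rw [hf.shift_m.neg_apply, hf.m_omega _ (neg_ne_zero.2 hb), normAt_apply q (ne_center_of_not_mem hz)
    hωo, hn _ (ne_omega_of_not_mem hz), hq.symm ω, hn _ (hf.cpar.1 0), mul_one,
    normAt_apply q (ne_center_of_not_mem hy)] at h1
  swap
  · intro h
    have := hf.cpar.injective isProfile_sqrt hq.toIsGauge h
    exact hb (by simpa using this)
  have h2 : q (n a (c s)) (e (-b)⁻¹) ^ 4 = s ^ 4 + (a + b⁻¹) ^ 2 := by
    have h := hf.n_apply a ((-b)⁻¹ - a)
    rw [sub_add_cancel] at h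
    rw [← h, hf.shift_n.isometry hq.toIsGauge hn, hq.quartic hn hc hf.cpar h0, inv_neg]
    ring
  have h3 : q (e (-b)⁻¹) (e 0) ^ 4 = (b⁻¹) ^ 2 := by
    rw [hf.cpar.2, sqrt_abs_pow_four, sub_zero, inv_neg, neg_sq]
  have h4 := congrArg (· ^ 4) h1
  simp only [div_pow, mul_pow, one_pow] at h4
  rw [h2, h3, hyo] at h4
  have hpos : 0 < q (m b (n a (c s))) (e 0) ^ 4 :=
    pow_pos (hq.pos _ _ (ne_center_of_not_mem hz)) 4
  have hp2 : 0 < s ^ 4 + a ^ 2 := by positivity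
  rw [modSq]
  field_simp at h4
  rw [eq_div_iff hpos.ne'] at h4
  linear_combination h4

/-- The function `(c, b, a) ↦ |x', n_c m_b n_a x|⁴` for two points of an `R`-line, up to the
conformal factor. -/
def word (q : X → X → ℝ) (n m : ℝ → X → X) (x' x : X) (s : ℝ) (c b a : ℝ) : ℝ :=
  q x' (n c (m b (n a x))) ^ 4 * modSq b a s

lemma IsFrame.word_eq (hf : IsFrame q ω e n m) (hq : IsCGeom q) (hn : NormalizedAt q ω)
    (x' x : X) (s c b a : ℝ) :
    word q n m x' x s c b a = q (n (-c) x') (m b (n a x)) ^ 4 * modSq b a s := by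
  rw [word, ← hf.shift_n.isometry hq.toIsGauge hn (-c) x', hf.shift_n.neg_apply]

/-- The last letter is a shift fixing `ω`, so the fourth power of the distance is a monic quadratic
in its parameter. -/
lemma IsFrame.word_quadratic_c (hf : IsFrame q ω e n m) (hq : IsCGeom q) (hn : NormalizedAt q ω)
    (hc : RPar q ω c) (h0 : c 0 = e 0) {s s' : ℝ} (hs : s ≠ 0) (b a : ℝ) :
    ∃ E h, ∀ t, word q n m (c s') (c s) s t b a = (E + (h + t) ^ 2) * modSq b a s := by
  have hz := hf.m_not_mem b (hf.n_not_mem a (hf.rline_not_mem hq hn hc h0 hs))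
  obtain ⟨D, h, hd⟩ := hf.shift_n.dist_left (hc.1 s') (ne_omega_of_not_mem hz)
  exact ⟨D ^ 4, h, fun t => by rw [word, hd]⟩

lemma IsFrame.word_eq_normAt (hf : IsFrame q ω e n m) (hq : IsCGeom q) (hn : NormalizedAt q ω)
    (hc : RPar q ω c) (h0 : c 0 = e 0) {s s' : ℝ} (hs : s ≠ 0) (hs' : s' ≠ 0) (t b a : ℝ) :
    word q n m (c s') (c s) s t b a =
      normAt q (e 0) (n (-t) (c s')) (m b (n a (c s))) ^ 4 *
        ((s' ^ 4 + t ^ 2) * (s ^ 4 + a ^ 2)) := by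
  have hx' := hf.n_not_mem (-t) (hf.rline_not_mem hq hn hc h0 hs')
  have hz := hf.m_not_mem b (hf.n_not_mem a (hf.rline_not_mem hq hn hc h0 hs))
  have h1 := hf.dist_n_center hq hn hc h0 (-t) s'
  have h2 := hf.dist_mn_center hq hn hc h0 b a hs
  have p1 := (hq.pos _ _ (ne_center_of_not_mem hx')).ne'
  have p2 := (hq.pos _ _ (ne_center_of_not_mem hz)).ne'
  rw [hf.word_eq hq hn, normAt_apply q (ne_center_of_not_mem hx') (ne_center_of_not_mem hz),
    div_pow, mul_pow, ← h2, ← neg_sq t, ← h1]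
  field_simp

/-- In the gauge normalized at `e 0` the letter `m b` is a vertical shift; the factor `modSq` in
`word` cancels the denominator depending on `b`. -/
lemma IsFrame.word_quadratic_b (hf : IsFrame q ω e n m) (hq : IsCGeom q) (hn : NormalizedAt q ω)
    (hc : RPar q ω c) (h0 : c 0 = e 0) {s s' : ℝ} (hs : s ≠ 0) (hs' : s' ≠ 0) (t a : ℝ) :
    ∃ E h, ∀ b, word q n m (c s') (c s) s t b a =
      (E + (h + b) ^ 2) * ((s' ^ 4 + t ^ 2) * (s ^ 4 + a ^ 2)) := by
  have hx' := hf.n_not_mem (-t) (hf.rline_not_mem hq hn hc h0 hs')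
  have hy := hf.n_not_mem a (hf.rline_not_mem hq hn hc h0 hs)
  obtain ⟨D, h, hd⟩ := hf.shift_m.dist_left (ne_center_of_not_mem hx') (ne_center_of_not_mem hy)
  exact ⟨D ^ 4, h, fun b => by rw [hf.word_eq_normAt hq hn hc h0 hs hs', hd]⟩

/-- Moving the letters `n` and `m` to the other point by isometry makes `n a` the outermost letter,
so that the word becomes quadratic in `a` as well. -/
lemma IsFrame.word_swap (hf : IsFrame q ω e n m) (hq : IsCGeom q) (hn : NormalizedAt q ω)
    (hc : RPar q ω c) (h0 : c 0 = e 0) {s s' : ℝ} (hs : s ≠ 0) (hs' : s' ≠ 0) (t b a : ℝ) :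
    word q n m (c s') (c s) s t b a =
      q (m (-b) (n (-t) (c s'))) (n a (c s)) ^ 4 * modSq (-b) (-t) s' := by
  have hx' := hf.m_not_mem (-b) (hf.n_not_mem (-t) (hf.rline_not_mem hq hn hc h0 hs'))
  have hy := hf.n_not_mem a (hf.rline_not_mem hq hn hc h0 hs)
  have h1 := hf.dist_n_center hq hn hc h0 a s
  have h2 := hf.dist_mn_center hq hn hc h0 (-b) (-t) hs'
  have p1 := (hq.pos _ _ (ne_center_of_not_mem hx')).ne'
  have p2 := (hq.pos _ _ (ne_center_of_not_mem hy)).ne'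
  rw [hf.word_eq_normAt hq hn hc h0 hs hs', ← hf.m_isometry hq (-b), hf.shift_m.neg_apply,
    normAt_apply q (ne_center_of_not_mem hx') (ne_center_of_not_mem hy),
    div_pow, mul_pow, ← neg_sq t, ← h2, ← h1]
  field_simp

lemma IsFrame.word_quadratic_a (hf : IsFrame q ω e n m) (hq : IsCGeom q) (hn : NormalizedAt q ω)
    (hc : RPar q ω c) (h0 : c 0 = e 0) {s s' : ℝ} (hs : s ≠ 0) (hs' : s' ≠ 0) (t b : ℝ) :
    ∃ E h, ∀ a, word q n m (c s') (c s) s t b a = (E + (h + a) ^ 2) * modSq (-b) (-t) s' := by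
  have hx' := hf.m_not_mem (-b) (hf.n_not_mem (-t) (hf.rline_not_mem hq hn hc h0 hs'))
  obtain ⟨D, h, hd⟩ := hf.shift_n.dist_left (ne_omega_of_not_mem hx') (hc.1 s)
  exact ⟨D ^ 4, h, fun a => by rw [hf.word_swap hq hn hc h0 hs hs', hd]⟩

lemma IsFrame.word_zero_b (hf : IsFrame q ω e n m) (hq : IsCGeom q) (hn : NormalizedAt q ω)
    (hc : RPar q ω c) (s s' t a : ℝ) :
    word q n m (c s') (c s) s t 0 a = (s - s') ^ 4 + (a + t) ^ 2 := by
  rw [word, hf.shift_m.zero, ← hf.shift_n.add, hf.shift_n.dist_rline hq hn hc, modSq]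
  ring

/-- An `R`-line through `ω` and `o` is an `R`-line for the gauge normalized at `o`. -/
lemma IsFrame.normAt_dist_rline (hf : IsFrame q ω e n m) (hq : IsCGeom q)
    (hn : NormalizedAt q ω) (hc : RPar q ω c) (h0 : c 0 = e 0) {s s' : ℝ} (hs : s ≠ 0)
    (hs' : s' ≠ 0) (b : ℝ) :
    normAt q (e 0) (c s') (m b (c s)) ^ 4 * (s ^ 4 * s' ^ 4) =
      (s - s') ^ 4 + b ^ 2 * (s ^ 4 * s' ^ 4) := by
  have hG := (hq.normAt (e 0)).toIsGauge
  have hN := normalizedAt_normAt hq.toIsGauge (e 0)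
  have hci := hc.injective isProfile_id hq.toIsGauge
  have hωo : ω ≠ e 0 := (hf.cpar.1 0).symm
  have hne : ∀ {s}, s ≠ 0 → c s ≠ e 0 := fun h =>
    ne_center_of_not_mem (hf.rline_not_mem hq hn hc h0 h)
  have hσ : IsR (normAt q (e 0)) (insert ω (Set.range c)) :=
    (isCircle_rescale_iff (normFactor_pos hq.toIsGauge _)).2 (hc.isCircle hq.toIsGauge hn)
  obtain ⟨r, hr, hr0, hrr⟩ := hσ.exists_par isProfile_id hG hN (ω := e 0) (Or.inr ⟨0, h0⟩)
    (Or.inl rfl) hωo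
  have hmem : ∀ {s}, s ≠ 0 → c s ∈ Set.range r := fun {s} h => by
    rw [hrr]; exact ⟨Or.inr ⟨s, rfl⟩, hne h⟩
  obtain ⟨τ, hτ⟩ := hmem hs
  obtain ⟨τ', hτ'⟩ := hmem hs'
  have h1 := hf.shift_m.dist_rline (hq.normAt (e 0)) hN hr τ' τ b
  rw [hτ, hτ'] at h1
  have h2 := hr.2 τ' τ
  rw [hτ, hτ', normAt_apply q (hne hs') (hne hs), ← h0, hc.2, hc.2, hc.2] at h2
  have h3 := congrArg (· ^ 4) h2
  simp only [sub_zero, div_pow, mul_pow] at h3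
  have e4 : ∀ x : ℝ, |x| ^ 4 = x ^ 4 := fun x => by
    rw [← abs_pow, abs_of_nonneg (by positivity)]
  rw [e4, e4, e4, e4] at h3
  rw [h1, ← h3]
  field_simp
  ring

lemma IsFrame.word_only_b (hf : IsFrame q ω e n m) (hq : IsCGeom q) (hn : NormalizedAt q ω)
    (hc : RPar q ω c) (h0 : c 0 = e 0) {s s' : ℝ} (hs : s ≠ 0) (hs' : s' ≠ 0) (b : ℝ) :
    word q n m (c s') (c s) s 0 b 0 = (s - s') ^ 4 + b ^ 2 * (s ^ 4 * s' ^ 4) := by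
  rw [hf.word_eq_normAt hq hn hc h0 hs hs', neg_zero, hf.shift_n.zero, hf.shift_n.zero,
    ← hf.normAt_dist_rline hq hn hc h0 hs hs']
  ring

end Frame

lemma word_form_aux {b r κ₁ κ₂ τ P S S' : ℝ} (hb : b ≠ 0) :
    r + b * (κ₁ * (-1 / (2 * b)) + κ₂ * (1 / b) + τ * ((-1 / (2 * b)) * (1 / b))) +
      ((-1 / (2 * b) + 1 / b + -1 / (2 * b) * b * (1 / b)) ^ 2 + P * b ^ 2 +
        S * (1 + b * (1 / b)) ^ 2 + S' * (1 + -1 / (2 * b) * b) ^ 2) =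
      P * b ^ 2 + (4 * S + S' / 4 + r - κ₁ / 2 + κ₂) - τ / (2 * b) := by
  have h1 : -1 / (2 * b) + 1 / b + -1 / (2 * b) * b * (1 / b) = 0 := by field_simp; ring
  have h2 : b * (1 / b) = 1 := by field_simp
  have h3 : -1 / (2 * b) * b = -1 / 2 := by field_simp
  rw [h1, h2, h3]
  field_simp
  ring

/-- Along `a = -1/(2b)`, `c = 1/b` one has `a + c + abc = 0`, so all terms stay bounded as `b → 0`
except `-τ/(2b)`. Nonnegativity for both signs of `b` forces `τ = 0`. -/
lemma word_form_of_affine {Φ : ℝ → ℝ → ℝ → ℝ} {s s' r κ₁ κ₂ τ : ℝ} (hpos : ∀ c b a, 0 ≤ Φ c b a)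
    (C : ∀ c b a, Φ c b a = r + b * (κ₁ * a + κ₂ * c + τ * (a * c)) +
      ((a + c + a * b * c) ^ 2 + s ^ 4 * s' ^ 4 * b ^ 2 + s ^ 4 * (1 + b * c) ^ 2 +
        s' ^ 4 * (1 + a * b) ^ 2)) :
    ∃ κ₁ κ₂ : ℝ, ∀ c b a, Φ c b a =
      (a + c + a * b * c) ^ 2 + s ^ 4 * s' ^ 4 * b ^ 2 + s ^ 4 * (1 + b * c) ^ 2 +
        s' ^ 4 * (1 + a * b) ^ 2 + r + κ₁ * (a * b) + κ₂ * (b * c) := by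
  have hτ0 : τ = 0 := by
    by_contra hne
    obtain ⟨Q, hQ⟩ : ∃ Q, Q = 4 * s ^ 4 + s' ^ 4 / 4 + r - κ₁ / 2 + κ₂ := ⟨_, rfl⟩
    have hP : 0 ≤ s ^ 4 * s' ^ 4 := by positivity
    have hPτ : 0 ≤ s ^ 4 * s' ^ 4 * τ ^ 2 := by positivity
    obtain ⟨K, hK⟩ : ∃ K, K = |Q| + s ^ 4 * s' ^ 4 * τ ^ 2 + 1 := ⟨_, rfl⟩
    have hK1 : 1 ≤ K := by linarith [abs_nonneg Q]
    have hK0 : 0 < K := by linarith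
    -- This makes `τ/(2b)` equal to `K`, which exceeds all remaining terms.
    obtain ⟨b, hb⟩ : ∃ b, b = τ / (2 * K) := ⟨_, rfl⟩
    have hb0 : b ≠ 0 := by rw [hb]; exact div_ne_zero hne (by positivity)
    have h3 := hpos (1 / b) b (-1 / (2 * b))
    have h5 : τ / (2 * b) = K := by
      rw [hb]; field_simp
    have h6 : b ^ 2 ≤ τ ^ 2 := by
      rw [hb, div_pow]
      apply div_le_self (sq_nonneg _)
      nlinarith
    rw [C, word_form_aux hb0, ← hQ, h5] at h3
    have h7 := mul_le_mul_of_nonneg_left h6 hP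
    have := le_abs_self Q
    linarith
  refine ⟨κ₁, κ₂, fun c b a => ?_⟩
  rw [C, hτ0]
  ring

/-- A function of three variables that is quadratic in each of them, with leading coefficients as
for the word `n_c m_b n_a`, is determined up to two parameters. -/
lemma word_form {Φ : ℝ → ℝ → ℝ → ℝ} {s s' : ℝ}
    (hc : ∀ b a, ∃ E h, ∀ c, Φ c b a = (E + (h + c) ^ 2) * modSq b a s)
    (hb : ∀ c a, ∃ E h, ∀ b, Φ c b a =
      (E + (h + b) ^ 2) * ((s' ^ 4 + c ^ 2) * (s ^ 4 + a ^ 2)))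
    (ha : ∀ c b, ∃ E h, ∀ a, Φ c b a = (E + (h + a) ^ 2) * modSq (-b) (-c) s')
    (h1 : ∀ c a, Φ c 0 a = (s - s') ^ 4 + (a + c) ^ 2)
    (h2 : ∀ b, Φ 0 b 0 = (s - s') ^ 4 + b ^ 2 * (s ^ 4 * s' ^ 4))
    (hpos : ∀ c b a, 0 ≤ Φ c b a) : ∃ κ₁ κ₂ : ℝ, ∀ c b a, Φ c b a =
      (a + c + a * b * c) ^ 2 + s ^ 4 * s' ^ 4 * b ^ 2 + s ^ 4 * (1 + b * c) ^ 2 +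
        s' ^ 4 * (1 + a * b) ^ 2 + ((s - s') ^ 4 - s ^ 4 - s' ^ 4) + κ₁ * (a * b) +
        κ₂ * (b * c) := by
  -- The subtracted polynomial has the same leading coefficient in each variable, so `Ψ` is affine
  -- in each variable separately. Its values at `b = 0` and on the `b`-axis remove all terms except
  -- `r`, `ab`, `bc` and `abc`.
  set Ψ : ℝ → ℝ → ℝ → ℝ := fun c b a => Φ c b a - ((a + c + a * b * c) ^ 2 +
    s ^ 4 * s' ^ 4 * b ^ 2 + s ^ 4 * (1 + b * c) ^ 2 + s' ^ 4 * (1 + a * b) ^ 2) with hΨ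
  have A1 : ∀ c b a, Ψ c b a = Ψ 0 b a + c * (Ψ 1 b a - Ψ 0 b a) := by
    intro c b a
    obtain ⟨E, h, H⟩ := hc b a
    simp only [hΨ, H, modSq]
    ring
  have A2 : ∀ c b a, Ψ c b a = Ψ c 0 a + b * (Ψ c 1 a - Ψ c 0 a) := by
    intro c b a
    obtain ⟨E, h, H⟩ := hb c a
    simp only [hΨ, H]
    ring
  have A3 : ∀ c b a, Ψ c b a = Ψ c b 0 + a * (Ψ c b 1 - Ψ c b 0) := by
    intro c b a
    obtain ⟨E, h, H⟩ := ha c b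
    simp only [hΨ, H, modSq]
    ring
  set r := (s - s') ^ 4 - s ^ 4 - s' ^ 4 with hr
  have B1 : ∀ c a, Ψ c 0 a = r := by
    intro c a
    simp only [hΨ, h1, hr]
    ring
  have B2 : Ψ 0 1 0 = r := by
    simp only [hΨ, h2, hr]
    ring
  refine word_form_of_affine hpos (r := r) (κ₁ := Ψ 0 1 1 - r) (κ₂ := Ψ 1 1 0 - r)
    (τ := Ψ 1 1 1 - Ψ 1 1 0 - Ψ 0 1 1 + r) fun c b a => ?_
  have C : Ψ c b a = r + b * ((Ψ 0 1 1 - r) * a + (Ψ 1 1 0 - r) * c +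
      (Ψ 1 1 1 - Ψ 1 1 0 - Ψ 0 1 1 + r) * (a * c)) := by
    rw [A2 c b a, B1, A1 c 1 a, A3 0 1 a, A3 1 1 a, B2]
    ring
  rw [← C]
  simp only [hΨ]
  ring

/-! ### Slides and homotheties as words in shifts -/

open Filter Topology

section Words

variable {X : Type*} {q : X → X → ℝ} {ω : X} {e c : ℝ → X} {n m : ℝ → X → X}

/-- A word in the shifts of a frame that fixes the center and converges to a homothety with
coefficient `l` as `b → 0`. -/
noncomputable def slide (n m : ℝ → X → X) (l b : ℝ) (x : X) : X :=
  n ((l - 1) / b) (m b (n ((1 / l - 1) / b) x))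

/-- A word in the shifts of a frame that is a homothety with coefficient `l`. -/
noncomputable def dilation (n m : ℝ → X → X) (l b : ℝ) (x : X) : X := slide n m l b (m (-(b * l)) x)

lemma IsFrame.slide_eq_dilation (hf : IsFrame q ω e n m) (l b : ℝ) (x : X) :
    slide n m l b x = dilation n m l b (m (b * l) x) := by
  rw [dilation, hf.shift_m.neg_apply]

lemma IsFrame.dilation_omega (hf : IsFrame q ω e n m) {l b : ℝ} (hl : l ≠ 0) (hb : b ≠ 0) :
    dilation n m l b ω = ω := by
  rw [dilation, slide, hf.m_omega _ (neg_ne_zero.2 (mul_ne_zero hb hl)), hf.n_apply, hf.m_pole,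
    hf.shift_n.map_omega]
  field_simp
  ring

/-- In matrices, `slide` acts on the ℂ-circle as `[[l, 0], [b, 1/l]]`, and precomposing with `m (-(b
* l))` clears the lower left entry, leaving `diag (l, 1/l)`. -/
lemma IsFrame.dilation_apply (hf : IsFrame q ω e n m) {l b : ℝ} (hl : l ≠ 0) (hb : b ≠ 0)
    (t : ℝ) : dilation n m l b (e t) = e (l ^ 2 * t) := by
  rw [dilation, slide]
  by_cases h : 1 + -(b * l) * t = 0
  · rw [hf.m_pole _ _ h, hf.shift_n.map_omega, hf.m_omega _ hb, hf.n_apply]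
    congr 1
    field_simp
    linear_combination l * h
  · obtain ⟨w, hw⟩ : ∃ w, w = 1 + -(b * l) * t := ⟨_, rfl⟩
    have ht : t = (1 - w) / (b * l) := by rw [hw]; field_simp; ring
    have h2 : 1 + b * (t / w + (1 / l - 1) / b) = 1 / (l * w) := by
      rw [← hw] at h
      rw [ht]
      field_simp
      ring
    rw [hf.m_apply _ _ h, ← hw, hf.n_apply, hf.m_apply, h2, hf.n_apply]
    · rw [← hw] at h
      congr 1
      rw [ht]
      field_simp
      ring
    · rw [h2]
      exact one_div_ne_zero (mul_ne_zero hl (hw ▸ h))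

lemma IsFrame.mob_dilation (hf : IsFrame q ω e n m) (hq : IsCGeom q) (hn : NormalizedAt q ω)
    (l b : ℝ) : IsMob q (dilation n m l b) :=
  (hf.mob_n hq hn _).comp ((hf.mob_m hq _).comp ((hf.mob_n hq hn _).comp (hf.mob_m hq _)))

lemma IsFrame.dilation_ne (hf : IsFrame q ω e n m) (hq : IsCGeom q) (hn : NormalizedAt q ω)
    {l b : ℝ} (hl : 0 < l) (hb : b ≠ 0) {x : X} (hx : x ≠ ω) : dilation n m l b x ≠ ω := fun h =>
  hx ((hf.mob_dilation hq hn l b).injective hq.toIsGauge (h.trans (hf.dilation_omega hl.ne' hb).symm))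

/-- A Möbius map fixing `ω` is a homothety for a gauge normalized at `ω`; its coefficient is read
off on the ℂ-line. -/
lemma IsFrame.dist_dilation (hf : IsFrame q ω e n m) (hq : IsCGeom q) (hn : NormalizedAt q ω)
    {l b : ℝ} (hl : 0 < l) (hb : b ≠ 0) {x y : X} (hx : x ≠ ω) (hy : y ≠ ω) :
    q (dilation n m l b x) (dilation n m l b y) = l * q x y := by
  obtain ⟨k, hk, h⟩ := (hf.mob_dilation hq hn l b).exists_homothety hn hq.toIsGauge
    (hf.dilation_omega hl.ne' hb)
  have h1 := h (e 1) (e 0) (hf.cpar.1 _) (hf.cpar.1 _)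
  rw [hf.dilation_apply hl.ne' hb, hf.dilation_apply hl.ne' hb, hf.cpar.2, hf.cpar.2] at h1
  have h2 : √|l ^ 2 * 1 - l ^ 2 * 0| = l := by
    rw [mul_one, mul_zero, sub_zero, abs_of_nonneg (sq_nonneg l), Real.sqrt_sq hl.le]
  rw [h2] at h1
  simp only [sub_zero, abs_one, Real.sqrt_one, mul_one] at h1
  rw [h _ _ hx hy, h1]

/-- The form of the words in the shifts of a frame, for two points of an `R`-line. -/
lemma IsFrame.exists_word_form (hf : IsFrame q ω e n m) (hq : IsCGeom q) (hn : NormalizedAt q ω)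
    (hc : RPar q ω c) (h0 : c 0 = e 0) {s s' : ℝ} (hs : s ≠ 0) (hs' : s' ≠ 0) :
    ∃ κ₁ κ₂ : ℝ, ∀ t b a, word q n m (c s') (c s) s t b a =
      (a + t + a * b * t) ^ 2 + s ^ 4 * s' ^ 4 * b ^ 2 + s ^ 4 * (1 + b * t) ^ 2 +
        s' ^ 4 * (1 + a * b) ^ 2 + ((s - s') ^ 4 - s ^ 4 - s' ^ 4) + κ₁ * (a * b) +
        κ₂ * (b * t) := by
  refine word_form (fun b a => hf.word_quadratic_c hq hn hc h0 hs b a)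
    (fun t a => hf.word_quadratic_b hq hn hc h0 hs hs' t a)
    (fun t b => hf.word_quadratic_a hq hn hc h0 hs hs' t b)
    (fun t a => hf.word_zero_b hq hn hc s s' t a) (fun b => hf.word_only_b hq hn hc h0 hs hs' b)
    fun t b a => mul_nonneg (pow_nonneg (hq.nonneg _ _) 4) (modSq_pos b a hs).le

lemma IsFrame.slide_not_mem (hf : IsFrame q ω e n m) {x : X} (l b : ℝ)
    (hx : x ∉ frameCircle ω e) : slide n m l b x ∉ frameCircle ω e :=
  hf.n_not_mem _ (hf.m_not_mem _ (hf.n_not_mem _ hx))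

/-- The middle letter `m b` carries `e (-t/l)` to `e (-t)`, the point that the last shift moves to
`e 0`. Its conformal change of distance is known from `IsFrame.dist_mn_center`. -/
lemma IsFrame.dist_slide_center (hf : IsFrame q ω e n m) (hq : IsCGeom q) (hn : NormalizedAt q ω)
    (hc : RPar q ω c) (h0 : c 0 = e 0) {s l b : ℝ} (hs : s ≠ 0) (hl : l ≠ 0) (hl1 : l ≠ 1)
    (hb : b ≠ 0) : q (slide n m l b (c s)) (e 0) ^ 4 * (1 / l ^ 2 + b ^ 2 * s ^ 4) =
      l ^ 2 * s ^ 4 := by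
  set t := (l - 1) / b with ht
  set a := (1 / l - 1) / b with ha
  have ht0 : t ≠ 0 := div_ne_zero (sub_ne_zero.2 hl1) hb
  have hx := hf.rline_not_mem hq hn hc h0 hs
  have hy := hf.n_not_mem a hx
  have hz := hf.m_not_mem b hy
  have hi := hf.cpar.injective isProfile_sqrt hq.toIsGauge
  have e1 : 1 + b * (-t / l) = 1 / l := by rw [ht]; field_simp; ring
  have e2 : m b (e (-t / l)) = e (-t) := by
    rw [hf.m_apply _ _ (by rw [e1]; exact one_div_ne_zero hl), e1]
    congr 1
    field_simp
  have h1 := hf.m_isometry hq b (n a (c s)) (e (-t / l))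
  rw [e2, normAt_apply q (ne_center_of_not_mem hz) (fun h => ht0 (by simpa using hi h)),
    normAt_apply q (ne_center_of_not_mem hy) (fun h => ht0 (by simpa [hl] using hi h))] at h1
  have h2 := congrArg (· ^ 4) h1
  simp only [div_pow, mul_pow] at h2
  have h3 : q (n a (c s)) (e (-t / l)) ^ 4 = s ^ 4 := by
    have h := hf.n_apply a (-t / l - a)
    rw [sub_add_cancel] at h
    have h4 : -t / l - a = 0 := by rw [ht, ha]; field_simp; ring
    rw [← h, hf.shift_n.isometry hq.toIsGauge hn, hq.quartic hn hc hf.cpar h0, h4]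
    ring
  have h4 : q (m b (n a (c s))) (e (-t)) = q (slide n m l b (c s)) (e 0) := by
    have h := hf.n_apply t (-t)
    rw [neg_add_cancel] at h
    rw [← h, slide, hf.shift_n.isometry hq.toIsGauge hn]
  have h5 := hf.dist_mn_center hq hn hc h0 b a hs
  have h6 := hf.dist_n_center hq hn hc h0 a s
  have h7 : modSq b a s = 1 / l ^ 2 + b ^ 2 * s ^ 4 := by
    rw [modSq, ha]; field_simp; ring
  have p1 := pow_ne_zero 4 (hq.pos _ _ (ne_center_of_not_mem hz)).ne'
  have p2 : s ^ 4 + a ^ 2 ≠ 0 := by positivity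
  rw [h3, h4, h6, hf.cpar.2, hf.cpar.2, sqrt_abs_pow_four, sqrt_abs_pow_four] at h2
  rw [h7] at h5
  generalize q (slide n m l b (c s)) (e 0) ^ 4 = A at *
  generalize q (m b (n a (c s))) (e 0) ^ 4 = B at *
  generalize 1 / l ^ 2 + b ^ 2 * s ^ 4 = C at *
  rw [← h5] at h2 p2
  have hC : C ≠ 0 := right_ne_zero_of_mul p2
  simp only [sub_zero, div_pow, neg_sq] at h2
  field_simp at h2
  linear_combination h2

lemma dist_slide
    {s s' κ₁ κ₂ : ℝ} (hw : ∀ t b a, word q n m (c s') (c s) s t b a =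
      (a + t + a * b * t) ^ 2 + s ^ 4 * s' ^ 4 * b ^ 2 + s ^ 4 * (1 + b * t) ^ 2 +
        s' ^ 4 * (1 + a * b) ^ 2 + ((s - s') ^ 4 - s ^ 4 - s' ^ 4) + κ₁ * (a * b) +
        κ₂ * (b * t)) {l b : ℝ} (hl : l ≠ 0) (hb : b ≠ 0) :
    q (c s') (slide n m l b (c s)) ^ 4 * (1 / l ^ 2 + b ^ 2 * s ^ 4) =
      s ^ 4 * s' ^ 4 * b ^ 2 + s ^ 4 * l ^ 2 + s' ^ 4 / l ^ 2 +
        ((s - s') ^ 4 - s ^ 4 - s' ^ 4) + κ₁ * (1 / l - 1) + κ₂ * (l - 1) := by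
  have h := hw ((l - 1) / b) b ((1 / l - 1) / b)
  have h7 : modSq b ((1 / l - 1) / b) s = 1 / l ^ 2 + b ^ 2 * s ^ 4 := by
    rw [modSq]; field_simp; ring
  have e1 : (1 / l - 1) / b + (l - 1) / b + (1 / l - 1) / b * b * ((l - 1) / b) = 0 := by
    field_simp; ring
  have e2 : 1 + b * ((l - 1) / b) = l := by field_simp; ring
  have e3 : (1 / l - 1) / b * b = 1 / l - 1 := by field_simp
  have e4 : b * ((l - 1) / b) = l - 1 := by field_simp
  rw [word, h7, e1, e2, e3, e4] at h
  rw [slide, h]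
  ring

/-- The limit of `q (c s') (slide n m l b (c s)) ^ 4` as `b → 0`. -/
lemma tendsto_dist_slide
    {s s' κ₁ κ₂ : ℝ} (hw : ∀ t b a, word q n m (c s') (c s) s t b a =
      (a + t + a * b * t) ^ 2 + s ^ 4 * s' ^ 4 * b ^ 2 + s ^ 4 * (1 + b * t) ^ 2 +
        s' ^ 4 * (1 + a * b) ^ 2 + ((s - s') ^ 4 - s ^ 4 - s' ^ 4) + κ₁ * (a * b) +
        κ₂ * (b * t)) {l : ℝ} (hl : l ≠ 0) :
    Tendsto (fun b => q (c s') (slide n m l b (c s)) ^ 4) (𝓝[≠] 0)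
      (𝓝 (s ^ 4 * l ^ 4 + s' ^ 4 + ((s - s') ^ 4 - s ^ 4 - s' ^ 4) * l ^ 2 + κ₁ * (l - l ^ 2) +
        κ₂ * (l ^ 3 - l ^ 2))) := by
  have h1 : Tendsto (fun b : ℝ => (s ^ 4 * s' ^ 4 * b ^ 2 + s ^ 4 * l ^ 2 + s' ^ 4 / l ^ 2 +
        ((s - s') ^ 4 - s ^ 4 - s' ^ 4) + κ₁ * (1 / l - 1) + κ₂ * (l - 1)) /
        (1 / l ^ 2 + b ^ 2 * s ^ 4)) (𝓝 0)
      (𝓝 ((s ^ 4 * s' ^ 4 * 0 ^ 2 + s ^ 4 * l ^ 2 + s' ^ 4 / l ^ 2 +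
        ((s - s') ^ 4 - s ^ 4 - s' ^ 4) + κ₁ * (1 / l - 1) + κ₂ * (l - 1)) /
        (1 / l ^ 2 + 0 ^ 2 * s ^ 4))) := by
    apply Tendsto.div
    · exact Continuous.tendsto (by fun_prop) 0
    · exact Continuous.tendsto (by fun_prop) 0
    · positivity
  have h2 := h1.mono_left (nhdsWithin_le_nhds (s := {0}ᶜ))
  have e1 : (s ^ 4 * s' ^ 4 * 0 ^ 2 + s ^ 4 * l ^ 2 + s' ^ 4 / l ^ 2 +
        ((s - s') ^ 4 - s ^ 4 - s' ^ 4) + κ₁ * (1 / l - 1) + κ₂ * (l - 1)) /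
        (1 / l ^ 2 + 0 ^ 2 * s ^ 4) =
      s ^ 4 * l ^ 4 + s' ^ 4 + ((s - s') ^ 4 - s ^ 4 - s' ^ 4) * l ^ 2 + κ₁ * (l - l ^ 2) +
        κ₂ * (l ^ 3 - l ^ 2) := by
    field_simp
    ring
  rw [e1] at h2
  refine h2.congr' ?_
  filter_upwards [self_mem_nhdsWithin] with b hb
  rw [← dist_slide hw hl hb, mul_div_cancel_right₀]
  positivity

lemma IsFrame.tendsto_dist_slide_center (hf : IsFrame q ω e n m) (hq : IsCGeom q)
    (hn : NormalizedAt q ω) (hc : RPar q ω c) (h0 : c 0 = e 0) {s l : ℝ} (hs : s ≠ 0)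
    (hl : l ≠ 0) (hl1 : l ≠ 1) :
    Tendsto (fun b => q (slide n m l b (c s)) (e 0)) (𝓝[≠] 0) (𝓝 |l * s|) := by
  have h1 : Tendsto (fun b : ℝ => (l ^ 2 * s ^ 4) / (1 / l ^ 2 + b ^ 2 * s ^ 4)) (𝓝 0)
      (𝓝 ((l ^ 2 * s ^ 4) / (1 / l ^ 2 + 0 ^ 2 * s ^ 4))) := by
    apply Tendsto.div tendsto_const_nhds
    · exact Continuous.tendsto (by fun_prop) 0
    · positivity
  have h2 := (h1.mono_left (nhdsWithin_le_nhds (s := {0}ᶜ))).sqrt.sqrt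
  have e1 : (l ^ 2 * s ^ 4) / (1 / l ^ 2 + 0 ^ 2 * s ^ 4) = (|l * s| ^ 2) ^ 2 := by
    rw [sq_abs]
    field_simp
    ring
  rw [e1, Real.sqrt_sq (sq_nonneg _), Real.sqrt_sq (abs_nonneg _)] at h2
  refine h2.congr' ?_
  filter_upwards [self_mem_nhdsWithin] with b hb
  rw [← hf.dist_slide_center hq hn hc h0 hs hl hl1 hb, mul_div_cancel_right₀ _ (by positivity)]
  have : q (slide n m l b (c s)) (e 0) ^ 4 = (q (slide n m l b (c s)) (e 0) ^ 2) ^ 2 := by ring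
  rw [this, Real.sqrt_sq (sq_nonneg _), Real.sqrt_sq (hq.nonneg _ _)]

/-- The defect `δ` of a pair of points of an `R`-line: slides converge to the homothety with
coefficient `l` if `δ = 0`. -/
lemma IsFrame.exists_defect (hf : IsFrame q ω e n m) (hq : IsCGeom q)
    (hn : NormalizedAt q ω) (hc : RPar q ω c) (h0 : c 0 = e 0) {s s' : ℝ} (hs : 0 < s)
    (hs' : 0 < s') : ∃ δ : ℝ, 0 ≤ δ ∧ (∀ t b a, word q n m (c s') (c s) s t b a =
      (a + t + a * b * t) ^ 2 + s ^ 4 * s' ^ 4 * b ^ 2 + s ^ 4 * (1 + b * t) ^ 2 +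
        s' ^ 4 * (1 + a * b) ^ 2 + ((s - s') ^ 4 - s ^ 4 - s' ^ 4) +
        (δ - 4 * s * s' ^ 3) * (a * b) + (δ - 4 * s' * s ^ 3) * (b * t)) ∧
      ∀ l, l ≠ 0 → Tendsto (fun b => q (c s') (slide n m l b (c s)) ^ 4) (𝓝[≠] 0)
        (𝓝 ((s' - l * s) ^ 4 + l * δ * (l - 1) ^ 2)) := by
  obtain ⟨κ₁, κ₂, hw⟩ := hf.exists_word_form hq hn hc h0 hs.ne' hs'.ne'
  have hL := fun l => tendsto_dist_slide hw (l := l)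
  obtain ⟨α, hα⟩ : ∃ α, α = κ₁ + 4 * s * s' ^ 3 := ⟨_, rfl⟩
  obtain ⟨β, hβ⟩ : ∃ β, β = κ₂ + 4 * s' * s ^ 3 := ⟨_, rfl⟩
  have hL' : ∀ l, s ^ 4 * l ^ 4 + s' ^ 4 + ((s - s') ^ 4 - s ^ 4 - s' ^ 4) * l ^ 2 +
      κ₁ * (l - l ^ 2) + κ₂ * (l ^ 3 - l ^ 2) =
      (s' - l * s) ^ 4 + l * ((1 - l) * (α - β * l)) := by
    intro l
    rw [hα, hβ]
    ring
  have hx' := hf.rline_not_mem hq hn hc h0 hs'.ne'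
  have hx := hf.rline_not_mem hq hn hc h0 hs.ne'
  -- The slid point has limiting distance `l * s` from the center, so its distance from `c s'` is at
  -- least `|s' - l * s|` in the limit. The surplus over this collinear value must be nonnegative.
  have key : ∀ l, 0 < l → l ≠ 1 → 0 ≤ (1 - l) * (α - β * l) := by
    intro l hl hl1
    have h1 := hL l hl.ne'
    rw [hL'] at h1
    have h2 := hf.tendsto_dist_slide_center hq hn hc h0 hs.ne' hl.ne' hl1
    rw [abs_of_pos (mul_pos hl hs)] at h2
    have h3 : Tendsto (fun b => (s' - q (slide n m l b (c s)) (e 0)) ^ 4) (𝓝[≠] 0)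
      (𝓝 ((s' - l * s) ^ 4)) := (tendsto_const_nhds.sub h2).pow 4
    have h4 := le_of_tendsto_of_tendsto h3 h1 (Eventually.of_forall fun b => by
      have hg := hf.slide_not_mem l b hx
      have hd : q (c s') (e 0) = s' := by
        rw [← h0, hc.2, sub_zero, abs_of_pos hs']
      have t1 := hq.triangle hn (ne_omega_of_not_mem hx') (ne_omega_of_not_mem hg) (hf.cpar.1 0)
      have t2 := hq.triangle hn (ne_omega_of_not_mem hg) (ne_omega_of_not_mem hx') (hf.cpar.1 0)
      rw [hq.symm _ (c s')] at t2
      rw [hd] at t1 t2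
      have : |s' - q (slide n m l b (c s)) (e 0)| ≤ q (c s') (slide n m l b (c s)) :=
        abs_le.2 ⟨by linarith, by linarith⟩
      simp only
      rw [← Even.pow_abs (by decide : Even 4) (s' - _)]
      exact pow_le_pow_left₀ (abs_nonneg _) this 4)
    have h5 : 0 ≤ l * ((1 - l) * (α - β * l)) := by linarith
    exact nonneg_of_mul_nonneg_right h5 hl
  -- The factor `1 - l` changes sign at `l = 1`, so the other factor must vanish there.
  have hαβ : α = β := by
    have low : ∀ ε, 0 < ε → ε < 1 → 0 ≤ α - β + β * ε := by
      intro ε h1 h2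
      have := key (1 - ε) (by linarith) (by linarith)
      have h3 : 0 ≤ ε * (α - β + β * ε) := by linarith
      exact nonneg_of_mul_nonneg_right h3 h1
    have high : ∀ ε, 0 < ε → ε < 1 → α - β ≤ β * ε := by
      intro ε h1 h2
      have := key (1 + ε) (by linarith) (by linarith)
      have h3 : 0 ≤ ε * (β * ε - (α - β)) := by linarith
      linarith [nonneg_of_mul_nonneg_right h3 h1]
    have t : Tendsto (fun ε : ℝ => β * ε) (𝓝[>] 0) (𝓝 0) := by
      have : Tendsto (fun ε : ℝ => β * ε) (𝓝 0) (𝓝 (β * 0)) := Continuous.tendsto (by fun_prop) 0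
      rw [mul_zero] at this
      exact this.mono_left nhdsWithin_le_nhds
    have ev : ∀ᶠ ε : ℝ in 𝓝[>] 0, 0 < ε ∧ ε < 1 := Ioo_mem_nhdsGT one_pos
    have u1 : α - β ≤ 0 := ge_of_tendsto t (ev.mono fun ε h => high ε h.1 h.2)
    have u2 : -(α - β) ≤ 0 := ge_of_tendsto t (ev.mono fun ε h => by linarith [low ε h.1 h.2])
    linarith
  subst hαβ
  refine ⟨α, ?_, fun t b a => ?_, fun l hl => ?_⟩
  · have := key (1 / 2) (by norm_num) (by norm_num)
    linarith
  · rw [hw]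
    have e1 : α - 4 * s * s' ^ 3 = κ₁ := by linarith
    have e2 : α - 4 * s' * s ^ 3 = κ₂ := by linarith
    rw [e1, e2]
  · have h1 := hL l hl
    rw [hL'] at h1
    convert h1 using 2
    ring

end Words

/-! ### Tangency of `C`-circles and the limits of slides -/

section Tangency

variable {X : Type*} {q : X → X → ℝ} {ω : X} {e c : ℝ → X} {n m : ℝ → X → X}

/-- Bounded sequences converge along ultrafilters. -/
def Proper (q : X → X → ℝ) (ω : X) : Prop :=
  ∀ (U : Ultrafilter ℕ) (x : ℕ → X) (y : X) (R : ℝ), y ≠ ω →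
    (∀ᶠ k in (U : Filter ℕ), x k ≠ ω ∧ q (x k) y ≤ R) →
    ∃ z, z ≠ ω ∧ Tendsto (fun k => q (x k) z) U (𝓝 0)

lemma IsGauge.tendsto_dist (hq : IsGauge q) (hn : NormalizedAt q ω) {F : Filter ℕ}
    {x x' : ℕ → X} {z z' : X} (hz : z ≠ ω) (hz' : z' ≠ ω) (hx : ∀ᶠ k in F, x k ≠ ω)
    (hx' : ∀ᶠ k in F, x' k ≠ ω) (h : Tendsto (fun k => q (x k) z) F (𝓝 0))
    (h' : Tendsto (fun k => q (x' k) z') F (𝓝 0)) :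
    Tendsto (fun k => q (x k) (x' k)) F (𝓝 (q z z')) := by
  have h1 := h.add h'
  rw [add_zero] at h1
  rw [tendsto_iff_dist_tendsto_zero]
  refine squeeze_zero' (Eventually.of_forall fun k => dist_nonneg) ?_ h1
  filter_upwards [hx, hx'] with k h2 h3
  rw [Real.dist_eq]
  have t1 := hq.triangle hn h2 hz h3
  have t2 := hq.triangle hn hz hz' h3
  have t3 := hq.triangle hn hz h2 hz'
  have t4 := hq.triangle hn h2 h3 hz'
  rw [hq.symm z' (x' k)] at t2
  rw [hq.symm z (x k)] at t3
  exact abs_le.2 ⟨by linarith, by linarith⟩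

/-- The orbit of `y` under `m` is a unit speed ℂ-line for the gauge normalized at `e 0`; this is
that statement in the original gauge. -/
lemma IsFrame.dist_m (hf : IsFrame q ω e n m) (hq : IsCGeom q) {y : X}
    (hy : y ∉ frameCircle ω e) (a b : ℝ) : q (m a y) (m b y) =
      √|a - b| * (q (m a y) (e 0) * q (m b y) (e 0)) := by
  have hne : ∀ b, m b y ≠ e 0 := fun b => ne_center_of_not_mem (hf.m_not_mem b hy)
  have h := (hf.shift_m.cpar y (ne_center_of_not_mem hy)).2 a b
  simp only at h
  rw [normAt_apply q (hne a) (hne b)] at h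
  exact (div_eq_iff (mul_pos (hq.pos _ _ (hne a)) (hq.pos _ _ (hne b))).ne').1 h

lemma IsFrame.tendsto_dist_m_center (hf : IsFrame q ω e n m) (hq : IsCGeom q)
    (hn : NormalizedAt q ω) (hc : RPar q ω c) (h0 : c 0 = e 0) {s : ℝ} (hs : s ≠ 0) (t : ℝ) :
    Tendsto (fun b => q (m b (n t (c s))) (e 0)) (𝓝 0) (𝓝 (q (n t (c s)) (e 0))) := by
  have h1 : Tendsto (fun b : ℝ => (s ^ 4 + t ^ 2) / modSq b t s) (𝓝 0)
      (𝓝 ((s ^ 4 + t ^ 2) / modSq 0 t s)) := by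
    refine Tendsto.div tendsto_const_nhds ?_ (modSq_pos _ _ hs).ne'
    unfold modSq
    exact Continuous.tendsto (by fun_prop) 0
  have h2 := h1.sqrt.sqrt
  have e0 : ∀ x : ℝ, 0 ≤ x → √√(x ^ 4) = x := fun x hx => by
    have : x ^ 4 = (x ^ 2) ^ 2 := by ring
    rw [this, Real.sqrt_sq (sq_nonneg _), Real.sqrt_sq hx]
  have e1 : ∀ b, √√((s ^ 4 + t ^ 2) / modSq b t s) = q (m b (n t (c s))) (e 0) := by
    intro b
    rw [← hf.dist_mn_center hq hn hc h0 b t hs, mul_div_cancel_right₀ _ (modSq_pos _ _ hs).ne',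
      e0 _ (hq.nonneg _ _)]
  simp only [e1, hf.shift_m.zero] at h2
  exact h2

/-- The `C`-circle through the center and a point `y` is tangent to the `C`-line through `y`. -/
lemma IsFrame.exists_tangent (hf : IsFrame q ω e n m) (hq : IsCGeom q) (hn : NormalizedAt q ω)
    (hP : Proper q ω) (hc : RPar q ω c) (h0 : c 0 = e 0) {s : ℝ} (hs : s ≠ 0) (t : ℝ)
    {ε η : ℝ} (hε : 0 < ε) (hη : 0 < η) : ∃ a b, 0 < a ∧ a < η ∧ |b| < η ∧
      q (m b (n t (c s))) (n a (n t (c s))) ^ 4 ≤ ε * a ^ 2 := by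
  obtain ⟨y, hy⟩ : ∃ y, y = n t (c s) := ⟨_, rfl⟩
  have hyF : y ∉ frameCircle ω e := hy ▸ hf.n_not_mem t (hf.rline_not_mem hq hn hc h0 hs)
  have hyω := ne_omega_of_not_mem hyF
  have hcen := hf.tendsto_dist_m_center hq hn hc h0 hs t
  rw [← hy] at hcen ⊢
  have hcy := hf.shift_n.cpar y hyω
  -- Blow-up at `y`: dilations centered at `y` with coefficients `l k → ∞` preserve the ℂ-line
  -- through `y`. The images of the ℂ-circle through `y` and `e 0` converge to a ℂ-line through `y`,
  -- which must be the same one.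
  obtain ⟨n', m', hf'⟩ := hq.exists_frame hn hcy
  obtain ⟨ρ, hρ⟩ : ∃ ρ, ρ = q y (e 0) := ⟨_, rfl⟩
  have hρ0 : 0 < ρ := hρ ▸ hq.pos _ _ (ne_center_of_not_mem hyF)
  rw [← hρ] at hcen
  set l : ℕ → ℝ := fun k => (k : ℝ) + 1 with hl
  have hl0 : ∀ k, 0 < l k := fun k => by positivity
  -- Chosen so that the magnified orbit `z k` has distances tending to `√|τ - τ'|`.
  set β : ℕ → ℝ := fun k => 1 / ((l k) ^ 2 * ρ ^ 4) with hβ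
  set H : ℕ → X → X := fun k => dilation n' m' (l k) 1 with hH
  set z : ℕ → ℝ → X := fun k τ => H k (m (β k * τ) y) with hz
  have hmω : ∀ b, m b y ≠ ω := fun b => ne_omega_of_not_mem (hf.m_not_mem b hyF)
  have hzω : ∀ k τ, z k τ ≠ ω := fun k τ => hf'.dilation_ne hq hn (hl0 k) one_ne_zero (hmω _)
  set r : ℕ → ℝ → ℝ := fun k τ => q (m (β k * τ) y) (e 0) / ρ with hr
  have hz_dist : ∀ k τ τ', q (z k τ) (z k τ') = √|τ - τ'| * (r k τ * r k τ') := by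
    intro k τ τ'
    have hb0 : 0 ≤ β k := by simp only [hβ]; positivity
    have h1 : √(β k) = 1 / (l k * ρ ^ 2) := by
      have : β k = (1 / (l k * ρ ^ 2)) ^ 2 := by
        simp only [hβ]; field_simp
      rw [this, Real.sqrt_sq]
      have := hl0 k
      positivity
    simp only [hz, hH, hr]
    rw [hf'.dist_dilation hq hn (hl0 k) one_ne_zero (hmω _) (hmω _), hf.dist_m hq hyF,
      ← mul_sub, abs_mul, abs_of_nonneg hb0, Real.sqrt_mul hb0, h1]
    have := (hl0 k).ne'
    field_simp
  have hHe : ∀ k a, H k (n a y) = n (l k ^ 2 * a) y := fun k a =>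
    hf'.dilation_apply (hl0 k).ne' one_ne_zero a
  have hz0 : ∀ k, z k 0 = y := by
    intro k
    have h1 := hHe k 0
    simp only [mul_zero, hf.shift_n.zero] at h1
    simp only [hz, mul_zero, hf.shift_m.zero, h1]
  have hl_top : Tendsto l atTop atTop :=
    tendsto_atTop_add_const_right _ _ tendsto_natCast_atTop_atTop
  have hl_inv : Tendsto (fun k => 1 / l k ^ 2) atTop (𝓝 0) := by
    have := (hl_top.inv_tendsto_atTop).pow 2
    simpa using this
  have hβ0 : Tendsto β atTop (𝓝 0) := by
    have := hl_inv.mul_const (1 / ρ ^ 4)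
    rw [zero_mul] at this
    refine this.congr fun k => ?_
    simp only [hβ]
    field_simp
  have hβτ : ∀ τ, Tendsto (fun k => β k * τ) atTop (𝓝 0) := fun τ => by
    simpa using hβ0.mul_const τ
  have hr1 : ∀ τ, Tendsto (fun k => r k τ) atTop (𝓝 1) := by
    intro τ
    have := (hcen.comp (hβτ τ)).div_const ρ
    rw [div_self hρ0.ne'] at this
    exact this
  obtain ⟨U, hU⟩ : ∃ U : Ultrafilter ℕ, (U : Filter ℕ) ≤ atTop :=
    ⟨hyperfilter ℕ, Nat.hyperfilter_le_atTop⟩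
  have hzlim : ∀ τ τ', Tendsto (fun k => q (z k τ) (z k τ')) U (𝓝 √|τ - τ'|) := by
    intro τ τ'
    have := ((hr1 τ).mul (hr1 τ')).const_mul √|τ - τ'|
    simp only [mul_one] at this
    exact (this.mono_left hU).congr fun k => (hz_dist k τ τ').symm
  have hE : ∀ τ, ∃ x, x ≠ ω ∧ Tendsto (fun k => q (z k τ) x) U (𝓝 0) := by
    intro τ
    refine hP U (fun k => z k τ) y (√|τ - 0| + 1) hyω ?_
    have := (hzlim τ 0).eventually (gt_mem_nhds (lt_add_one _))
    filter_upwards [this] with k hk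
    rw [hz0] at hk
    exact ⟨hzω k τ, hk.le⟩
  choose E hEω hEl using hE
  have hEpar : CPar q ω E := by
    refine ⟨hEω, fun τ τ' => ?_⟩
    exact tendsto_nhds_unique (hq.toIsGauge.tendsto_dist hn (hEω τ) (hEω τ')
      (Eventually.of_forall fun k => hzω k τ) (Eventually.of_forall fun k => hzω k τ')
      (hEl τ) (hEl τ')) (hzlim τ τ')
  have hE0 : E 0 = y := by
    have h1 := hEl 0
    simp only [hz0] at h1
    exact (hq.eq_of_eq_zero (tendsto_nhds_unique tendsto_const_nhds h1)).symm
  have hEy : E 0 = n 0 y := by rw [hE0, hf.shift_n.zero]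
  have hinj : Set.InjOn Real.sqrt (Set.Ici 0) := fun a ha b hb hab =>
    (Real.sqrt_inj ha hb).1 hab
  -- The limit line may carry either orientation, hence `τ = ±1`.
  obtain ⟨τ, hτ1, hτ⟩ : ∃ τ : ℝ, |τ| = 1 ∧ E τ = n 1 y := by
    rcases hcy.eq_or_eq_neg isProfile_sqrt hinj hq.toIsGauge hEpar hEy
      (hq.range_cpar_eq hn hEpar hcy hEy).subset with h | h
    · exact ⟨1, by simp, h 1⟩
    · exact ⟨-1, by simp, by simpa using h (-1)⟩
  have hlim := hEl τ
  rw [hτ] at hlim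
  have ev1 := hlim.eventually (gt_mem_nhds (lt_min one_pos hε))
  have ev2 := (hl_inv.eventually (gt_mem_nhds hη)).filter_mono hU
  have ev3 := (hβ0.eventually (gt_mem_nhds hη)).filter_mono hU
  obtain ⟨k, h1, h2, h3⟩ := (ev1.and (ev2.and ev3)).exists
  have hlk := hl0 k
  refine ⟨1 / l k ^ 2, β k * τ, by positivity, h2, ?_, ?_⟩
  · rw [abs_mul, hτ1, mul_one, abs_of_nonneg (by simp only [hβ]; positivity)]
    exact h3
  · have h4 := hHe k (1 / l k ^ 2)
    rw [mul_one_div_cancel (by positivity)] at h4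
    rw [← h4] at h1
    simp only [hz, hH] at h1
    rw [hf'.dist_dilation hq hn hlk one_ne_zero (hmω _) (hf.shift_n.ne hyω _)] at h1
    set Q := q (m (β k * τ) y) (n (1 / l k ^ 2) y) with hQ
    have hQ0 : 0 ≤ Q := hq.nonneg _ _
    -- A number in `[0, 1]` dominates its fourth power. Scaling back by `l k` turns the closeness
    -- into `ε * a ^ 2` with `a = 1 / l k ^ 2`.
    have h5 : (l k * Q) ^ 4 ≤ min 1 ε := by
      have h6 : 0 ≤ l k * Q := by positivity
      have h7 : l k * Q ≤ 1 := h1.le.trans (min_le_left _ _)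
      calc (l k * Q) ^ 4 ≤ (l k * Q) ^ 1 := pow_le_pow_of_le_one h6 h7 (by norm_num)
        _ ≤ min 1 ε := by rw [pow_one]; exact h1.le
    have h6 := h5.trans (min_le_right _ _)
    have e1 : ε * (1 / l k ^ 2) ^ 2 = ε / l k ^ 4 := by field_simp
    rw [e1, le_div_iff₀ (by positivity)]
    rw [mul_pow] at h6
    linarith

/-- For `0 < δ < 4K` the form `a² - (2K - δ) a b + K² b²` is positive definite, and the remaining
terms are of higher order. Such a lower bound excludes tangency. -/
lemma defect_eq_zero_aux {K δ M : ℝ} (hK : 0 < K) (hδ : 0 < δ) (hδK : δ < 4 * K) (hM : 0 < M) :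
    ∃ ε > 0, ∃ η > 0, ∀ a b, 0 < a → a < η → |b| < η → ε * a ^ 2 * M <
      a ^ 2 + b ^ 2 * K ^ 2 - a * b * (2 * K - δ) + a * b * (-2 * a + 2 * K * b + K * a * b) := by
  have h1 : |2 * K - δ| < 2 * K := abs_lt.2 ⟨by linarith, by linarith⟩
  obtain ⟨g, hg⟩ : ∃ g, g = (2 * K - |2 * K - δ|) / 2 := ⟨_, rfl⟩
  have hg0 : 0 < g := by rw [hg]; linarith
  -- Bounds the cross coefficient including the small perturbation while staying below `2K`;
  -- completing the square leaves the factor `1 - θ²/(4K²)`.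
  obtain ⟨θ, hθ⟩ : ∃ θ, θ = |2 * K - δ| + g := ⟨_, rfl⟩
  have hθ0 : 0 ≤ θ := by rw [hθ]; positivity
  have hθK : θ < 2 * K := by rw [hθ]; linarith
  have hγ : 0 < 1 - θ ^ 2 / (4 * K ^ 2) := by
    rw [sub_pos, div_lt_one (by positivity)]
    nlinarith
  refine ⟨(1 - θ ^ 2 / (4 * K ^ 2)) / (2 * M), by positivity, min 1 (g / (2 + 3 * K)),
    lt_min one_pos (by positivity), fun a b ha haη hbη => ?_⟩
  have ha1 : a < 1 := haη.trans_le (min_le_left _ _)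
  have ha2 := haη.trans_le (min_le_right _ _)
  have hb2 := hbη.trans_le (min_le_right _ _)
  rw [lt_div_iff₀ (by positivity)] at ha2 hb2
  have hb0 := abs_nonneg b
  have hE : |(2 * K - δ) - (-2 * a + 2 * K * b + K * a * b)| ≤ θ := by
    have e1 : |-2 * a + 2 * K * b + K * a * b| ≤ 2 * a + 2 * K * |b| + K * |b| := by
      refine (abs_add_le _ _).trans (add_le_add ((abs_add_le _ _).trans (add_le_add ?_ ?_)) ?_)
      · rw [abs_mul, abs_of_pos ha]; norm_num
      · rw [abs_mul, abs_of_pos (by positivity : 0 < 2 * K)]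
      · rw [abs_mul, abs_of_pos (by positivity : 0 < K * a)]
        have : K * a ≤ K := by nlinarith
        exact mul_le_mul_of_nonneg_right this hb0
    have e2 : 2 * a + 2 * K * |b| + K * |b| ≤ g := by nlinarith
    exact (abs_sub _ _).trans (by rw [hθ]; linarith)
  have h2 : a * b * ((2 * K - δ) - (-2 * a + 2 * K * b + K * a * b)) ≤ a * |b| * θ := by
    refine (le_abs_self _).trans ?_
    rw [abs_mul, abs_mul, abs_of_pos ha]
    exact mul_le_mul_of_nonneg_left hE (by positivity)
  have h3 : 0 ≤ (|b| * K - θ * a / (2 * K)) ^ 2 := sq_nonneg _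
  have h4 : (|b| * K - θ * a / (2 * K)) ^ 2 =
      b ^ 2 * K ^ 2 - a * |b| * θ + θ ^ 2 / (4 * K ^ 2) * a ^ 2 := by
    have h5 : b ^ 2 = |b| ^ 2 := (sq_abs b).symm
    rw [h5]
    field_simp
    ring
  have h5 : (1 - θ ^ 2 / (4 * K ^ 2)) / (2 * M) * a ^ 2 * M =
      (1 - θ ^ 2 / (4 * K ^ 2)) * a ^ 2 / 2 := by
    field_simp
  have h6 : 0 < (1 - θ ^ 2 / (4 * K ^ 2)) * a ^ 2 := by positivity
  rw [h5]
  linarith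

lemma IsFrame.tendsto_dist_slide_self (hf : IsFrame q ω e n m) (hq : IsCGeom q)
    (hn : NormalizedAt q ω) (hP : Proper q ω) (hc : RPar q ω c) (h0 : c 0 = e 0) {s : ℝ}
    (hs : 0 < s) {l : ℝ} (hl : l ≠ 0) :
    Tendsto (fun b => q (c s) (slide n m l b (c s)) ^ 4) (𝓝[≠] 0) (𝓝 ((s - l * s) ^ 4)) := by
  obtain ⟨δ, hδ, hw, hL⟩ := hf.exists_defect hq hn hc h0 hs hs
  suffices δ = 0 by
    have := hL l hl
    simpa [‹δ = 0›] using this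
  by_contra hne
  have hδ0 : 0 < δ := lt_of_le_of_ne hδ (Ne.symm hne)
  -- Nonnegativity of the limit for `l = -1`.
  have hδ1 : δ ≤ 4 * s ^ 4 := by
    have h1 := hL (-1) (by norm_num)
    have h2 : 0 ≤ (s - -1 * s) ^ 4 + -1 * δ * (-1 - 1) ^ 2 :=
      ge_of_tendsto' h1 fun b => pow_nonneg (hq.nonneg _ _) 4
    linarith
  have hs4 : 0 < s ^ 4 := by positivity
  obtain ⟨ε, hε, η, hη, h⟩ := defect_eq_zero_aux (K := 1 + s ^ 4) (M := 4 + s ^ 4)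
    (by linarith) hδ0 (by linarith) (by linarith)
  -- Tangency is used at the point of height `1` above `c s`: there `K = 1 + s ^ 4`, so that `δ <
  -- 4K` strictly. At height `0` the borderline `δ = 4K` would remain.
  obtain ⟨a, b, ha, haη, hbη, hab⟩ := hf.exists_tangent hq hn hP hc h0 hs.ne' 1 hε
    (lt_min one_pos hη)
  have h1 := h a (-b) ha (haη.trans_le (min_le_right _ _))
    (by rw [abs_neg]; exact hbη.trans_le (min_le_right _ _))
  have hb1 : |b| < 1 := hbη.trans_le (min_le_left _ _)
  have h2 := hf.word_swap hq hn hc h0 hs.ne' hs.ne' (-1) (-b) (a + 1)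
  rw [neg_neg, neg_neg, hf.shift_n.add, hw] at h2
  have h3 : modSq b 1 s ≤ 4 + s ^ 4 := by
    rw [modSq]
    have := abs_lt.1 hb1
    have hb2 : b ^ 2 ≤ 1 := by nlinarith
    nlinarith
  have h4 := mul_le_mul hab h3 (modSq_pos b 1 hs.ne').le (by positivity)
  rw [← h2] at h4
  linarith

end Tangency

/-! ### The homothety as a limit of words -/

section Homothety

variable {X : Type*} {q : X → X → ℝ} {ω : X} {e c : ℝ → X} {n m : ℝ → X → X}

lemma sqrt_sqrt_pow_four (x : ℝ) : √√(x ^ 4) = |x| := by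
  have : x ^ 4 = (x ^ 2) ^ 2 := by ring
  rw [this, Real.sqrt_sq (sq_nonneg _), Real.sqrt_sq_eq_abs]

lemma tendsto_of_pow_four {α : Type*} {F : Filter α} {f : α → ℝ} {x : ℝ} (hf : ∀ a, 0 ≤ f a)
    (h : Tendsto (fun a => f a ^ 4) F (𝓝 (x ^ 4))) : Tendsto f F (𝓝 |x|) := by
  have h1 := h.sqrt.sqrt
  rw [sqrt_sqrt_pow_four] at h1
  exact h1.congr fun a => by rw [sqrt_sqrt_pow_four, abs_of_nonneg (hf a)]

lemma IsFrame.tendsto_slide (hf : IsFrame q ω e n m) (hq : IsCGeom q)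
    (hn : NormalizedAt q ω) (hP : Proper q ω) (hc : RPar q ω c) (h0 : c 0 = e 0) {s l : ℝ}
    (hs : 0 < s) (hl : 0 < l) (hl1 : l ≠ 1) :
    Tendsto (fun b => q (c (l * s)) (slide n m l b (c s))) (𝓝[≠] 0) (𝓝 0) := by
  have hs' : 0 < l * s := mul_pos hl hs
  obtain ⟨δ, hδ, -, hL⟩ := hf.exists_defect hq hn hc h0 hs hs'
  have bound : ∀ k, 0 < k → (l * s - k * s) ^ 4 + k * δ * (k - 1) ^ 2 ≤
      (|l * s - s| + |s - k * s|) ^ 4 := by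
    intro k hk
    have h1 := tendsto_of_pow_four (fun b => hq.nonneg _ _)
      (hf.tendsto_dist_slide_self hq hn hP hc h0 hs hk.ne')
    have h2 := (h1.const_add |l * s - s|).pow 4
    refine le_of_tendsto_of_tendsto (hL k hk.ne') h2 (Eventually.of_forall fun b => ?_)
    have hg := hf.slide_not_mem k b (hf.rline_not_mem hq hn hc h0 hs.ne')
    have t := hq.triangle hn (hc.1 (l * s)) (hc.1 s) (ne_omega_of_not_mem hg)
    rw [hc.2] at t
    exact pow_le_pow_left₀ (hq.nonneg _ _) t 4
  -- Take `k` on the other side of `1` from `l`. The triangle inequality through `c s` then bounds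
  -- the limit by the collinear distance itself and leaves no room for the defect.
  have hδ0 : δ = 0 := by
    rcases lt_or_gt_of_ne hl1 with h | h
    · have h1 := bound 2 two_pos
      have e1 : |l * s - s| = s - l * s := by rw [abs_of_nonpos (by nlinarith)]; ring
      have e2 : |s - 2 * s| = s := by rw [abs_of_nonpos (by linarith)]; ring
      rw [e1, e2] at h1
      have e3 : (s - l * s + s) ^ 4 = (l * s - 2 * s) ^ 4 := by ring
      linarith
    · have h1 := bound (1 / 2) (by norm_num)
      have e1 : |l * s - s| = l * s - s := abs_of_nonneg (by nlinarith)
      have e2 : |s - 1 / 2 * s| = s / 2 := by rw [abs_of_nonneg (by linarith)]; ring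
      rw [e1, e2] at h1
      have e3 : (l * s - s + s / 2) ^ 4 = (l * s - 1 / 2 * s) ^ 4 := by ring
      linarith
  have h1 := hL l hl.ne'
  rw [hδ0] at h1
  have e1 : (l * s - l * s) ^ 4 + l * 0 * (l - 1) ^ 2 = (0 : ℝ) ^ 4 := by ring
  rw [e1] at h1
  simpa using tendsto_of_pow_four (fun b => hq.nonneg _ _) h1

/-- `slide` and `dilation` differ by the inner letter `m (b * l)`, which moves `c s` by an amount
tending to zero. -/
lemma IsFrame.tendsto_dilation (hf : IsFrame q ω e n m) (hq : IsCGeom q)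
    (hn : NormalizedAt q ω) (hP : Proper q ω) (hc : RPar q ω c) (h0 : c 0 = e 0) {s l : ℝ}
    (hs : 0 < s) (hl : 0 < l) (hl1 : l ≠ 1) :
    Tendsto (fun b => q (dilation n m l b (c s)) (c (l * s))) (𝓝[≠] 0) (𝓝 0) := by
  have hx := hf.rline_not_mem hq hn hc h0 hs.ne'
  have h1 := hf.tendsto_slide hq hn hP hc h0 hs hl hl1
  have hm := hf.tendsto_dist_m_center hq hn hc h0 hs.ne' 0
  rw [hf.shift_n.zero] at hm
  have hb : Tendsto (fun b : ℝ => b * l) (𝓝 0) (𝓝 0) := by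
    have : Tendsto (fun b : ℝ => b * l) (𝓝 0) (𝓝 (0 * l)) := Continuous.tendsto (by fun_prop) 0
    rwa [zero_mul] at this
  have h2 : Tendsto (fun b : ℝ => l * (√|0 - b * l| *
      (q (c s) (e 0) * q (m (b * l) (c s)) (e 0)))) (𝓝 0)
      (𝓝 (l * (√|0 - 0 * l| * (q (c s) (e 0) * q (c s) (e 0))))) := by
    refine (Tendsto.mul ?_ ((hm.comp hb).const_mul _)).const_mul l
    exact Continuous.tendsto (by fun_prop) 0
  have h3 := (h2.mono_left (nhdsWithin_le_nhds (s := {0}ᶜ))).add h1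
  simp only [zero_mul, sub_zero, abs_zero, Real.sqrt_zero, mul_zero, add_zero] at h3
  refine squeeze_zero' (Eventually.of_forall fun b => hq.nonneg _ _) ?_ h3
  filter_upwards [self_mem_nhdsWithin] with b hb
  have hxω := ne_omega_of_not_mem hx
  have hmω := ne_omega_of_not_mem (hf.m_not_mem (b * l) hx)
  have hg := hf.slide_not_mem l b hx
  have t := hq.triangle hn (hf.dilation_ne hq hn hl hb hxω) (ne_omega_of_not_mem hg) (hc.1 (l * s))
  have h4 : q (dilation n m l b (c s)) (slide n m l b (c s)) = l * (√|b * l| *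
      (q (c s) (e 0) * q (m (b * l) (c s)) (e 0))) := by
    rw [hf.slide_eq_dilation, hf.dist_dilation hq hn hl hb hxω hmω]
    have := hf.dist_m hq hx 0 (b * l)
    rw [hf.shift_m.zero, zero_sub, abs_neg] at this
    rw [this]
  rw [h4, hq.symm (slide n m l b (c s))] at t
  simpa using t

/-- Every dilation is an exact homothety and acts correctly on the ℂ-line, so an ultrafilter limit
as `b → 0` keeps both properties. On ℝ-lines through the center the limit is identified by
`IsFrame.tendsto_dilation`. -/
theorem IsFrame.exists_homothety (hf : IsFrame q ω e n m) (hq : IsCGeom q)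
    (hn : NormalizedAt q ω) (hP : Proper q ω) {l : ℝ} (hl : 0 < l) :
    ∃ h : X → X, h ω = ω ∧ (∀ x, x ≠ ω → h x ≠ ω) ∧
      (∀ x y, x ≠ ω → y ≠ ω → q (h x) (h y) = l * q x y) ∧ (∀ t, h (e t) = e (l ^ 2 * t)) ∧
      ∀ c, RPar q ω c → c 0 = e 0 → ∀ s, h (c s) = c (l * s) := by
  by_cases hl1 : l = 1
  · subst hl1
    exact ⟨id, rfl, fun _ h => h, fun x y _ _ => by simp, fun t => by simp, fun c _ _ s => by simp⟩
  obtain ⟨U, hU⟩ : ∃ U : Ultrafilter ℕ, (U : Filter ℕ) ≤ atTop :=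
    ⟨hyperfilter ℕ, Nat.hyperfilter_le_atTop⟩
  set β : ℕ → ℝ := fun k => 1 / ((k : ℝ) + 1) with hβ
  have hβ0 : ∀ k, β k ≠ 0 := fun k => by simp only [hβ]; positivity
  have hβt : Tendsto β U (𝓝[≠] 0) := by
    refine tendsto_nhdsWithin_iff.2 ⟨?_, Eventually.of_forall hβ0⟩
    exact tendsto_one_div_add_atTop_nhds_zero_nat.mono_left hU
  have hex : ∀ x, ∃ z, (x = ω → z = ω) ∧
      (x ≠ ω → z ≠ ω ∧ Tendsto (fun k => q (dilation n m l (β k) x) z) U (𝓝 0)) := by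
    intro x
    by_cases hx : x = ω
    · exact ⟨ω, fun _ => rfl, fun h => absurd hx h⟩
    · obtain ⟨z, hz⟩ := hP U (fun k => dilation n m l (β k) x) (e 0) (l * q x (e 0)) (hf.cpar.1 0)
        (Eventually.of_forall fun k => ⟨hf.dilation_ne hq hn hl (hβ0 k) hx, by
          have h1 := hf.dilation_apply hl.ne' (hβ0 k) 0
          rw [mul_zero] at h1
          have h2 := hf.dist_dilation hq hn hl (hβ0 k) hx (hf.cpar.1 0)
          rw [h1] at h2
          exact h2.le⟩)
      exact ⟨z, fun h => absurd h hx, fun _ => hz⟩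
  choose h hhω hh using hex
  have huniq : ∀ x z, x ≠ ω → z ≠ ω →
      Tendsto (fun k => q (dilation n m l (β k) x) z) U (𝓝 0) → h x = z := by
    intro x z hx hz hxz
    have hev : ∀ᶠ k in (U : Filter ℕ), dilation n m l (β k) x ≠ ω :=
      Eventually.of_forall fun k => hf.dilation_ne hq hn hl (hβ0 k) hx
    have h1 := hq.toIsGauge.tendsto_dist hn (hh x hx).1 hz hev hev (hh x hx).2 hxz
    simp only [hq.self] at h1
    exact hq.eq_of_eq_zero (tendsto_nhds_unique h1 tendsto_const_nhds)
  refine ⟨h, hhω ω rfl, fun x hx => (hh x hx).1, fun x y hx hy => ?_, fun t => ?_, ?_⟩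
  · have h1 := hq.toIsGauge.tendsto_dist hn (hh x hx).1 (hh y hy).1
      (Eventually.of_forall fun k => hf.dilation_ne hq hn hl (hβ0 k) hx)
      (Eventually.of_forall fun k => hf.dilation_ne hq hn hl (hβ0 k) hy) (hh x hx).2 (hh y hy).2
    simp only [fun k => hf.dist_dilation hq hn hl (hβ0 k) hx hy] at h1
    exact tendsto_nhds_unique h1 tendsto_const_nhds
  · refine huniq _ _ (hf.cpar.1 t) (hf.cpar.1 _) ?_
    simp only [fun k => hf.dilation_apply hl.ne' (hβ0 k) t, hq.self]
    exact tendsto_const_nhds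
  · have pos : ∀ c, RPar q ω c → c 0 = e 0 → ∀ s, 0 < s → h (c s) = c (l * s) :=
      fun c hc h0 s hs => huniq _ _ (hc.1 s) (hc.1 _)
        ((hf.tendsto_dilation hq hn hP hc h0 hs hl hl1).comp hβt)
    intro c hc h0 s
    rcases lt_trichotomy s 0 with hs | rfl | hs
    -- Negative parameters reduce to positive ones on the reversed line.
    · have := pos (fun s => c (-s)) hc.neg (by simpa using h0) (-s) (neg_pos.2 hs)
      simpa using this
    · rw [mul_zero, h0]
      refine huniq _ _ (hf.cpar.1 0) (hf.cpar.1 _) ?_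
      have h1 : ∀ k, dilation n m l (β k) (e 0) = e 0 := fun k => by
        simpa using hf.dilation_apply hl.ne' (hβ0 k) 0
      simp only [h1, hq.self]
      exact tendsto_const_nhds
    · exact pos c hc h0 s hs

end Homothety

/-! ### Homotheties and fibers -/

section Dilation

variable {X : Type*} {q : X → X → ℝ} {ω : X} {e : ℝ → X} {T : ℝ → X → X} {l : ℝ} {h : X → X}

/-- A homothety of the complement of `ω` with center `e 0` and coefficient `l` that preserves the
lines through the center. -/
structure IsDilation (q : X → X → ℝ) (ω : X) (e : ℝ → X) (l : ℝ) (h : X → X) : Prop where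
  map_omega : h ω = ω
  ne : ∀ x, x ≠ ω → h x ≠ ω
  dist : ∀ x y, x ≠ ω → y ≠ ω → q (h x) (h y) = l * q x y
  cpar : ∀ t, h (e t) = e (l ^ 2 * t)
  rpar : ∀ c, RPar q ω c → c 0 = e 0 → ∀ s, h (c s) = c (l * s)

lemma sqrt_injOn : Set.InjOn Real.sqrt (Set.Ici 0) := fun _ ha _ hb hab =>
  (Real.sqrt_inj ha hb).1 hab

lemma IsCGeom.cpar_eq_shift (hq : IsCGeom q) (hn : NormalizedAt q ω) (hT : IsShift q ω T)
    {e' : ℝ → X} (he' : CPar q ω e') :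
    (∀ a, e' a = T a (e' 0)) ∨ ∀ a, e' a = T (-a) (e' 0) := by
  have hc := hT.cpar (e' 0) (he'.1 0)
  have h0 : e' 0 = T 0 (e' 0) := (hT.zero _).symm
  exact hc.eq_or_eq_neg isProfile_sqrt sqrt_injOn hq.toIsGauge he' h0
    (hq.range_cpar_eq hn he' hc h0).subset

/-- Two points lie on the same `C`-line iff they differ by a shift. -/
lemma IsCGeom.mem_fiber_iff (hq : IsCGeom q) (hn : NormalizedAt q ω) (hT : IsShift q ω T)
    {x p : X} (hx : x ≠ ω) (hp : p ≠ ω) :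
    (∃ G, IsC q G ∧ ω ∈ G ∧ x ∈ G ∧ p ∈ G) ↔ ∃ a, x = T a p := by
  constructor
  · rintro ⟨G, hG, hω, hxG, hpG⟩
    obtain ⟨e', he', h0, hr⟩ := hG.exists_par isProfile_sqrt hq.toIsGauge hn hω hpG hp
    obtain ⟨a, rfl⟩ : x ∈ Set.range e' := by rw [hr]; exact ⟨hxG, hx⟩
    subst h0
    rcases hq.cpar_eq_shift hn hT he' with h | h
    · exact ⟨a, h a⟩
    · exact ⟨-a, h a⟩
  · rintro ⟨a, rfl⟩
    exact ⟨_, (hT.cpar p hp).isCircle hq.toIsGauge hn, Or.inl rfl, Or.inr ⟨a, rfl⟩,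
      Or.inr ⟨0, hT.zero p⟩⟩

lemma IsShift.rpar (hT : IsShift q ω T) (hq : IsGauge q) (hn : NormalizedAt q ω) {r : ℝ → X}
    (hr : RPar q ω r) (a : ℝ) : RPar q ω fun s => T a (r s) :=
  ⟨fun s => hT.ne (hr.1 s) a, fun s t => by rw [hT.isometry hq hn, hr.2]⟩

lemma IsCGeom.exists_coordinates (hq : IsCGeom q) (hn : NormalizedAt q ω) (he : CPar q ω e)
    (hT : IsShift q ω T) (hTe : ∀ a t, T a (e t) = e (t + a)) {x : X} (hx : x ≠ ω)
    (hxe : x ∉ Set.range e) :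
    ∃ c t s, RPar q ω c ∧ c 0 = e 0 ∧ x = T t (c s) := by
  obtain ⟨r, t, s, hr, h0, hs⟩ := hq.exists_rpar_foot hn he hx hxe
  refine ⟨fun s => T (-t) (r s), t, s, hT.rpar hq.toIsGauge hn hr _, ?_, ?_⟩
  · simp only [h0, hTe, add_neg_cancel]
  · simp only [hT.apply_neg, hs]

/-- After division of the parameter by `l ^ 2`, the image of a shift orbit is again a unit speed
ℂ-line through `h x`. Its orientation is left open, and is not needed for preserving fibers. -/
lemma IsDilation.shift (hh : IsDilation q ω e l h) (hq : IsCGeom q) (hn : NormalizedAt q ω)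
    (hT : IsShift q ω T) (hl : 0 < l) {x : X} (hx : x ≠ ω) :
    (∀ a, h (T a x) = T (l ^ 2 * a) (h x)) ∨ ∀ a, h (T a x) = T (-(l ^ 2 * a)) (h x) := by
  have hpar : CPar q ω fun a => h (T (a / l ^ 2) x) := by
    refine ⟨fun a => hh.ne _ (hT.ne hx _), fun s t => ?_⟩
    simp only
    rw [hh.dist _ _ (hT.ne hx _) (hT.ne hx _), (hT.cpar x hx).2, ← sub_div, abs_div,
      Real.sqrt_div (abs_nonneg _), abs_of_pos (by positivity : 0 < l ^ 2), Real.sqrt_sq hl.le]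
    field_simp
  have e1 : ∀ a, l ^ 2 * a / l ^ 2 = a := fun a => by field_simp
  rcases hq.cpar_eq_shift hn hT hpar with h1 | h1
  · left
    intro a
    have := h1 (l ^ 2 * a)
    simpa only [e1, zero_div, hT.zero] using this
  · right
    intro a
    have := h1 (l ^ 2 * a)
    simpa only [e1, zero_div, hT.zero] using this

lemma IsDilation.exists_shift (hh : IsDilation q ω e l h) (hq : IsCGeom q) (hn : NormalizedAt q ω)
    (hT : IsShift q ω T) (hl : 0 < l) {x : X} (hx : x ≠ ω) (a : ℝ) :
    ∃ b, h (T a x) = T b (h x) := by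
  rcases hh.shift hq hn hT hl hx with h1 | h1
  · exact ⟨_, h1 a⟩
  · exact ⟨_, h1 a⟩

lemma IsDilation.exists_shift_symm (hh : IsDilation q ω e l h) (hq : IsCGeom q)
    (hn : NormalizedAt q ω) (hT : IsShift q ω T) (hl : 0 < l) {x : X} (hx : x ≠ ω) (a : ℝ) :
    ∃ b, h (T b x) = T a (h x) := by
  rcases hh.shift hq hn hT hl hx with h1 | h1
  · exact ⟨a / l ^ 2, by rw [h1]; congr 1; field_simp⟩
  · exact ⟨-a / l ^ 2, by rw [h1]; congr 1; field_simp⟩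

lemma IsDilation.isMob (hh : IsDilation q ω e l h) (hq : IsCGeom q) (hn : NormalizedAt q ω)
    (hl : 0 < l) : IsMob q h := by
  classical
  have h1 := Real.sqrt_pos.2 hl
  refine ⟨fun x => if x = ω then (√l)⁻¹ else √l, fun x => ?_, fun x y => ?_⟩
  · simp only
    split_ifs
    · exact inv_pos.2 h1
    · exact h1
  · by_cases hx : x = ω <;> by_cases hy : y = ω
    · rw [hx, hy, hq.self, hq.self, mul_zero]
    · rw [hx, hh.map_omega, hq.symm, hn _ (hh.ne _ hy), hq.symm, hn _ hy]
      simp [hy, h1.ne']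
    · rw [hy, hh.map_omega, hn _ (hh.ne _ hx), hn _ hx]
      simp [hx, h1.ne']
    · simp only [hx, hy, if_false]
      rw [hh.dist _ _ hx hy, Real.mul_self_sqrt hl.le]

lemma IsDilation.surjective (hh : IsDilation q ω e l h) (hq : IsCGeom q) (hn : NormalizedAt q ω)
    (he : CPar q ω e) (hl : 0 < l) : Function.Surjective h := by
  obtain ⟨T, hT, hTe⟩ := hq.exists_shift hn he
  intro z
  by_cases hz : z = ω
  · exact ⟨ω, hh.map_omega.trans hz.symm⟩
  by_cases hze : z ∈ Set.range e
  · obtain ⟨t, rfl⟩ := hze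
    exact ⟨e (t / l ^ 2), by rw [hh.cpar]; congr 1; field_simp⟩
  · obtain ⟨c, t, s, hc, h0, rfl⟩ := hq.exists_coordinates hn he hT hTe hz hze
    obtain ⟨b, hb⟩ := hh.exists_shift_symm hq hn hT hl (hc.1 (s / l)) t
    refine ⟨_, hb.trans ?_⟩
    rw [hh.rpar c hc h0]
    congr 2
    field_simp

lemma IsDilation.bijective (hh : IsDilation q ω e l h) (hq : IsCGeom q) (hn : NormalizedAt q ω)
    (he : CPar q ω e) (hl : 0 < l) : Function.Bijective h :=
  ⟨(hh.isMob hq hn hl).injective hq.toIsGauge, hh.surjective hq hn he hl⟩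

/-- The union of the `C`-lines that meet an `R`-line through a point of the `C`-line `e` is
preserved. -/
lemma IsDilation.image_semiplane (hh : IsDilation q ω e l h) (hq : IsCGeom q)
    (hn : NormalizedAt q ω) (hT : IsShift q ω T) (hTe : ∀ a t, T a (e t) = e (t + a)) (hl : 0 < l)
    {r : ℝ → X} (hr : RPar q ω r) {a₀ : ℝ} (h0 : r 0 = e a₀) :
    h '' {x | ∃ s a, x = T a (r s)} = {x | ∃ s a, x = T a (r s)} := by
  obtain ⟨c, hc⟩ : ∃ c : ℝ → X, c = fun s => T (-a₀) (r s) := ⟨_, rfl⟩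
  have hcp : RPar q ω c := hc ▸ hT.rpar hq.toIsGauge hn hr _
  have hc0 : c 0 = e 0 := by simp only [hc, h0, hTe, add_neg_cancel]
  have hset : {x | ∃ s a, x = T a (r s)} = {x | ∃ s a, x = T a (c s)} := by
    ext x
    constructor
    · rintro ⟨s, a, rfl⟩
      refine ⟨s, a + a₀, ?_⟩
      rw [hc, ← hT.add, add_neg_cancel_right]
    · rintro ⟨s, a, rfl⟩
      exact ⟨s, a + -a₀, by rw [hc, ← hT.add]⟩
  rw [hset]
  apply Set.Subset.antisymm
  · rintro _ ⟨_, ⟨s, a, rfl⟩, rfl⟩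
    obtain ⟨b, hb⟩ := hh.exists_shift hq hn hT hl (hcp.1 s) a
    exact ⟨l * s, b, by rw [hb, hh.rpar c hcp hc0]⟩
  · rintro _ ⟨s, a, rfl⟩
    obtain ⟨b, hb⟩ := hh.exists_shift_symm hq hn hT hl (hcp.1 (s / l)) a
    refine ⟨_, ⟨s / l, b, rfl⟩, hb.trans ?_⟩
    rw [hh.rpar c hcp hc0]
    congr 2
    field_simp

/-- A point outside the `C`-line `e` is determined by its vertical and horizontal coordinates. -/
lemma IsCGeom.eq_shift_of_coordinates (hq : IsCGeom q) (hn : NormalizedAt q ω) (he : CPar q ω e)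
    (hT : IsShift q ω T) (hTe : ∀ a t, T a (e t) = e (t + a)) {c : ℝ → X} (hc : RPar q ω c)
    (h0 : c 0 = e 0) {s : ℝ} (hs : s ≠ 0) {z : X} {p : ℝ} (hz : z ≠ ω)
    (hG : ∃ G, IsC q G ∧ ω ∈ G ∧ z ∈ G ∧ c s ∈ G)
    (hσ : ∃ σ, IsR q σ ∧ ω ∈ σ ∧ z ∈ σ ∧ e p ∈ σ) : z = T p (c s) := by
  obtain ⟨τ, rfl⟩ := (hq.mem_fiber_iff hn hT hz (hc.1 s)).1 hG
  obtain ⟨σ, hσ, hω, hzσ, hpσ⟩ := hσ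
  obtain ⟨r, hr, hr0, hrr⟩ := hσ.exists_par isProfile_id hq.toIsGauge hn hω hpσ (he.1 p)
  obtain ⟨s', hs'⟩ : T τ (c s) ∈ Set.range r := by rw [hrr]; exact ⟨hzσ, hz⟩
  have hr' := hT.rpar hq.toIsGauge hn hr (-τ)
  have hcs : T (-τ) (r s') = c s := by rw [hs', hT.neg_apply]
  have hr'0 : T (-τ) (r 0) = e (p - τ) := by rw [hr0, hTe]; rfl
  have hcs_not : c s ∉ insert ω (Set.range e) := by
    rintro (h | ⟨t, h⟩)
    · exact hc.1 s h
    · exact hs (hq.eq_zero_of_meet hn hc he h0 h.symm).1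
  -- Shifting `z` back to `c s` carries its ℝ-line to one through `c s` that still meets `e`; by
  -- uniqueness it is `c`, which meets `e` only at `0`.
  have huniq := (hq.existsUnique_R _ (he.isCircle hq.toIsGauge hn) ω (Or.inl rfl) (c s) hcs_not).unique
    ⟨hr'.isCircle hq.toIsGauge hn, Or.inl rfl, Or.inr ⟨s', hcs⟩, _, Or.inr ⟨0, hr'0⟩,
      Or.inr ⟨_, rfl⟩, he.1 _⟩
    ⟨hc.isCircle hq.toIsGauge hn, Or.inl rfl, Or.inr ⟨s, rfl⟩, _, Or.inr ⟨0, h0⟩,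
      Or.inr ⟨_, rfl⟩, he.1 _⟩
  have h1 : e (p - τ) ∈ insert ω (Set.range c) := by
    rw [← huniq]
    exact Or.inr ⟨0, hr'0⟩
  rcases h1 with h1 | ⟨s'', h1⟩
  · exact absurd h1 (he.1 _)
  · have := (hq.eq_zero_of_meet hn hc he h0 h1).2
    rw [sub_eq_zero.1 this]

theorem IsCGeom.exists_dilation (hq : IsCGeom q) (hn : NormalizedAt q ω) (hP : Proper q ω)
    (he : CPar q ω e) (hl : 0 < l) : ∃ h, IsDilation q ω e l h := by
  obtain ⟨n, m, hf⟩ := hq.exists_frame hn he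
  obtain ⟨h, h1, h2, h3, h4, h5⟩ := hf.exists_homothety hq hn hP hl
  exact ⟨h, h1, h2, h3, h4, h5⟩

end Dilation

/-! ### The gauge of an extended metric -/

section Conformal

/-- Two distance functions with the same cross-ratios differ by a conformal factor. -/
lemma exists_conformal_factor {Y : Type*} {q₁ q₂ : Y → Y → ℝ} (hs₁ : ∀ x y, q₁ x y = q₁ y x)
    (hs₂ : ∀ x y, q₂ x y = q₂ y x) (h0₁ : ∀ x, q₁ x x = 0) (h0₂ : ∀ x, q₂ x x = 0)
    (hp₁ : ∀ x y, x ≠ y → 0 < q₁ x y) (hp₂ : ∀ x y, x ≠ y → 0 < q₂ x y)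
    (hcr : ∀ x y z u, Admissible x y z u →
      q₁ x y * q₁ z u * (q₂ x z * q₂ y u) = q₁ x z * q₁ y u * (q₂ x y * q₂ z u))
    {a b c : Y} (hab : a ≠ b) (hac : a ≠ c) (hbc : b ≠ c) :
    ∃ φ : Y → ℝ, (∀ x, 0 < φ x) ∧ ∀ x y, q₁ x y = φ x * φ y * q₂ x y := by
  classical
  obtain ⟨R, hR⟩ : ∃ R : Y → Y → ℝ, ∀ x y, R x y = q₁ x y / q₂ x y := ⟨_, fun _ _ => rfl⟩
  have hRp : ∀ x y, x ≠ y → 0 < R x y := fun x y h => by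
    rw [hR]; exact div_pos (hp₁ _ _ h) (hp₂ _ _ h)
  have hRs : ∀ x y, R x y = R y x := fun x y => by rw [hR, hR, hs₁, hs₂]
  have hRR : ∀ x y z u, x ≠ y → x ≠ z → x ≠ u → y ≠ z → y ≠ u → z ≠ u →
      R x y * R z u = R x z * R y u := by
    intro x y z u hxy hxz hxu hyz hyu hzu
    have h := hcr x y z u ⟨fun h => hxy h.1, fun h => hxy h.1, fun h => hxz h.1, fun h => hyz h.1⟩
    have p1 := (hp₂ _ _ hxy).ne'
    have p2 := (hp₂ _ _ hzu).ne'
    have p3 := (hp₂ _ _ hxz).ne'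
    have p4 := (hp₂ _ _ hyu).ne'
    rw [hR, hR, hR, hR, div_mul_div_comm, div_mul_div_comm,
      div_eq_div_iff (mul_ne_zero p1 p2) (mul_ne_zero p3 p4)]
    exact h
  -- If `R x y = φ x * φ y`, this quotient is `φ a ^ 2`. Its independence of `x` and `y` is what the
  -- cross-ratios give, and it determines `φ`.
  obtain ⟨C, hC⟩ : ∃ C : Y → Y → ℝ, ∀ x y, C x y = R x a * R y a / R x y := ⟨_, fun _ _ => rfl⟩
  have hCs : ∀ x y, C x y = C y x := fun x y => by rw [hC, hC, hRs x y, mul_comm (R x a)]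
  have step : ∀ x y z, x ≠ a → y ≠ a → z ≠ a → x ≠ y → x ≠ z → C x y = C x z := by
    intro x y z hx hy hz hxy hxz
    by_cases hyz : y = z
    · rw [hyz]
    have h := hRR x z y a hxz hxy hx (Ne.symm hyz) hz hy
    rw [hC, hC, div_eq_div_iff (hRp _ _ hxy).ne' (hRp _ _ hxz).ne']
    linear_combination (R x a) * h
  have const : ∀ x y, x ≠ a → y ≠ a → x ≠ y → C x y = C b c := by
    intro x y hx hy hxy
    have hb : ∀ y, y ≠ a → b ≠ y → C b y = C b c := fun y hy h =>
      step b y c hab.symm hy hac.symm h hbc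
    by_cases hxb : x = b
    · subst hxb
      exact hb y hy hxy
    · by_cases hyb : y = b
      · subst hyb
        rw [hCs]
        exact hb x hx hxy.symm
      · rw [step x y b hx hy hab.symm hxy hxb, hCs]
        exact hb x hx (Ne.symm hxb)
  have hCp : 0 < C b c := by
    rw [hC]
    exact div_pos (mul_pos (hRp _ _ hab.symm) (hRp _ _ hac.symm)) (hRp _ _ hbc)
  have hsq := Real.sqrt_pos.2 hCp
  have hss := Real.mul_self_sqrt hCp.le
  refine ⟨fun x => if x = a then √(C b c) else R x a / √(C b c), fun x => ?_, fun x y => ?_⟩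
  · simp only
    split_ifs with h
    · exact hsq
    · exact div_pos (hRp _ _ h) hsq
  · by_cases hxy : x = y
    · rw [hxy, h0₁, h0₂, mul_zero]
    have hq : q₁ x y = R x y * q₂ x y := by
      rw [hR, div_mul_cancel₀ _ (hp₂ _ _ hxy).ne']
    rw [hq]
    congr 1
    by_cases hx : x = a
    · subst hx
      simp only [if_true, Ne.symm hxy, if_false]
      rw [hRs x y]
      field_simp
    · by_cases hy : y = a
      · subst hy
        simp only [if_true, hx, if_false]
        field_simp
      · simp only [hx, hy, if_false]
        have h1 := const x y hx hy hxy
        have h2 := (hRp _ _ hxy).ne'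
        rw [hC, div_eq_iff h2] at h1
        have h3 : R x a / √(C b c) * (R y a / √(C b c)) =
            R x a * R y a / (√(C b c) * √(C b c)) := by rw [div_mul_div_comm]
        rw [h3, hss, h1, mul_comm, mul_div_cancel_right₀ _ hCp.ne']

end Conformal

/-! ### From the Möbius structure to gauges -/

section Translate

variable {X Y : Type*}

lemma factor_symm (d : ExtMetric X) (x y : X) : d.factor x y = d.factor y x := by
  simp only [ExtMetric.factor, d.symm x y]

lemma factor_self (d : ExtMetric X) (x : X) : d.factor x x = 0 := by
  simp [ExtMetric.factor, d.dist_self]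

lemma factor_pos (d : ExtMetric X) {x y : X} (h : x ≠ y) : 0 < d.factor x y := by
  unfold ExtMetric.factor
  split_ifs with h1
  · exact one_pos
  · exact ENNReal.toReal_pos (fun h2 => h (d.eq_of_dist_eq_zero _ _ h2)) h1

lemma factor_nonneg (d : ExtMetric X) (x y : X) : 0 ≤ d.factor x y := by
  by_cases h : x = y
  · rw [h, factor_self]
  · exact (factor_pos d h).le

lemma sameProjPoint_crt {d : ExtMetric X} {d' : ExtMetric Y} {x y z u : X} {x' y' z' u' : Y}
    (h : SameProjPoint (d.crt x y z u) (d'.crt x' y' z' u')) : ∃ k : ℝ, k ≠ 0 ∧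
      d.factor x y * d.factor z u = k * (d'.factor x' y' * d'.factor z' u') ∧
      d.factor x z * d.factor y u = k * (d'.factor x' z' * d'.factor y' u') ∧
      d.factor x u * d.factor y z = k * (d'.factor x' u' * d'.factor y' z') := by
  obtain ⟨k, hk, h⟩ := h
  exact ⟨k, hk, by simpa [ExtMetric.crt] using congrFun h 0,
    by simpa [ExtMetric.crt] using congrFun h 1, by simpa [ExtMetric.crt] using congrFun h 2⟩

lemma sameProjPoint_of_conformal {d : ExtMetric X} {d' : ExtMetric Y} {f : Y → X} {φ : Y → ℝ}
    (hφ : ∀ x, 0 < φ x) (h : ∀ x y, d.factor (f x) (f y) = φ x * φ y * d'.factor x y)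
    (x y z u : Y) : SameProjPoint (d.crt (f x) (f y) (f z) (f u)) (d'.crt x y z u) := by
  refine ⟨φ x * φ y * φ z * φ u,
    (mul_pos (mul_pos (mul_pos (hφ x) (hφ y)) (hφ z)) (hφ u)).ne', ?_⟩
  funext i
  fin_cases i
  · simp [ExtMetric.crt, h]; ring
  · simp [ExtMetric.crt, h]; ring
  · simp [ExtMetric.crt, h]; ring

lemma admissible_map {f : Y → X} (hf : Function.Injective f) {x y z u : Y}
    (h : Admissible x y z u) : Admissible (f x) (f y) (f z) (f u) := by
  simpa only [Admissible, hf.eq_iff] using h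

/-- Möbius maps are the injective maps that change the factors conformally. -/
lemma isMoebiusMap_of_conformal {M : MoebiusStructure X} {N : MoebiusStructure Y}
    {d : ExtMetric X} (hd : d ∈ M.metrics) {d' : ExtMetric Y} (hd' : d' ∈ N.metrics) {f : Y → X}
    {φ : Y → ℝ} (hφ : ∀ x, 0 < φ x)
    (h : ∀ x y, d.factor (f x) (f y) = φ x * φ y * d'.factor x y) : IsMoebiusMap N M f := by
  have hinj : Function.Injective f := by
    intro x y hxy
    by_contra hne
    have h1 := h x y
    rw [hxy, factor_self] at h1
    exact (mul_pos (mul_pos (hφ x) (hφ y)) (factor_pos d' hne)).ne h1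
  refine ⟨hinj, fun d₁ hd₁ e₁ he₁ x y z u hA => ?_⟩
  exact ((M.equivalent e₁ he₁ d hd _ _ _ _ (admissible_map hinj hA)).trans
    (sameProjPoint_of_conformal hφ h x y z u)).trans (N.equivalent d' hd' d₁ hd₁ x y z u hA)

lemma exists_conformal_of_isMoebiusMap {M : MoebiusStructure X} {N : MoebiusStructure Y}
    {d : ExtMetric X} (hd : d ∈ M.metrics) {d' : ExtMetric Y} (hd' : d' ∈ N.metrics) {f : Y → X}
    (h : IsMoebiusMap N M f) {a b c : Y} (hab : a ≠ b) (hac : a ≠ c) (hbc : b ≠ c) :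
    ∃ φ : Y → ℝ, (∀ x, 0 < φ x) ∧
      ∀ x y, d.factor (f x) (f y) = φ x * φ y * d'.factor x y := by
  refine exists_conformal_factor (q₁ := fun x y => d.factor (f x) (f y)) (q₂ := d'.factor)
    (fun x y => factor_symm _ _ _) (factor_symm d')
    (fun x => factor_self _ _) (factor_self d') (fun x y hxy => factor_pos d (h.1.ne hxy))
    (fun x y hxy => factor_pos d' hxy) (fun x y z u hA => ?_) hab hac hbc
  obtain ⟨k, -, h1, h2, -⟩ := sameProjPoint_crt (h.2 d' hd' d hd x y z u hA)
  rw [h1, h2]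
  ring

lemma self_mem_moebiusStructure (d : ExtMetric X) : d ∈ d.moebiusStructure.metrics :=
  fun _ _ _ _ _ => SameProjPoint.refl _

lemma factor_extRealLine : extRealLine.factor = model fun x => x := by
  funext x y
  cases x <;> cases y <;>
    simp [ExtMetric.factor, extRealLine, ExtMetric.ofMetric, extendedDist, model]

lemma factor_sqrtExtRealLine : sqrtExtRealLine.factor = model Real.sqrt := by
  funext x y
  cases x <;> cases y <;>
    simp [ExtMetric.factor, sqrtExtRealLine, ExtMetric.ofMetric, extendedDist, model]

variable {M : MoebiusStructure X} {d : ExtMetric X}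

lemma isCircle_factor_iff (hd : d ∈ M.metrics) {p : ℝ → ℝ} {d' : ExtMetric (OnePoint ℝ)}
    (hp : d'.factor = model p) {σ : Set X} :
    (∃ f : OnePoint ℝ → X, IsMoebiusMap d'.moebiusStructure M f ∧ Set.range f = σ) ↔
      IsCircle p d.factor σ := by
  have hd' := self_mem_moebiusStructure d'
  constructor
  · rintro ⟨f, hf, hr⟩
    obtain ⟨φ, hφ, h⟩ := exists_conformal_of_isMoebiusMap hd hd' hf (a := OnePoint.infty)
      (b := ((0 : ℝ) : OnePoint ℝ)) (c := ((1 : ℝ) : OnePoint ℝ)) (by simp) (by simp)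
      (by simp)
    exact ⟨f, φ, hφ, fun x y => by rw [h, hp], hr⟩
  · rintro ⟨f, φ, hφ, h, hr⟩
    exact ⟨f, isMoebiusMap_of_conformal hd hd' hφ (fun x y => by rw [h, hp]), hr⟩

lemma isRCircle_iff (hd : d ∈ M.metrics) {σ : Set X} : M.IsRCircle σ ↔ IsR d.factor σ :=
  isCircle_factor_iff hd factor_extRealLine

lemma isCCircle_iff (hd : d ∈ M.metrics) {F : Set X} : M.IsCCircle F ↔ IsC d.factor F :=
  isCircle_factor_iff hd factor_sqrtExtRealLine

lemma harmonic_iff (hd : d ∈ M.metrics) {x z y u : X} : M.Harmonic x z y u ↔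
    Admissible x z y u ∧ d.factor x z * d.factor y u = d.factor x u * d.factor z y := by
  refine ⟨fun h => ⟨h.1, ?_⟩, fun h => ⟨h.1, fun d' hd' => ?_⟩⟩
  · rw [h.2 d hd, factor_symm d z y, factor_symm d y z]
  · obtain ⟨k, hk, h1, h2, h3⟩ := sameProjPoint_crt (M.equivalent d' hd' d hd x z y u h.1)
    rw [h1, factor_symm d' y z, h3, h.2]

end Translate

/-! ### Verification of the gauge conditions, existence and uniqueness -/

section Main

variable {X : Type*} {M : MoebiusStructure X} {d : ExtMetric X} {ω : X}

lemma normalizedAt_factor (hdω : d.Remote ω) : NormalizedAt d.factor ω := fun x hx => by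
  simp [ExtMetric.factor, hdω x hx]

lemma dist_eq_ofReal_factor (hdω : d.Remote ω) {x y : X} (hx : x ≠ ω) (hy : y ≠ ω) :
    d.dist x y ≠ ⊤ ∧ d.dist x y = ENNReal.ofReal (d.factor x y) := by
  have h : d.dist x y ≠ ⊤ := by
    intro h
    rcases d.remote_of_top x y h with h | h
    · exact hx (d.remote_unique _ _ h hdω)
    · exact hy (d.remote_unique _ _ h hdω)
  exact ⟨h, by rw [ExtMetric.factor, if_neg h, ENNReal.ofReal_toReal h]⟩

lemma isPar_of_dist (hdω : d.Remote ω) {p : ℝ → ℝ} {c : ℝ → X} {σ : Set X} (hp : ∀ x, 0 ≤ p |x|)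
    (hr : Set.range c = σ \ {ω}) (hc : ∀ s t, d.dist (c s) (c t) = ENNReal.ofReal (p |s - t|)) :
    IsPar p d.factor ω c := by
  have hne : ∀ s, c s ≠ ω := fun s => by
    have : c s ∈ σ \ {ω} := hr ▸ ⟨s, rfl⟩
    exact this.2
  refine ⟨hne, fun s t => ?_⟩
  have h := (dist_eq_ofReal_factor hdω (hne s) (hne t)).2
  rw [hc, ENNReal.ofReal_eq_ofReal_iff (hp _) (factor_nonneg d _ _)] at h
  exact h.symm

/-- For quadruples that are not admissible the left side of the Ptolemy inequality is zero;
everything else translates directly. -/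
theorem isCGeom_factor (hd : d ∈ M.metrics) (h_ptolemy : M.Ptolemy) (h_EC : M.AxiomEC)
    (h_ER : M.AxiomER) (h_OC : M.AxiomOC) (h_OR : M.AxiomOR) : IsCGeom d.factor where
  symm := factor_symm d
  self := factor_self d
  pos _ _ := factor_pos d
  ptolemy x y z u := by
    by_cases hA : Admissible x y z u
    · exact h_ptolemy d hd x y z u hA
    · have h0 : d.factor x z * d.factor y u = 0 := by
        have hA' : (x = y ∧ y = z) ∨ (x = y ∧ y = u) ∨ (x = z ∧ z = u) ∨ (y = z ∧ z = u) := by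
          unfold Admissible at hA
          tauto
        rcases hA' with h | h | h | h
        · rw [h.1, h.2, factor_self, zero_mul]
        · rw [← h.2, factor_self, mul_zero]
        · rw [h.1, factor_self, zero_mul]
        · rw [h.1, h.2, factor_self, mul_zero]
      rw [h0]
      exact add_nonneg (mul_nonneg (factor_nonneg d _ _) (factor_nonneg d _ _))
        (mul_nonneg (factor_nonneg d _ _) (factor_nonneg d _ _))
  existsUnique_C x y hxy := by
    simpa only [isCCircle_iff hd] using h_EC x y hxy
  existsUnique_R F hF ω hω u hu := by
    simpa only [isRCircle_iff hd] using h_ER F ((isCCircle_iff hd).2 hF) ω hω u hu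
  harmonic_C σ F hσ hF o ω hoω h1 h2 h3 h4 u hu v hv huo huω hvo hvω h w hw :=
    ((harmonic_iff hd).1 (h_OC σ F ((isRCircle_iff hd).2 hσ) ((isCCircle_iff hd).2 hF) o ω hoω
      h1 h2 h3 h4 u hu v hv ((harmonic_iff hd).2 ⟨⟨fun h => huo h.1.symm, fun h => huo h.1.symm,
        fun h => hoω h.1, fun h => huω h.1⟩, h⟩) w hw)).2
  harmonic_R σ F hσ hF o ω hoω h1 h2 h3 h4 u hu v hv huo huω hvo hvω h w hw :=
    ((harmonic_iff hd).1 (h_OR σ F ((isRCircle_iff hd).2 hσ) ((isCCircle_iff hd).2 hF) o ω hoω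
      h1 h2 h3 h4 u hu v hv ((harmonic_iff hd).2 ⟨⟨fun h => huo h.1.symm, fun h => huo h.1.symm,
        fun h => hoω h.1, fun h => huω h.1⟩, h⟩) w hw)).2

lemma isMoebiusMap_id : IsMoebiusMap M M id :=
  ⟨Function.injective_id, fun d hd e he x y z u hA => M.equivalent e he d hd x y z u hA⟩

/-- An ultrafilter limit exists in the compact space. It is not `ω`, since the conformal factor
grows like the reciprocal of the distance to `ω` and a bounded sequence stays away from it; off `ω`
the two metrics give the same convergence. -/
theorem proper_factor (hd : d ∈ M.metrics) (hdω : d.Remote ω) (hM : M.Compact) {a b c : X}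
    (hab : a ≠ b) (hac : a ≠ c) (hbc : b ≠ c) : Proper d.factor ω := by
  obtain ⟨d₀, hd₀, hfin, hcpt⟩ := hM
  obtain ⟨φ, hφ, h⟩ := exists_conformal_of_isMoebiusMap hd hd₀ isMoebiusMap_id hab hac hbc
  simp only [id] at h
  let _ := d₀.toMetricSpace hfin
  have hdist : ∀ x y, d₀.factor x y = dist x y := fun x y => by
    rw [ExtMetric.factor, if_neg (hfin x y)]
    rfl
  simp only [hdist] at h
  have hφω : ∀ x, x ≠ ω → φ x * (φ ω * dist x ω) = 1 := fun x hx => by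
    rw [← normalizedAt_factor hdω x hx, h]
    ring
  intro U x y R hy hx
  obtain ⟨z, hz⟩ : ∃ z, Tendsto x U (𝓝 z) := by
    have : Nonempty X := ⟨ω⟩
    exact ⟨_, (U.map x).le_nhds_lim⟩
  have hd1 : ∀ p, Tendsto (fun k => dist (x k) p) U (𝓝 (dist z p)) := fun p =>
    hz.dist tendsto_const_nhds
  have hzω : z ≠ ω := by
    rintro rfl
    have h1 : ∀ᶠ k in (U : Filter ℕ), φ y * dist (x k) y ≤ R * (φ z * dist (x k) z) := by
      filter_upwards [hx] with k hk
      have h2 := hφω _ hk.1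
      have h3 := hk.2
      have h4 : 0 ≤ φ z * dist (x k) z := mul_nonneg (hφ z).le dist_nonneg
      have h5 := mul_le_mul_of_nonneg_right h3 h4
      rw [h] at h5
      have h6 : φ (x k) * φ y * dist (x k) y * (φ z * dist (x k) z) =
        φ (x k) * (φ z * dist (x k) z) * (φ y * dist (x k) y) := by ring
      rwa [h6, h2, one_mul] at h5
    have h2 := le_of_tendsto_of_tendsto ((hd1 y).const_mul (φ y))
      (((hd1 z).const_mul (φ z)).const_mul R) h1
    rw [dist_self, mul_zero, mul_zero] at h2
    exact absurd h2 (not_le.2 (mul_pos (hφ y) (dist_pos.2 hy.symm)))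
  refine ⟨z, hzω, ?_⟩
  have h1 : Tendsto (fun k => φ z * dist (x k) z / (φ ω * dist (x k) ω)) U
      (𝓝 (φ z * dist z z / (φ ω * dist z ω))) :=
    ((hd1 z).const_mul _).div ((hd1 ω).const_mul _) (mul_pos (hφ ω) (dist_pos.2 hzω)).ne'
  rw [dist_self, mul_zero, zero_div] at h1
  refine h1.congr' ?_
  filter_upwards [hx] with k hk
  have h2 := hφω _ hk.1
  have h3 : φ ω * dist (x k) ω ≠ 0 := right_ne_zero_of_mul_eq_one h2
  rw [h, div_eq_iff h3]
  linear_combination (-(φ z * dist (x k) z)) * h2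

lemma isMoebiusAutomorphism_of_isMob (hd : d ∈ M.metrics) {h : X → X} (hb : Function.Bijective h)
    (hm : IsMob d.factor h) : IsMoebiusAutomorphism M h := by
  obtain ⟨φ, hφ, h1⟩ := hm
  exact ⟨hb, isMoebiusMap_of_conformal hd hd hφ h1⟩

variable {e : ℝ → X} {l : ℝ} {h : X → X} {T : ℝ → X → X}

lemma range_of_isCLine (hd : d ∈ M.metrics) (hq : IsCGeom d.factor) (hn : NormalizedAt d.factor ω)
    (he : CPar d.factor ω e) {F : Set X} (hF : M.IsCLine ω (e 0) F) :
    F = insert ω (Set.range e) :=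
  (hq.existsUnique_C (e 0) ω hF.2.2.2).unique ⟨(isCCircle_iff hd).1 hF.1, hF.2.2.1, hF.2.1⟩
    ⟨he.isCircle hq.toIsGauge hn, Or.inr ⟨0, rfl⟩, Or.inl rfl⟩

lemma exists_rpar_of_isRLine (hd : d ∈ M.metrics) (hq : IsCGeom d.factor)
    (hn : NormalizedAt d.factor ω) {o : X} {σ : Set X} (hσ : M.IsRLine ω o σ) :
    ∃ c, RPar d.factor ω c ∧ c 0 = o ∧ Set.range c = σ \ {ω} :=
  ((isRCircle_iff hd).1 hσ.1).exists_par isProfile_id hq.toIsGauge hn hσ.2.1 hσ.2.2.1 hσ.2.2.2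

lemma eq_insert_of_range {c : ℝ → X} {σ : Set X} (hω : ω ∈ σ) (hr : Set.range c = σ \ {ω}) :
    σ = insert ω (Set.range c) := by
  rw [hr, Set.insert_sdiff_singleton, Set.insert_eq_of_mem hω]

lemma semiCPlane_eq (hd : d ∈ M.metrics) (hq : IsCGeom d.factor)
    (hn : NormalizedAt d.factor ω) (hT : IsShift d.factor ω T) {σ : Set X} {r : ℝ → X}
    (hr : RPar d.factor ω r) (hrr : Set.range r = σ \ {ω}) :
    M.semiCPlane ω σ = {x | ∃ s a, x = T a (r s)} := by
  ext x
  constructor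
  · rintro ⟨p, hp, hpω, G, hG, hpG⟩
    obtain ⟨s, rfl⟩ : p ∈ Set.range r := hrr ▸ ⟨hp, hpω⟩
    obtain ⟨a, ha⟩ := (hq.mem_fiber_iff hn hT hG.2.2.2 hpω).1
      ⟨G, (isCCircle_iff hd).1 hG.1, hG.2.1, hG.2.2.1, hpG⟩
    exact ⟨s, a, ha⟩
  · rintro ⟨s, a, rfl⟩
    have hp : r s ∈ σ \ {ω} := hrr ▸ ⟨s, rfl⟩
    have hx := hT.ne (hr.1 s) a
    obtain ⟨G, hG, hω, hxG, hpG⟩ := (hq.mem_fiber_iff hn hT hx (hr.1 s)).2 ⟨a, rfl⟩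
    exact ⟨r s, hp.1, hp.2, G, ⟨(isCCircle_iff hd).2 hG, hω, hxG, hx⟩, hpG⟩

lemma isCLine_image (hd : d ∈ M.metrics) (hm : IsMob d.factor h) (hω : h ω = ω)
    (hne : ∀ x, x ≠ ω → h x ≠ ω) {x : X} {G : Set X} (hG : M.IsCLine ω x G) :
    M.IsCLine ω (h x) (h '' G) :=
  ⟨(isCCircle_iff hd).2 (((isCCircle_iff hd).1 hG.1).image hm), ⟨ω, hG.2.1, hω⟩,
    ⟨x, hG.2.2.1, rfl⟩, hne x hG.2.2.2⟩

/-- A Möbius map fixing `ω` sends the circles that define the coordinates of a point to circles of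
the same kind, and the lines through the center are preserved. -/
theorem IsDilation.isPureHomothetyMap (hh : IsDilation d.factor ω e l h) (hd : d ∈ M.metrics)
    (hdω : d.Remote ω) (hq : IsCGeom d.factor) (he : CPar d.factor ω e) (hl : 0 < l) :
    M.IsPureHomothetyMap d ω (e 0) l h := by
  have hn := normalizedAt_factor hdω
  obtain ⟨T, hT, hTe⟩ := hq.exists_shift hn he
  have hm := hh.isMob hq hn hl
  have hinj := hm.injective hq.toIsGauge
  have hF : ∀ F, M.IsCLine ω (e 0) F → h '' F = F := by
    intro F hF
    rw [range_of_isCLine hd hq hn he hF, Set.image_insert_eq, hh.map_omega, ← Set.range_comp]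
    congr 1
    apply Set.Subset.antisymm
    · rintro _ ⟨t, rfl⟩
      exact ⟨_, (hh.cpar t).symm⟩
    · rintro _ ⟨t, rfl⟩
      refine ⟨t / l ^ 2, ?_⟩
      simp only [Function.comp, hh.cpar]
      congr 1
      field_simp
  have hσ : ∀ σ, M.IsRLine ω (e 0) σ → h '' σ = σ := by
    intro σ hσ
    obtain ⟨c, hc, h0, hr⟩ := exists_rpar_of_isRLine hd hq hn hσ
    rw [eq_insert_of_range hσ.2.1 hr, Set.image_insert_eq, hh.map_omega, ← Set.range_comp]
    congr 1
    apply Set.Subset.antisymm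
    · rintro _ ⟨t, rfl⟩
      exact ⟨_, (hh.rpar c hc h0 t).symm⟩
    · rintro _ ⟨t, rfl⟩
      refine ⟨t / l, ?_⟩
      simp only [Function.comp, hh.rpar c hc h0]
      congr 1
      field_simp
  refine ⟨hh.map_omega, hh.ne, by simpa using hh.cpar 0, hF, ?_, hσ, ?_, ?_, ?_⟩
  · intro F hF c hr h0 hc t
    have hcp : CPar d.factor ω c := isPar_of_dist hdω (fun x => Real.sqrt_nonneg _) hr hc
    have hr' : Set.range c ⊆ Set.range e := (hq.range_cpar_eq hn hcp he h0).subset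
    rcases he.eq_or_eq_neg isProfile_sqrt sqrt_injOn hq.toIsGauge hcp h0 hr' with h1 | h1
    · rw [h1, h1, hh.cpar]
    · rw [h1, h1, hh.cpar]
      congr 1
      ring
  · intro σ hσ c hr h0 hc t
    exact hh.rpar c (isPar_of_dist hdω (fun x => abs_nonneg x) hr hc) h0 t
  · intro F σ hF hσ hω hsub
    -- The ℝ-line need not pass through the center: it meets `F` at some `e a₀`, and a vertical
    -- shift leads to an ℝ-line through the center with the same semi-ℂ-plane.
    have hoF : e 0 ∈ F \ {ω} := ⟨hF.2.2.1, he.1 0⟩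
    obtain ⟨p, hp, hpω, G, hG, hpG⟩ := hsub hoF
    rw [range_of_isCLine hd hq hn he hG] at hpG
    obtain ⟨a₀, rfl⟩ := hpG.resolve_left hpω
    obtain ⟨r, hr, h0, hrr⟩ := ((isRCircle_iff hd).1 hσ).exists_par isProfile_id hq.toIsGauge hn
      hω hp hpω
    rw [semiCPlane_eq hd hq hn hT hr hrr]
    exact hh.image_semiplane hq hn hT hTe hl hr h0
  · intro F σ hF' hσ' x hx xF xσ hxF hxσ
    constructor
    · rcases hxF with ⟨h1, rfl⟩ | ⟨h1, h2, h3, τ, hτ, hωτ, hxτ, hpτ⟩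
      · exact Or.inl ⟨by rw [← hF F hF']; exact ⟨_, h1, rfl⟩, rfl⟩
      · refine Or.inr ⟨fun h4 => h1 ?_, ?_, hh.ne _ h3, h '' τ,
          (isRCircle_iff hd).2 (((isRCircle_iff hd).1 hτ).image hm), ⟨ω, hωτ, hh.map_omega⟩,
          ⟨x, hxτ, rfl⟩, ⟨xF, hpτ, rfl⟩⟩
        · rw [← hF F hF'] at h4
          obtain ⟨y, hy, hxy⟩ := h4
          rwa [← hinj hxy]
        · rw [← hF F hF']
          exact ⟨_, h2, rfl⟩
    · obtain ⟨h1, h2, G, hG, hpG⟩ := hxσ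
      refine ⟨?_, hh.ne _ h2, h '' G, isCLine_image hd hm hh.map_omega hh.ne hG, ⟨_, hpG, rfl⟩⟩
      rw [← hσ σ hσ']
      exact ⟨_, h1, rfl⟩

lemma dist_of_isPar (hdω : d.Remote ω) {p : ℝ → ℝ} {c : ℝ → X} (hc : IsPar p d.factor ω c)
    (s t : ℝ) : d.dist (c s) (c t) = ENNReal.ofReal (p |s - t|) := by
  rw [(dist_eq_ofReal_factor hdω (hc.1 s) (hc.1 t)).2, hc.2]

lemma range_eq_diff {p : ℝ → ℝ} {q : X → X → ℝ} {c : ℝ → X} (hc : IsPar p q ω c) :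
    Set.range c = insert ω (Set.range c) \ {ω} := by
  rw [Set.insert_sdiff_of_mem _ (Set.mem_singleton ω), Set.sdiff_singleton_eq_self]
  rintro ⟨s, hs⟩
  exact hc.1 s hs

/-- A pure homothety map is determined by its center and coefficient. -/
theorem isPureHomothetyMap_apply (hd : d ∈ M.metrics) (hdω : d.Remote ω) (hq : IsCGeom d.factor)
    (he : CPar d.factor ω e) (hT : IsShift d.factor ω T) (hTe : ∀ a t, T a (e t) = e (t + a))
    (hl : 0 < l) (hh : M.IsPureHomothetyMap d ω (e 0) l h) :
    (∀ t, h (e t) = e (l ^ 2 * t)) ∧ ∀ c t s, RPar d.factor ω c → c 0 = e 0 → s ≠ 0 →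
      h (T t (c s)) = T (l ^ 2 * t) (c (l * s)) := by
  have hn := normalizedAt_factor hdω
  have heC := he.isCircle hq.toIsGauge hn
  have hF : M.IsCLine ω (e 0) (insert ω (Set.range e)) :=
    ⟨(isCCircle_iff hd).2 heC, Or.inl rfl, Or.inr ⟨0, rfl⟩, he.1 0⟩
  have hcl : ∀ t, h (e t) = e (l ^ 2 * t) :=
    hh.scales_cline _ hF e (range_eq_diff he) rfl (dist_of_isPar hdω he)
  refine ⟨hcl, fun c t s hc h0 hs => ?_⟩
  have hcR := hc.isCircle hq.toIsGauge hn
  have hσ : M.IsRLine ω (e 0) (insert ω (Set.range c)) :=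
    ⟨(isRCircle_iff hd).2 hcR, Or.inl rfl, Or.inr ⟨0, h0⟩, he.1 0⟩
  have hrl : h (c s) = c (l * s) :=
    hh.scales_rline _ hσ c (range_eq_diff hc) h0 (dist_of_isPar hdω hc) s
  have not_mem : ∀ s, s ≠ 0 → ∀ t, T t (c s) ∉ insert ω (Set.range e) := by
    rintro s hs t (h1 | ⟨τ, h1⟩)
    · exact hT.ne (hc.1 s) t h1
    · have h2 : c s = e (τ - t) := by
        rw [← hT.neg_apply t (c s), ← h1, hTe]
        rfl
      exact hs (hq.eq_zero_of_meet hn hc he h0 h2).1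
  have hxω := hT.ne (hc.1 s) t
  obtain ⟨G, hG, hωG, hxG, hpG⟩ := (hq.mem_fiber_iff hn hT hxω (hc.1 s)).2 ⟨t, rfl⟩
  have hGC : M.IsCLine ω (T t (c s)) G := ⟨(isCCircle_iff hd).2 hG, hωG, hxG, hxω⟩
  have hTc := hT.rpar hq.toIsGauge hn hc t
  have hco := hh.coordinatewise _ _ hF hσ (T t (c s))
    ⟨c s, Or.inr ⟨s, rfl⟩, hc.1 s, G, hGC, hpG⟩ (e t) (c s)
    (Or.inr ⟨not_mem s hs t, Or.inr ⟨t, rfl⟩, he.1 t, _,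
      (isRCircle_iff hd).2 (hTc.isCircle hq.toIsGauge hn), Or.inl rfl, Or.inr ⟨s, rfl⟩,
      Or.inr ⟨0, by simp only [h0, hTe, zero_add]⟩⟩)
    ⟨Or.inr ⟨s, rfl⟩, hc.1 s, G, hGC, hpG⟩
  rw [hcl, hrl] at hco
  obtain ⟨hv, -, -, G', hG', hpG'⟩ := hco
  have hls : l * s ≠ 0 := mul_ne_zero hl.ne' hs
  have hGq : ∃ G, IsC d.factor G ∧ ω ∈ G ∧ h (T t (c s)) ∈ G ∧ c (l * s) ∈ G :=
    ⟨G', (isCCircle_iff hd).1 hG'.1, hG'.2.1, hG'.2.2.1, hpG'⟩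
  -- The image lies on the ℂ-line through `c (l * s)`, which differs from `F`; this excludes the
  -- degenerate case of the vertical projection.
  have hxF : h (T t (c s)) ∉ insert ω (Set.range e) := by
    obtain ⟨a, ha⟩ := (hq.mem_fiber_iff hn hT hG'.2.2.2 (hc.1 _)).1 hGq
    rw [ha]
    exact not_mem _ hls a
  obtain ⟨-, -, -, τ, hτ, hωτ, hxτ, hpτ⟩ := hv.resolve_left fun h1 => hxF h1.1
  exact hq.eq_shift_of_coordinates hn he hT hTe hc h0 hls hG'.2.2.2 hGq
    ⟨τ, (isRCircle_iff hd).1 hτ, hωτ, hxτ, hpτ⟩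

lemma isPureHomothetyMap_unique (hd : d ∈ M.metrics) (hdω : d.Remote ω) (hq : IsCGeom d.factor)
    (he : CPar d.factor ω e) (hl : 0 < l) {h' : X → X}
    (hh : M.IsPureHomothetyMap d ω (e 0) l h) (hh' : M.IsPureHomothetyMap d ω (e 0) l h') :
    h = h' := by
  have hn := normalizedAt_factor hdω
  obtain ⟨T, hT, hTe⟩ := hq.exists_shift hn he
  obtain ⟨h1, h2⟩ := isPureHomothetyMap_apply hd hdω hq he hT hTe hl hh
  obtain ⟨h1', h2'⟩ := isPureHomothetyMap_apply hd hdω hq he hT hTe hl hh'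
  funext x
  by_cases hx : x = ω
  · rw [hx, hh.map_omega, hh'.map_omega]
  by_cases hxe : x ∈ Set.range e
  · obtain ⟨t, rfl⟩ := hxe
    rw [h1, h1']
  · obtain ⟨c, t, s, hc, h0, rfl⟩ := hq.exists_coordinates hn he hT hTe hx hxe
    by_cases hs : s = 0
    · exact absurd ⟨0 + t, by rw [hs, h0, hTe]⟩ hxe
    · rw [h2 c t s hc h0 hs, h2' c t s hc h0 hs]

end Main

end MoebiusGauge

theorem mainTheorem9 {X : Type*} (M : MoebiusStructure X)
    (h_compact : M.Compact) (h_ptolemy : M.Ptolemy)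
    (h_EC : M.AxiomEC) (h_ER : M.AxiomER) (h_OC : M.AxiomOC) (h_OR : M.AxiomOR)
    (ω : X) (d : ExtMetric X) (hd : d ∈ M.metrics) (hdω : d.Remote ω)
    (o : X) (ho : o ≠ ω) (lam : ℝ) (hlam : 0 < lam) :
    (∃! h : X → X, M.IsPureHomothetyMap d ω o lam h) ∧
    ∀ h : X → X, M.IsPureHomothetyMap d ω o lam h →
      (∀ x y, x ≠ ω → y ≠ ω → d.dist (h x) (h y) = ENNReal.ofReal lam * d.dist x y) ∧
      IsMoebiusAutomorphism M h := by
  have hq := MoebiusGauge.isCGeom_factor hd h_ptolemy h_EC h_ER h_OC h_OR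
  have hn := MoebiusGauge.normalizedAt_factor hdω
  obtain ⟨e, he, rfl⟩ := hq.exists_cpar hn ho
  -- The three distinct points needed for the conformal factor are `e 0`, `ω` and `e 1`.
  have hP : MoebiusGauge.Proper d.factor ω :=
    MoebiusGauge.proper_factor hd hdω h_compact (he.1 0) (fun h01 =>
      zero_ne_one (he.injective MoebiusGauge.isProfile_sqrt hq.toIsGauge h01)) (he.1 1).symm
  obtain ⟨g, hg⟩ := hq.exists_dilation hn hP he hlam
  have hg' := hg.isPureHomothetyMap hd hdω hq he hlam
  refine ⟨⟨g, hg', fun h hh => MoebiusGauge.isPureHomothetyMap_unique hd hdω hq he hlam hh hg'⟩,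
    fun h hh => ?_⟩
  obtain rfl := MoebiusGauge.isPureHomothetyMap_unique hd hdω hq he hlam hh hg'
  refine ⟨fun x y hx hy => ?_, MoebiusGauge.isMoebiusAutomorphism_of_isMob hd
    (hg.bijective hq hn he hlam) (hg.isMob hq hn hlam)⟩
  rw [(MoebiusGauge.dist_eq_ofReal_factor hdω (hg.ne x hx) (hg.ne y hy)).2, hg.dist x y hx hy,
    ENNReal.ofReal_mul hlam.le, ← (MoebiusGauge.dist_eq_ofReal_factor hdω hx hy).2]
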